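/- \textbf{Setting.} Let $\mathcal H_A,\mathcal H_B$ be finite-dimensional complex Hilbert spaces, let $\Lambda(\cdot)=\sum_{k\in K}A_k(\cdot)A_k^\dagger$ be a quantum channel from $\mathcal H_A$ to $\mathcal H_B$ with finitely many Kraus operators ($\sum_kA_k^\dagger A_k=I$), and let $\rho$ be a density matrix on $\mathcal H_A$. Eve's (environment) output on an operator $X$ is $\mathcal E(X)=\sum_{k,l}\mathrm{Tr}(A_kXA_l^\dagger)\,|k\rangle\langle l|$; $\mathcal E_n$ denotes the same map for the Kraus operators $A_{k_1}\otimes\cdots\otimes A_{k_n}$ of $\Lambda^{\otimes n}$. Let $S(\rho)=-\mathrm{Tr}\,\rho\log_2\rho$, let $\|X\|=\mathrm{Tr}\sqrt{X^\dagger X}$ be the trace norm, and let $I_{coh}=S(\Lambda(\rho))-S(\mathcal E(\rho))$. Fix $\delta>0$. For $n\ge1$ let $\{|i\rangle\}$ be an orthonormal eigenbasis of $\rho^{\otimes n}$ with eigenvalues $p_i$, let $T=\{i: 2^{-n(S(\rho)+\delta)}\le p_i\le 2^{-n(S(\rho)-\delta)}\}$, $d=|T|$, $q_i=p_i/\sum_{j\in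 T}p_j$ and $\rho^{typ}=\sum_{i\in T}q_i|i\rangle\langle i|$. A \emph{random Lloyd code} of size $N$ consists of $N$ independent codewords $|\alpha\rangle=\sum_{i\in T}\sqrt{q_i}\,e^{\mathrm i\phi_i}|i\rangle$ with independent uniform phases $\phi_i$. A random \emph{uniform source-distorted code} of size $N$ consists of $N$ independent codewords $|\alpha\rangle=\sqrt d\,\sqrt{\rho^{typ}}\,|\phi\rangle$ with $|\phi\rangle$ uniform on the unit sphere of $\mathrm{span}\{|i\rangle: i\in T\}$. For a code $\{|\alpha\rangle\}_{\alpha=1}^N$ let $\psi_{ABE}=\big(\sum_\alpha\langle\alpha|\alpha\rangle\big)^{-1/2}\sum_{\alpha}\sum_{k\in K^n}|\psi_\alpha\rangle_A\otimes A_k|\alpha\rangle_B\otimes|k\rangle_E$ with $\{\psi_\alpha\}$ orthonormal and $A_k=A_{k_1}\otimes\cdots\otimes A_{k_n}$. Let $\sigma_E^\alpha$ be Eve's normalized state when a measurement of $A$ in the basis $\{\psi_\alpha\}$ gives $\alpha$ (that is, $\sigma_E^\alpha=\mathcal E_n(|\alpha\rangle\langle\alpha|)/\langle\alpha|\alpha\rangle$),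 let $\sigma_E$ be their average $\frac1N\sum_\alpha\sigma_E^\alpha$, and let $\chi_E=S(\sigma_E)-\frac1N\sum_\alpha S(\sigma_E^\alpha)$. \textbf{Proposition (privacy).} Let $0\le R<I_{coh}$ and $\delta>0$. There are $c>0$ and $n_0$, depending only on the channel, $\rho$, $R$ and $\delta$, such that for all $n\ge n_0$, for every choice of the eigenbasis, and with $N=\lfloor2^{nR}\rfloor$ and $\varepsilon=2^{-cn}$: for a random Lloyd code, and likewise for a random uniform source-distorted code, with probability at least $1-\varepsilon$ one has $$\frac1N\sum_{\alpha}\|\sigma_E^\alpha-\sigma_E\|\le\varepsilon\qquad\text{and}\qquad\chi_E\le\varepsilon .$$ On the same event, the first inequality also holds (a) with the average $\sigma_E$ replaced by the reduction of $\psi_{ABE}$ to $E$, and (b) with $\sigma_E^\alpha$ replaced by the operators $\mathcal E_n(|\alpha\rangle\langle\alpha|)$ and $\sigma_E$ by their average. (For Lloyd codes, whose codewords are unit vectors, these are all the same inequality.) -/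

import Mathlib

open MeasureTheory
open scoped ComplexConjugate ComplexOrder

noncomputable section

namespace QPrivacy

/-! ### Matrices, entropy, trace norm -/

/-- The tensor product `M 0 ⊗ ⋯ ⊗ M (n-1)`, in the product bases. -/
def tensorProd {a b : Type*} {n : ℕ} (M : Fin n → Matrix b a ℂ) :
    Matrix (Fin n → b) (Fin n → a) ℂ :=
  Matrix.of fun y x => ∏ t, M t (y t) (x t)

/-- Trace norm: the sum of the singular values, i.e. `Tr √(Xᴴ X)`. -/
def traceNorm {ι : Type*} [Fintype ι] [DecidableEq ι] (X : Matrix ι ι ℂ) : ℝ :=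
  ∑ i, √((Matrix.isHermitian_conjTranspose_mul_self X).eigenvalues i)

/-- Von Neumann entropy `-Tr ρ log₂ ρ` of a Hermitian matrix (by convention `0` on other
matrices, to which it is never applied). -/
def entropy {ι : Type*} [Fintype ι] [DecidableEq ι] (ρ : Matrix ι ι ℂ) : ℝ :=
  open Classical in
  if h : ρ.IsHermitian then ∑ i, Real.negMulLog (h.eigenvalues i) / Real.log 2 else 0

/-- `ρ` is a density matrix. -/
def IsState {ι : Type*} [Fintype ι] (ρ : Matrix ι ι ℂ) : Prop :=
  ρ.PosSemidef ∧ ρ.trace = 1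

/-- The rank-one operator `|v⟩⟨v|`. -/
def ketbra {ι : Type*} (v : EuclideanSpace ℂ ι) : Matrix ι ι ℂ :=
  Matrix.of fun i j => v i * conj (v j)

/-! ### Channels in Kraus form -/

section Channel

variable {a b κ : Type*} [Fintype a] [DecidableEq a] [Fintype b] [DecidableEq b]
  [Fintype κ] [DecidableEq κ]

/-- The operators `A k` are Kraus operators of a channel (trace preserving). -/
def IsKraus (A : κ → Matrix b a ℂ) : Prop :=
  ∑ k, (A k).conjTranspose * A k = 1

/-- Kraus operators `A_{k₁} ⊗ ⋯ ⊗ A_{kₙ}` of `n` independent uses of the channel. -/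
def krausPow (A : κ → Matrix b a ℂ) (n : ℕ) (k : Fin n → κ) :
    Matrix (Fin n → b) (Fin n → a) ℂ :=
  tensorProd fun t => A (k t)

/-- Bob's output `∑ₖ Aₖ ρ Aₖ†`. -/
def bobOutput (A : κ → Matrix b a ℂ) (ρ : Matrix a a ℂ) : Matrix b b ℂ :=
  ∑ k, A k * ρ * (A k).conjTranspose

/-- Eve's output `∑ₖₗ Tr(Aₖ ρ Aₗ†) |k⟩⟨l|`. -/
def eveOutput (A : κ → Matrix b a ℂ) (ρ : Matrix a a ℂ) : Matrix κ κ ℂ :=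
  Matrix.of fun k l => (A k * ρ * (A l).conjTranspose).trace

/-- Coherent information `S_B - S_E`. -/
def coherentInfo (A : κ → Matrix b a ℂ) (ρ : Matrix a a ℂ) : ℝ :=
  entropy (bobOutput A ρ) - entropy (eveOutput A ρ)

/-! ### The state shared by Alice, Bob and Eve for a given code -/

variable {N : ℕ}

/-- Amplitudes of
`ψ_ABE = (∑ₐ ⟨α|α⟩)^(-1/2) ∑ₐ ∑ₖ |ψₐ⟩_A ⊗ Aₖ|α⟩_B ⊗ |k⟩_E`,
where the orthonormal vectors `ψₐ` are the standard basis of Alice's register `ℂ^N` and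
`C α` is the codeword `|α⟩`. For codewords of unit length the prefactor is `1/√N`. -/
def psiABE (A : κ → Matrix b a ℂ) (C : Fin N → EuclideanSpace ℂ a) (α : Fin N) (y : b) (k : κ) :
    ℂ :=
  ((√(∑ β, ‖C β‖ ^ 2))⁻¹ : ℝ) * (A k).mulVec (C α).ofLp y

/-- `σ_E`, the reduction of `ψ_ABE` to Eve's system. -/
def sigmaE (A : κ → Matrix b a ℂ) (C : Fin N → EuclideanSpace ℂ a) : Matrix κ κ ℂ :=
  Matrix.of fun k l => ∑ α, ∑ y, psiABE A C α y k * conj (psiABE A C α y l)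

/-- `σ_E^α`, Eve's (normalized) state after the measurement of Alice's register in the basis
`ψₐ` has given the outcome `α`. -/
def sigmaEα (A : κ → Matrix b a ℂ) (C : Fin N → EuclideanSpace ℂ a) (α : Fin N) :
    Matrix κ κ ℂ :=
  ((∑ y, ∑ k, ‖psiABE A C α y k‖ ^ 2)⁻¹ : ℝ) •
    Matrix.of fun k l => ∑ y, psiABE A C α y k * conj (psiABE A C α y l)

/-- The uniform average `(1/N) ∑ₐ σₐ`. -/
def average (σ : Fin N → Matrix κ κ ℂ) : Matrix κ κ ℂ :=
  (N : ℝ)⁻¹ • ∑ α, σ α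

/-- The average trace distance `(1/N) ∑ₐ ‖σₐ - τ‖`. -/
def avgDist (σ : Fin N → Matrix κ κ ℂ) (τ : Matrix κ κ ℂ) : ℝ :=
  (N : ℝ)⁻¹ * ∑ α, traceNorm (σ α - τ)

/-- The Holevo quantity `χ({1/N, σₐ}) = S((1/N) ∑ₐ σₐ) - (1/N) ∑ₐ S(σₐ)`. -/
def holevo (σ : Fin N → Matrix κ κ ℂ) : ℝ :=
  entropy (average σ) - (N : ℝ)⁻¹ * ∑ α, entropy (σ α)

/-- The code `C` is `ε`-private against Eve. When the codewords have unit length, the first three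
inequalities coincide. Otherwise the first one is about the operators
`∑ₖₗ Tr(Aₖ|α⟩⟨α|Aₗ†)|k⟩⟨l|` and their average, and the other two are about Eve's states `σ_E^α`,
compared with their average and with the reduction `σ_E` of `ψ_ABE`
(in which `σ_E^α` has the weight `⟨α|α⟩ / ∑ ⟨β|β⟩`). -/
def IsPrivate (A : κ → Matrix b a ℂ) (C : Fin N → EuclideanSpace ℂ a) (ε : ℝ) : Prop :=
  avgDist (fun α => eveOutput A (ketbra (C α))) (average fun α => eveOutput A (ketbra (C α))) ≤ ε ∧
  avgDist (sigmaEα A C) (average (sigmaEα A C)) ≤ ε ∧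
  avgDist (sigmaEα A C) (sigmaE A C) ≤ ε ∧
  holevo (sigmaEα A C) ≤ ε

end Channel

/-! ### Typical subspace of the source and random codes -/

section Codes

variable {a : Type*} [Fintype a] [DecidableEq a] {n : ℕ}

/-- `e` is an orthonormal eigenbasis of `ρ^{⊗n}`, with eigenvalues `p`. -/
def IsSourceEigenbasis (ρ : Matrix a a ℂ)
    (e : OrthonormalBasis (Fin n → a) ℂ (EuclideanSpace ℂ (Fin n → a)))
    (p : (Fin n → a) → ℝ) : Prop :=
  ∀ i, (tensorProd fun _ : Fin n => ρ).mulVec (e i).ofLp = (p i : ℂ) • (e i).ofLp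

/-- The indices `i` of the eigenvectors that span the `δ`-typical subspace:
`2^{-n(S+δ)} ≤ p i ≤ 2^{-n(S-δ)}`. -/
def typical (S δ : ℝ) (p : (Fin n → a) → ℝ) : Finset (Fin n → a) :=
  open Classical in
  Finset.univ.filter fun i =>
    (2 : ℝ) ^ (-(n : ℝ) * (S + δ)) ≤ p i ∧ p i ≤ (2 : ℝ) ^ (-(n : ℝ) * (S - δ))

/-- The eigenvalues `q i = p i / ∑ⱼ p j` (`i`, `j` typical) of the normalized typical state. -/
def typWeight (T : Finset (Fin n → a)) (p : (Fin n → a) → ℝ) (i : Fin n → a) : ℝ :=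
  p i / ∑ j ∈ T, p j

/-- The codeword `∑_{i ∈ T} √(q i) e^{2π√-1 θ i} |i⟩`. -/
def lloydCodeword (e : OrthonormalBasis (Fin n → a) ℂ (EuclideanSpace ℂ (Fin n → a)))
    (T : Finset (Fin n → a)) (p : (Fin n → a) → ℝ) (θ : (Fin n → a) → UnitAddCircle) :
    EuclideanSpace ℂ (Fin n → a) :=
  ∑ i ∈ T, (((√(typWeight T p i) : ℝ) : ℂ) * (AddCircle.toCircle (θ i) : ℂ)) • e i

/-- Independent uniform phases for `N` independent codewords. -/
def lloydLaw (a : Type*) [Fintype a] (n N : ℕ) :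
    Measure (Fin N → (Fin n → a) → UnitAddCircle) :=
  Measure.pi fun _ => Measure.pi fun _ => volume

/-- The uniform probability measure on the unit sphere of `ℂ^ι`. -/
def uniformSphere (ι : Type*) [Fintype ι] :
    Measure (Metric.sphere (0 : EuclideanSpace ℂ ι) 1) :=
  ((volume : Measure (EuclideanSpace ℂ ι)).toSphere Set.univ)⁻¹ •
    (volume : Measure (EuclideanSpace ℂ ι)).toSphere

/-- The codeword `√d √ρ_typ |φ⟩`, where `φ = ∑_{i ∈ T} φ i |i⟩` is a unit vector of the typical
subspace and `d` the dimension of that subspace: `√ρ_typ |i⟩ = √(q i) |i⟩`. -/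
def distortedCodeword (e : OrthonormalBasis (Fin n → a) ℂ (EuclideanSpace ℂ (Fin n → a)))
    (T : Finset (Fin n → a)) (p : (Fin n → a) → ℝ)
    (φ : Metric.sphere (0 : EuclideanSpace ℂ T) 1) : EuclideanSpace ℂ (Fin n → a) :=
  ∑ i : T, (((√(T.card : ℝ) * √(typWeight T p i) : ℝ) : ℂ) * φ.1 i) • e i

/-- Independent uniform unit vectors of the typical subspace, for `N` independent codewords. -/
def distortedLaw (T : Finset (Fin n → a)) (N : ℕ) :
    Measure (Fin N → Metric.sphere (0 : EuclideanSpace ℂ T) 1) :=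
  Measure.pi fun _ => uniformSphere T

end Codes

end QPrivacy

end

/-! Eve's output on a random codeword is `Ψ Ψᴴ` with `Ψ = ∑ cᵢ Wᵢ`. The `cᵢ` are the random
coefficients: phases for Lloyd codes, `√d` times the coordinates of a random unit vector for
source-distorted codes. `Wᵢ` is `√qᵢ` times the array of amplitudes of `A_k|i⟩`, with rows indexed
by Eve and columns by Bob. The mean is the fixed operator `θ = ∑ Wᵢ Wᵢᴴ`, Eve's output on `ρ^typ`.
The heart of the proof is that the mean of `‖Ψ Ψᴴ - θ‖` is exponentially small once the coherent
information is positive. This concerns a single codeword: an average over `N` identically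
distributed codewords has the same mean, whatever `N ≥ 1` is, and Markov's inequality finishes.

The decoupling is a second-moment computation. In eigenbases of the outputs of Bob and Eve, delete
Eve's rows of too small probability and Bob's columns of too large probability. By Chernoff's bound
this removes exponentially little weight (`exists_decoupling_rate_of_diagonal`). At most
`2^{n(S_E+η)}` rows survive, and on the surviving columns Bob's operator has norm at most
`2·2^{-n(S_B-η)}`. The two ensembles share the moments recorded in `HasCodeMoments`
(`hasCodeMoments_toCircle`, `hasCodeMoments_sphere`). These bound the Hilbert–Schmidt variance of
the truncated output by `∑ ‖Gᵢ Gⱼᴴ‖²` (`HasCodeMoments.integral_hsSq_output`), hence by the norm of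
Bob's operator. Cauchy–Schwarz over the surviving rows converts this to trace norm
(`HasCodeMoments.exists_dominating`), giving order `2^{-n(S_B-S_E-2η)/2}`.

Closeness to `θ` then implies every clause of privacy (`isPrivate_of_avgDist_le`). Normalizing a
codeword costs a factor 2, because `θ` has trace one. The Holevo quantity is controlled by a
Fannes-type inequality (`entropy_sub_le`), whose dimension factor is only linear in `n`. -/

namespace QPrivacy

open Matrix

/-! ### Hilbert–Schmidt norm -/

section HilbertSchmidt

variable {l m n : Type*} [Fintype l] [Fintype m] [Fintype n]

/-- The squared Hilbert–Schmidt norm of a matrix. -/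
noncomputable def hsSq (X : Matrix m n ℂ) : ℝ := ∑ i, ∑ j, ‖X i j‖ ^ 2

lemma hsSq_nonneg (X : Matrix m n ℂ) : 0 ≤ hsSq X := by unfold hsSq; positivity

lemma trace_mul_conjTranspose_self (X : Matrix m n ℂ) : (X * Xᴴ).trace = (hsSq X : ℂ) := by
  simp only [Matrix.trace, Matrix.diag, Matrix.mul_apply, Matrix.conjTranspose_apply, hsSq,
    Complex.ofReal_sum, Complex.ofReal_pow]
  refine Finset.sum_congr rfl fun i _ => Finset.sum_congr rfl fun j _ => ?_
  exact Complex.mul_conj' _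

lemma trace_conjTranspose_mul_self (X : Matrix m n ℂ) : (Xᴴ * X).trace = (hsSq X : ℂ) := by
  rw [Matrix.trace_mul_comm, trace_mul_conjTranspose_self]

lemma hsSq_conjTranspose (X : Matrix m n ℂ) : hsSq Xᴴ = hsSq X := by
  have h := trace_mul_conjTranspose_self Xᴴ
  rw [conjTranspose_conjTranspose, trace_conjTranspose_mul_self] at h
  exact_mod_cast h.symm

lemma norm_trace_mul_conjTranspose_le (X Y : Matrix m n ℂ) :
    ‖(X * Yᴴ).trace‖ ≤ √(hsSq X) * √(hsSq Y) := by
  have h1 : ‖(X * Yᴴ).trace‖ ≤ ∑ p : m × n, ‖X p.1 p.2‖ * ‖Y p.1 p.2‖ := by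
    rw [Fintype.sum_prod_type]
    refine (norm_sum_le _ _).trans (Finset.sum_le_sum fun i _ => ?_)
    simp only [Matrix.diag, Matrix.mul_apply, Matrix.conjTranspose_apply]
    refine (norm_sum_le _ _).trans (Finset.sum_le_sum fun j _ => ?_)
    simp
  refine h1.trans ((Real.sum_mul_le_sqrt_mul_sqrt _ _ _).trans (le_of_eq ?_))
  simp only [hsSq, Fintype.sum_prod_type]

lemma norm_dotProduct_star_le (x y : n → ℂ) :
    ‖star x ⬝ᵥ y‖ ≤ √(∑ i, ‖x i‖ ^ 2) * √(∑ i, ‖y i‖ ^ 2) := by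
  refine le_trans ?_ (Real.sum_mul_le_sqrt_mul_sqrt _ _ _)
  refine (norm_sum_le _ _).trans (Finset.sum_le_sum fun i _ => ?_)
  simp

lemma dotProduct_star_self_eq (x : n → ℂ) : star x ⬝ᵥ x = ((∑ i, ‖x i‖ ^ 2 : ℝ) : ℂ) := by
  simp only [dotProduct, Pi.star_apply, Complex.ofReal_sum, Complex.ofReal_pow]
  exact Finset.sum_congr rfl fun i _ => Complex.conj_mul' _

end HilbertSchmidt

/-! ### Contractions -/

section Contraction

variable {m n : Type*} [Fintype m] [Fintype n]

/-- `U` does not increase the Euclidean norm. -/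
def IsContraction (U : Matrix m m ℂ) : Prop :=
  ∀ x : m → ℂ, ∑ i, ‖(U *ᵥ x) i‖ ^ 2 ≤ ∑ i, ‖x i‖ ^ 2

lemma IsContraction.hsSq_mul_le {U : Matrix m m ℂ} (hU : IsContraction U) (X : Matrix m n ℂ) :
    hsSq (U * X) ≤ hsSq X := by
  unfold hsSq
  rw [Finset.sum_comm, Finset.sum_comm (γ := m)]
  exact Finset.sum_le_sum fun j _ => hU fun i => X i j

lemma sum_norm_sq_mulVec_of_isometry [DecidableEq m] {U : Matrix m m ℂ} (hU : Uᴴ * U = 1)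
    (x : m → ℂ) : ∑ i, ‖(U *ᵥ x) i‖ ^ 2 = ∑ i, ‖x i‖ ^ 2 := by
  have h : star (U *ᵥ x) ⬝ᵥ (U *ᵥ x) = star x ⬝ᵥ x := by
    rw [star_mulVec, ← dotProduct_mulVec, mulVec_mulVec, hU, one_mulVec]
  rw [dotProduct_star_self_eq, dotProduct_star_self_eq] at h
  exact_mod_cast h

lemma isContraction_of_isometry [DecidableEq m] {U : Matrix m m ℂ} (hU : Uᴴ * U = 1) :
    IsContraction U :=
  fun x => (sum_norm_sq_mulVec_of_isometry hU x).le

lemma IsContraction.mul {U V : Matrix m m ℂ} (hU : IsContraction U) (hV : IsContraction V) :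
    IsContraction (U * V) := fun x => by
  rw [← mulVec_mulVec]
  exact (hU _).trans (hV x)

lemma isContraction_diagonal [DecidableEq m] {d : m → ℂ} (hd : ∀ i, ‖d i‖ ≤ 1) :
    IsContraction (diagonal d) := fun x => by
  refine Finset.sum_le_sum fun i _ => ?_
  rw [mulVec_diagonal, norm_mul]
  have := mul_le_mul_of_nonneg_right (hd i) (norm_nonneg (x i))
  rw [one_mul] at this
  gcongr

/-- The adjoint of a partial isometry whose initial projection is diagonal is a contraction. -/
lemma isContraction_conjTranspose [DecidableEq m] {Y : Matrix m m ℂ} {d : m → ℂ}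
    (hY : Yᴴ * Y = diagonal d) (hd : ∀ i, ‖d i‖ ≤ 1) : IsContraction Yᴴ := fun x => by
  set z := Yᴴ *ᵥ x with hz
  have hzY : star x ᵥ* Y = star z := by rw [hz, star_mulVec, conjTranspose_conjTranspose]
  have h2 : ∑ i, ‖(Y *ᵥ z) i‖ ^ 2 ≤ ∑ i, ‖z i‖ ^ 2 := by
    have e : star (Y *ᵥ z) ⬝ᵥ (Y *ᵥ z) = star z ⬝ᵥ (diagonal d *ᵥ z) := by
      rw [star_mulVec, ← dotProduct_mulVec, mulVec_mulVec, hY]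
    rw [dotProduct_star_self_eq] at e
    have h3 := norm_dotProduct_star_le z (diagonal d *ᵥ z)
    rw [← e, Complex.norm_real, Real.norm_of_nonneg (by positivity)] at h3
    have h4 := Real.sqrt_le_sqrt (isContraction_diagonal hd z)
    calc _ ≤ _ := h3
      _ ≤ √(∑ i, ‖z i‖ ^ 2) * √(∑ i, ‖z i‖ ^ 2) := by gcongr
      _ = _ := Real.mul_self_sqrt (by positivity)
  have e2 : star x ⬝ᵥ (Y *ᵥ z) = ((∑ i, ‖z i‖ ^ 2 : ℝ) : ℂ) := by
    rw [dotProduct_mulVec, hzY, dotProduct_star_self_eq]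
  have h5 := norm_dotProduct_star_le x (Y *ᵥ z)
  rw [e2, Complex.norm_real, Real.norm_of_nonneg (by positivity)] at h5
  have h6 := h5.trans (mul_le_mul_of_nonneg_left (Real.sqrt_le_sqrt h2) (Real.sqrt_nonneg _))
  have ha : 0 ≤ ∑ i, ‖z i‖ ^ 2 := by positivity
  have hb : 0 ≤ ∑ i, ‖x i‖ ^ 2 := by positivity
  by_contra! hlt
  have h7 : √(∑ i, ‖x i‖ ^ 2) < √(∑ i, ‖z i‖ ^ 2) := Real.sqrt_lt_sqrt hb hlt
  have h8 := Real.mul_self_sqrt ha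
  nlinarith [Real.sqrt_nonneg (∑ i, ‖x i‖ ^ 2)]

end Contraction

/-! ### Trace norm -/

section TraceNorm

variable {m n : Type*} [Fintype m] [DecidableEq m] [Fintype n]

lemma exists_unitary_diagonal {M : Matrix m m ℂ} (h : M.IsHermitian) :
    ∃ U : Matrix m m ℂ, Uᴴ * U = 1 ∧ U * Uᴴ = 1 ∧
      M = U * diagonal (fun i => (h.eigenvalues i : ℂ)) * Uᴴ := by
  refine ⟨h.eigenvectorUnitary, ?_, ?_, ?_⟩
  · simpa [star_eq_conjTranspose] using Unitary.coe_star_mul_self h.eigenvectorUnitary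
  · simpa [star_eq_conjTranspose] using Unitary.coe_mul_star_self h.eigenvectorUnitary
  · have := h.spectral_theorem
    rwa [Unitary.conjStarAlgAut_apply] at this

lemma traceNorm_nonneg (X : Matrix m m ℂ) : 0 ≤ traceNorm X :=
  Finset.sum_nonneg fun _ _ => Real.sqrt_nonneg _

/-- One half of the duality between trace norm and contractions. In an eigenbasis `vᵢ` of `Xᴴ X` the
trace is `∑ ⟨vᵢ, U X vᵢ⟩`, and `‖X vᵢ‖` is the `i`-th singular value. -/
lemma IsContraction.norm_trace_mul_le {U : Matrix m m ℂ} (hU : IsContraction U)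
    (X : Matrix m m ℂ) : ‖(U * X).trace‖ ≤ traceNorm X := by
  obtain ⟨V, hV1, hV2, hV⟩ := exists_unitary_diagonal (isHermitian_conjTranspose_mul_self X)
  set lam := (isHermitian_conjTranspose_mul_self X).eigenvalues with hlam
  have e1 : (U * X).trace = (Vᴴ * (U * X * V)).trace := by
    rw [trace_mul_comm Vᴴ, Matrix.mul_assoc, hV2, Matrix.mul_one]
  have hD : (X * V)ᴴ * (X * V) = diagonal fun i => (lam i : ℂ) := by
    rw [conjTranspose_mul, Matrix.mul_assoc, ← Matrix.mul_assoc Xᴴ, hV]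
    simp only [← Matrix.mul_assoc]
    rw [hV1, Matrix.one_mul, Matrix.mul_assoc, hV1, Matrix.mul_one]
  have hcol : ∀ i, ∑ j, ‖(X * V) j i‖ ^ 2 = lam i := fun i => by
    have := congrFun (congrFun hD i) i
    rw [diagonal_apply_eq, Matrix.mul_apply] at this
    have h2 : ((∑ j, ‖(X * V) j i‖ ^ 2 : ℝ) : ℂ) = lam i := by
      rw [← this]
      push_cast
      exact Finset.sum_congr rfl fun j _ => (Complex.conj_mul' _).symm
    exact_mod_cast h2
  have hVcol : ∀ i, ∑ j, ‖V j i‖ ^ 2 = 1 := fun i => by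
    have := congrFun (congrFun hV1 i) i
    rw [one_apply_eq, Matrix.mul_apply] at this
    have h2 : ((∑ j, ‖V j i‖ ^ 2 : ℝ) : ℂ) = 1 := by
      rw [← this]
      push_cast
      exact Finset.sum_congr rfl fun j _ => (Complex.conj_mul' _).symm
    exact_mod_cast h2
  rw [e1]
  refine (norm_sum_le _ _).trans (Finset.sum_le_sum fun i _ => ?_)
  have e2 : (Vᴴ * (U * X * V)).diag i = star (fun j => V j i) ⬝ᵥ (U *ᵥ fun j => (X * V) j i) := by
    rw [Matrix.diag, Matrix.mul_apply, Matrix.mul_assoc]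
    rfl
  rw [e2]
  refine (norm_dotProduct_star_le _ _).trans ?_
  rw [hVcol, Real.sqrt_one, one_mul]
  refine Real.sqrt_le_sqrt ((hU _).trans ?_)
  rw [hcol]

/-- The other half of the duality: the adjoint of the polar part of `X` attains the supremum.
Together the two halves yield the triangle inequality and the other norm properties below.
Contractions are used instead of unitaries because the polar part of a singular matrix is only a
partial isometry. -/
lemma exists_contraction_trace_eq (X : Matrix m m ℂ) :
    ∃ U : Matrix m m ℂ, IsContraction U ∧ (U * X).trace = traceNorm X := by
  obtain ⟨V, hV1, hV2, hV⟩ := exists_unitary_diagonal (isHermitian_conjTranspose_mul_self X)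
  have hpos : ∀ i, 0 ≤ (isHermitian_conjTranspose_mul_self X).eigenvalues i :=
    fun i => (posSemidef_conjTranspose_mul_self X).eigenvalues_nonneg i
  unfold traceNorm
  set lam := (isHermitian_conjTranspose_mul_self X).eigenvalues with hlam
  have hD : (X * V)ᴴ * (X * V) = diagonal fun i => (lam i : ℂ) := by
    rw [conjTranspose_mul, Matrix.mul_assoc, ← Matrix.mul_assoc Xᴴ, hV]
    simp only [← Matrix.mul_assoc]
    rw [hV1, Matrix.one_mul, Matrix.mul_assoc, hV1, Matrix.mul_one]
  -- Since `0⁻¹ = 0`, this is the pseudo-inverse of the singular values, and `Yᴴ Y` below is a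
  -- diagonal projection.
  set D : Matrix m m ℂ := diagonal fun i => (((√(lam i))⁻¹ : ℝ) : ℂ) with hDdef
  have hDH : Dᴴ = D := by
    rw [hDdef, diagonal_conjTranspose]
    congr 1
    ext i
    simp
  set Y := X * V * D with hY
  have hYY : Yᴴ * Y = diagonal fun i => (((√(lam i))⁻¹ * lam i * (√(lam i))⁻¹ : ℝ) : ℂ) := by
    rw [hY, conjTranspose_mul, hDH, Matrix.mul_assoc, ← Matrix.mul_assoc _ (X * V), hD, hDdef,
      diagonal_mul_diagonal, diagonal_mul_diagonal]
    congr 1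
    ext i
    push_cast
    ring
  have hle : ∀ i, ‖(((√(lam i))⁻¹ * lam i * (√(lam i))⁻¹ : ℝ) : ℂ)‖ ≤ 1 := fun i => by
    rw [Complex.norm_real]
    rcases (hpos i).eq_or_lt with h | h
    · simp [← h]
    · have h1 := Real.sqrt_pos.2 h
      have h2 : (√(lam i))⁻¹ * lam i * (√(lam i))⁻¹ = 1 := by
        nth_rw 2 [← Real.mul_self_sqrt h.le]
        field_simp
      rw [h2]
      simp
  refine ⟨V * Yᴴ, (isContraction_of_isometry hV1).mul (isContraction_conjTranspose hYY hle), ?_⟩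
  have e : (V * Yᴴ * X).trace = (D * ((X * V)ᴴ * (X * V))).trace := by
    rw [Matrix.mul_assoc, trace_mul_comm, hY, conjTranspose_mul, hDH]
    simp only [Matrix.mul_assoc]
  rw [e, hD, hDdef, diagonal_mul_diagonal, trace_diagonal]
  push_cast
  refine Finset.sum_congr rfl fun i _ => ?_
  norm_cast
  rw [inv_mul_eq_div, Real.div_sqrt]

lemma traceNorm_add_le (X Y : Matrix m m ℂ) : traceNorm (X + Y) ≤ traceNorm X + traceNorm Y := by
  obtain ⟨U, hU, h⟩ := exists_contraction_trace_eq (X + Y)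
  have h2 : traceNorm (X + Y) = ‖(U * (X + Y)).trace‖ := by
    rw [h, Complex.norm_real, Real.norm_of_nonneg (traceNorm_nonneg _)]
  rw [h2, Matrix.mul_add, trace_add]
  exact (norm_add_le _ _).trans (add_le_add (hU.norm_trace_mul_le X) (hU.norm_trace_mul_le Y))

lemma traceNorm_smul_le (r : ℝ) (X : Matrix m m ℂ) :
    traceNorm (r • X) ≤ |r| * traceNorm X := by
  obtain ⟨U, hU, h⟩ := exists_contraction_trace_eq (r • X)
  have h2 : traceNorm (r • X) = ‖(U * (r • X)).trace‖ := by
    rw [h, Complex.norm_real, Real.norm_of_nonneg (traceNorm_nonneg _)]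
  rw [h2, Matrix.mul_smul, trace_smul, norm_smul, Real.norm_eq_abs]
  exact mul_le_mul_of_nonneg_left (hU.norm_trace_mul_le X) (abs_nonneg _)

@[simp]
lemma traceNorm_zero : traceNorm (0 : Matrix m m ℂ) = 0 := by
  have h := traceNorm_smul_le 0 (0 : Matrix m m ℂ)
  rw [smul_zero, abs_zero, zero_mul] at h
  exact h.antisymm (traceNorm_nonneg _)

lemma traceNorm_sub_comm (X Y : Matrix m m ℂ) : traceNorm (X - Y) = traceNorm (Y - X) := by
  have h : ∀ X Y : Matrix m m ℂ, traceNorm (X - Y) ≤ traceNorm (Y - X) := fun X Y => by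
    have := traceNorm_smul_le (-1) (Y - X)
    simpa using this
  exact (h X Y).antisymm (h Y X)

lemma traceNorm_sub_le (X Y Z : Matrix m m ℂ) :
    traceNorm (X - Z) ≤ traceNorm (X - Y) + traceNorm (Y - Z) := by
  simpa using traceNorm_add_le (X - Y) (Y - Z)

lemma traceNorm_sum_le {ι : Type*} (s : Finset ι) (X : ι → Matrix m m ℂ) :
    traceNorm (∑ i ∈ s, X i) ≤ ∑ i ∈ s, traceNorm (X i) :=
  Finset.le_sum_of_subadditive _ traceNorm_zero.le traceNorm_add_le s X

lemma norm_trace_le_traceNorm (X : Matrix m m ℂ) : ‖X.trace‖ ≤ traceNorm X := by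
  have h : IsContraction (1 : Matrix m m ℂ) := isContraction_of_isometry (by simp)
  simpa using h.norm_trace_mul_le X

/-- Hölder's inequality with exponents 2 and 2: by duality it reduces to Cauchy–Schwarz, as a
contraction does not increase the Hilbert–Schmidt norm. -/
lemma traceNorm_mul_conjTranspose_le (X Y : Matrix m n ℂ) :
    traceNorm (X * Yᴴ) ≤ √(hsSq X) * √(hsSq Y) := by
  obtain ⟨U, hU, h⟩ := exists_contraction_trace_eq (X * Yᴴ)
  have h2 : traceNorm (X * Yᴴ) = ‖(U * (X * Yᴴ)).trace‖ := by
    rw [h, Complex.norm_real, Real.norm_of_nonneg (traceNorm_nonneg _)]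
  rw [h2, ← Matrix.mul_assoc]
  exact (norm_trace_mul_conjTranspose_le _ _).trans
    (mul_le_mul_of_nonneg_right (Real.sqrt_le_sqrt (hU.hsSq_mul_le X)) (Real.sqrt_nonneg _))

lemma traceNorm_mul_conjTranspose_self (X : Matrix m n ℂ) : traceNorm (X * Xᴴ) = hsSq X := by
  refine le_antisymm ?_ ?_
  · exact (traceNorm_mul_conjTranspose_le X X).trans (Real.mul_self_sqrt (hsSq_nonneg _)).le
  · have h := norm_trace_le_traceNorm (X * Xᴴ)
    rwa [trace_mul_conjTranspose_self, Complex.norm_real,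
      Real.norm_of_nonneg (hsSq_nonneg _)] at h

/-- A matrix whose rows outside `s` vanish has trace norm at most `√|s|` times its
Hilbert–Schmidt norm. -/
lemma traceNorm_le_of_support (s : Finset m) (X : Matrix m m ℂ)
    (hX : ∀ i, i ∉ s → ∀ j, X i j = 0) : traceNorm X ≤ √(s.card : ℝ) * √(hsSq X) := by
  set P : Matrix m m ℂ := diagonal fun i => if i ∈ s then 1 else 0 with hP
  have e : X = P * Xᴴᴴ := by
    ext i j
    rw [conjTranspose_conjTranspose, hP, diagonal_mul]
    split_ifs with h
    · simp
    · simp [hX i h j]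
  have hPs : hsSq P = s.card := by
    have : ∀ i j : m, ‖P i j‖ ^ 2 = if i = j then (if i ∈ s then (1 : ℝ) else 0) else 0 := by
      intro i j
      rw [hP, diagonal_apply]
      split_ifs <;> simp
    simp [hsSq, this]
  calc traceNorm X = traceNorm (P * Xᴴᴴ) := congrArg _ e
    _ ≤ √(hsSq P) * √(hsSq Xᴴ) := traceNorm_mul_conjTranspose_le _ _
    _ = _ := by rw [hPs, hsSq_conjTranspose]

lemma traceNorm_unitary_conj_le {W : Matrix m m ℂ} (hW : Wᴴ * W = 1) (X : Matrix m m ℂ) :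
    traceNorm (W * X * Wᴴ) ≤ traceNorm X := by
  have hW2 : W * Wᴴ = 1 := mul_eq_one_comm.1 hW
  obtain ⟨U, hU, h⟩ := exists_contraction_trace_eq (W * X * Wᴴ)
  have h2 : traceNorm (W * X * Wᴴ) = ‖(U * (W * X * Wᴴ)).trace‖ := by
    rw [h, Complex.norm_real, Real.norm_of_nonneg (traceNorm_nonneg _)]
  have e : (U * (W * X * Wᴴ)).trace = (Wᴴ * U * W * X).trace := by
    rw [← Matrix.mul_assoc, trace_mul_comm]
    simp only [Matrix.mul_assoc]
  rw [h2, e]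
  refine (((isContraction_of_isometry ?_).mul hU).mul
    (isContraction_of_isometry hW)).norm_trace_mul_le X
  rwa [conjTranspose_conjTranspose]

/-- The diagonal entries of `X` in an orthonormal basis sum to at most the trace norm. -/
lemma sum_norm_diag_le_traceNorm {W : Matrix m m ℂ} (hW : Wᴴ * W = 1) (X : Matrix m m ℂ) :
    ∑ i, ‖(Wᴴ * X * W) i i‖ ≤ traceNorm X := by
  set Y := Wᴴ * X * W with hY
  have hYX : traceNorm Y ≤ traceNorm X := by
    have hW2 : W * Wᴴ = 1 := mul_eq_one_comm.1 hW
    have := traceNorm_unitary_conj_le (W := Wᴴ) (by rwa [conjTranspose_conjTranspose]) X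
    rwa [conjTranspose_conjTranspose] at this
  refine le_trans ?_ hYX
  -- A diagonal contraction that rotates every diagonal entry of `Y` to its modulus.
  set u : m → ℂ := fun i => if Y i i = 0 then 0 else conj (Y i i) / ‖Y i i‖ with hu
  have hu1 : ∀ i, ‖u i‖ ≤ 1 := fun i => by
    simp only [hu]
    split_ifs with h
    · simp
    · simp [h]
  have hu2 : ∀ i, u i * Y i i = ‖Y i i‖ := fun i => by
    simp only [hu]
    split_ifs with h
    · simp [h]
    · have : (‖Y i i‖ : ℂ) ≠ 0 := by exact_mod_cast norm_ne_zero_iff.2 h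
      rw [div_mul_eq_mul_div, Complex.conj_mul', pow_two, mul_div_assoc, div_self this, mul_one]
  have h := (isContraction_diagonal hu1).norm_trace_mul_le Y
  have e : (diagonal u * Y).trace = ((∑ i, ‖Y i i‖ : ℝ) : ℂ) := by
    simp only [Matrix.trace, Matrix.diag, diagonal_mul, hu2, Complex.ofReal_sum]
  rwa [e, Complex.norm_real, Real.norm_of_nonneg (by positivity)] at h

end TraceNorm

/-! ### Continuity of the entropy -/

section Entropy

lemma negMulLog_add_le {x y : ℝ} (hx : 0 ≤ x) (hy : 0 ≤ y) :
    Real.negMulLog (x + y) ≤ Real.negMulLog x + Real.negMulLog y := by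
  rcases hx.eq_or_lt with rfl | hx
  · simp
  rcases hy.eq_or_lt with rfl | hy
  · simp
  have h1 : Real.log x ≤ Real.log (x + y) := Real.log_le_log hx (by linarith)
  have h2 : Real.log y ≤ Real.log (x + y) := Real.log_le_log hy (by linarith)
  simp only [Real.negMulLog]
  nlinarith

/-- Concave functions lie below their tangents: this is `e^x ≥ 1 + x` at `x = -L - log u`,
multiplied by `u`. The free slope `L` is later taken proportional to `n`, so that the constant term
beats the dimension of Eve's system. -/
lemma negMulLog_le_mul_add_exp {u : ℝ} (hu : 0 ≤ u) (L : ℝ) :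
    Real.negMulLog u ≤ u * L + Real.exp (-L) := by
  rcases hu.eq_or_lt with rfl | hu
  · simp [Real.exp_nonneg]
  have h := Real.add_one_le_exp (-L - Real.log u)
  have h2 : Real.exp (-L - Real.log u) * u = Real.exp (-L) := by
    rw [Real.exp_sub, Real.exp_log hu, div_mul_cancel₀ _ hu.ne']
  simp only [Real.negMulLog]
  nlinarith

/-- For `x ≥ y` subadditivity reduces to the tangent bound at `x - y`. For `x ≤ y ≤ 1` the
derivative `-log t - 1` is at least `-1` on `(0, 1]`, so the difference is at most `y - x`. -/
lemma negMulLog_sub_le {x y : ℝ} (hx : 0 ≤ x) (hy : 0 ≤ y) (hy1 : y ≤ 1) (L : ℝ)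
    (hL : 0 ≤ L) :
    Real.negMulLog x - Real.negMulLog y ≤ |x - y| * (L + 1) + Real.exp (-L) := by
  rcases le_total y x with h | h
  · have h1 := negMulLog_add_le hy (sub_nonneg.2 h)
    rw [add_sub_cancel] at h1
    have h2 := negMulLog_le_mul_add_exp (sub_nonneg.2 h) L
    rw [abs_of_nonneg (sub_nonneg.2 h)]
    linarith
  · rw [abs_of_nonpos (sub_nonpos.2 h)]
    have key : Real.negMulLog x - Real.negMulLog y ≤ y - x := by
      rcases hx.eq_or_lt with rfl | hx
      · have := Real.negMulLog_nonneg hy hy1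
        simp
        linarith
      · have hy0 : 0 < y := hx.trans_le h
        have h1 := Real.add_one_le_exp (Real.log y - Real.log x)
        rw [Real.exp_sub, Real.exp_log hx, Real.exp_log hy0] at h1
        have h2 : x * (y / x) = y := by field_simp
        have h3 : Real.log y ≤ 0 := Real.log_nonpos hy hy1
        simp only [Real.negMulLog]
        nlinarith
    have := Real.exp_nonneg (-L)
    nlinarith

variable {m : Type*} [Fintype m] [DecidableEq m]

lemma sum_norm_sq_row_of_unitary {U : Matrix m m ℂ} (hU : U * Uᴴ = 1) (i : m) :
    ∑ j, ‖U i j‖ ^ 2 = 1 := by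
  have := congrFun (congrFun hU i) i
  rw [one_apply_eq, Matrix.mul_apply] at this
  have h2 : ((∑ j, ‖U i j‖ ^ 2 : ℝ) : ℂ) = 1 := by
    rw [← this]
    push_cast
    exact Finset.sum_congr rfl fun j _ => (Complex.mul_conj' _).symm
  exact_mod_cast h2

lemma sum_norm_sq_col_of_unitary {U : Matrix m m ℂ} (hU : Uᴴ * U = 1) (j : m) :
    ∑ i, ‖U i j‖ ^ 2 = 1 := by
  simpa using sum_norm_sq_row_of_unitary (U := Uᴴ) (by rwa [conjTranspose_conjTranspose]) j

lemma conj_diagonal_apply_self (V : Matrix m m ℂ) (d : m → ℝ) (j : m) :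
    (V * diagonal (fun i => (d i : ℂ)) * Vᴴ) j j = ((∑ i, ‖V j i‖ ^ 2 * d i : ℝ) : ℂ) := by
  rw [Matrix.mul_apply]
  push_cast
  refine Finset.sum_congr rfl fun i _ => ?_
  rw [mul_diagonal, conjTranspose_apply, ← Complex.mul_conj']
  simp only [RCLike.star_def]
  ring

/-- The entropy is at most the entropy of the diagonal in any orthonormal basis. -/
lemma entropy_le_sum_diag {σ : Matrix m m ℂ} (hσ : σ.PosSemidef) {W : Matrix m m ℂ}
    (hW : Wᴴ * W = 1) :
    entropy σ ≤ ∑ j, Real.negMulLog ((Wᴴ * σ * W) j j).re / Real.log 2 := by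
  have hW2 : W * Wᴴ = 1 := mul_eq_one_comm.1 hW
  obtain ⟨U, hU1, hU2, hU⟩ := exists_unitary_diagonal hσ.isHermitian
  have hpos := hσ.eigenvalues_nonneg
  rw [entropy, dif_pos hσ.isHermitian, ← Finset.sum_div, ← Finset.sum_div]
  refine div_le_div_of_nonneg_right ?_ (Real.log_nonneg (by norm_num))
  set lam := hσ.isHermitian.eigenvalues
  -- The squared moduli of these overlaps form a doubly stochastic matrix carrying the spectrum to
  -- the diagonal, so Jensen's inequality applies entrywise.
  set V := Wᴴ * U with hV
  have hVH : Vᴴ = Uᴴ * W := by rw [hV, conjTranspose_mul, conjTranspose_conjTranspose]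
  have hV1 : Vᴴ * V = 1 := by
    rw [hVH, hV, Matrix.mul_assoc, ← Matrix.mul_assoc W, hW2, Matrix.one_mul, hU1]
  have hV2 : V * Vᴴ = 1 := mul_eq_one_comm.1 hV1
  have e : ∀ j, ((Wᴴ * σ * W) j j).re = ∑ i, ‖V j i‖ ^ 2 * lam i := fun j => by
    have : Wᴴ * σ * W = V * diagonal (fun i => (lam i : ℂ)) * Vᴴ := by
      rw [hVH, hV, hU]
      simp only [Matrix.mul_assoc]
    rw [this, conj_diagonal_apply_self, Complex.ofReal_re]
  calc ∑ i, Real.negMulLog (lam i) = ∑ i, ∑ j, ‖V j i‖ ^ 2 * Real.negMulLog (lam i) := by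
        refine Finset.sum_congr rfl fun i _ => ?_
        rw [← Finset.sum_mul, sum_norm_sq_col_of_unitary hV1, one_mul]
    _ = ∑ j, ∑ i, ‖V j i‖ ^ 2 * Real.negMulLog (lam i) := Finset.sum_comm
    _ ≤ _ := by
        refine Finset.sum_le_sum fun j _ => ?_
        rw [e]
        have := Real.concaveOn_negMulLog.le_map_sum (t := Finset.univ) (w := fun i => ‖V j i‖ ^ 2)
          (p := lam) (fun i _ => by positivity) (sum_norm_sq_row_of_unitary hV2 j)
          (fun i _ => hpos i)
        simpa only [smul_eq_mul] using this

/-- One-sided continuity bound for the entropy on subnormalized states. -/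
lemma entropy_sub_le {σ τ : Matrix m m ℂ} (hσ : σ.PosSemidef) (hτ : τ.PosSemidef)
    (hτ1 : τ.trace.re ≤ 1) {L : ℝ} (hL : 0 ≤ L) :
    entropy σ - entropy τ ≤
      (traceNorm (σ - τ) * (L + 1) + Fintype.card m * Real.exp (-L)) / Real.log 2 := by
  -- Both states are read in the eigenbasis of `τ`: the entropy of `τ` is unchanged, that of `σ` can
  -- only grow, and the problem becomes scalar.
  obtain ⟨W, hW1, hW2, hW⟩ := exists_unitary_diagonal hτ.isHermitian
  have hτe : entropy τ = ∑ j, Real.negMulLog (hτ.isHermitian.eigenvalues j) / Real.log 2 := by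
    rw [entropy, dif_pos hτ.isHermitian]
  have hpos := hτ.eigenvalues_nonneg
  set mu := hτ.isHermitian.eigenvalues
  have htr : ∑ j, mu j = τ.trace.re := by
    rw [hτ.isHermitian.trace_eq_sum_eigenvalues]
    simp [mu]
  have hmu1 : ∀ j, mu j ≤ 1 := fun j =>
    (Finset.single_le_sum (fun i _ => hpos i) (Finset.mem_univ j)).trans (htr.le.trans hτ1)
  have hdiag : Wᴴ * τ * W = diagonal fun i => (mu i : ℂ) := by
    rw [hW]
    simp only [← Matrix.mul_assoc]
    rw [hW1, Matrix.one_mul, Matrix.mul_assoc, hW1, Matrix.mul_one]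
  have hx : ∀ j, 0 ≤ ((Wᴴ * σ * W) j j).re := fun j =>
    (Complex.nonneg_iff.1 ((hσ.conjTranspose_mul_mul_same W).diag_nonneg (i := j))).1
  have hdiff : ∀ j, |((Wᴴ * σ * W) j j).re - mu j| ≤ ‖(Wᴴ * (σ - τ) * W) j j‖ := fun j => by
    rw [Matrix.mul_sub, Matrix.sub_mul, hdiag, Matrix.sub_apply, diagonal_apply_eq]
    have := Complex.abs_re_le_norm ((Wᴴ * σ * W) j j - mu j)
    simpa using this
  have h1 := entropy_le_sum_diag hσ hW1
  rw [hτe]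
  have h2 : (∑ j, Real.negMulLog ((Wᴴ * σ * W) j j).re) - ∑ j, Real.negMulLog (mu j) ≤
      traceNorm (σ - τ) * (L + 1) + Fintype.card m * Real.exp (-L) := by
    rw [← Finset.sum_sub_distrib]
    calc _ ≤ ∑ j, (‖(Wᴴ * (σ - τ) * W) j j‖ * (L + 1) + Real.exp (-L)) := by
          refine Finset.sum_le_sum fun j _ =>
            (negMulLog_sub_le (hx j) (hpos j) (hmu1 j) L hL).trans ?_
          have := hdiff j
          gcongr
      _ = (∑ j, ‖(Wᴴ * (σ - τ) * W) j j‖) * (L + 1) + Fintype.card m * Real.exp (-L) := by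
          rw [Finset.sum_add_distrib, ← Finset.sum_mul]
          simp
      _ ≤ _ := by
          have := sum_norm_diag_le_traceNorm hW1 (σ - τ)
          gcongr
  have h3 := div_le_div_of_nonneg_right h2 (Real.log_nonneg (by norm_num : (1 : ℝ) ≤ 2))
  rw [sub_div, Finset.sum_div, Finset.sum_div] at h3
  linarith

end Entropy

/-! ### Large deviations for products of a finite distribution -/

section Chernoff

variable {ι : Type*} [Fintype ι]

/-- The moment generating function equals 1 at 0 and its derivative there is the mean, which is
negative. -/
lemma exists_exp_moment_lt_one {w g : ι → ℝ} (hw1 : ∑ i, w i = 1) (hg : ∑ i, w i * g i < 0) :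
    ∃ s : ℝ, 0 < s ∧ ∑ i, w i * Real.exp (s * g i) < 1 := by
  have hd : HasDerivAt (fun s : ℝ => ∑ i, w i * Real.exp (s * g i)) (∑ i, w i * g i) 0 := by
    refine HasDerivAt.fun_sum fun i _ => ?_
    have h := (((hasDerivAt_id (0 : ℝ)).mul_const (g i)).exp).const_mul (w i)
    simpa using h
  have h1 := (hasDerivAt_iff_tendsto_slope.1 hd).eventually (eventually_lt_nhds hg)
  have h2 := (nhdsWithin_mono (0 : ℝ) (fun x (hx : x ∈ Set.Ioi (0 : ℝ)) => ne_of_gt hx) :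
    nhdsWithin (0 : ℝ) (Set.Ioi 0) ≤ nhdsWithin 0 {0}ᶜ) h1
  obtain ⟨s, hs, hs0⟩ := (Filter.Eventually.and h2 self_mem_nhdsWithin).exists
  refine ⟨s, hs0, ?_⟩
  have hs0' : 0 < s := hs0
  have hs' : slope (fun s : ℝ => ∑ i, w i * Real.exp (s * g i)) 0 s < 0 := hs
  rw [slope_def_field, div_neg_iff] at hs'
  simp only [zero_mul, Real.exp_zero, mul_one, hw1, sub_zero] at hs'
  rcases hs' with h | h
  · linarith [h.2]
  · linarith [h.1]

/-- Chernoff's bound: sums of independent variables with negative mean are nonnegative with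
exponentially small probability. -/
lemma exists_chernoff_rate {w g : ι → ℝ} (hw : ∀ i, 0 ≤ w i) (hw1 : ∑ i, w i = 1)
    (hg : ∑ i, w i * g i < 0) :
    ∃ r : ℝ, 0 < r ∧ r < 1 ∧ ∀ (n : ℕ) (s : Finset (Fin n → ι)),
      (∀ x ∈ s, (∀ t, w (x t) ≠ 0) → 0 ≤ ∑ t, g (x t)) → ∑ x ∈ s, ∏ t, w (x t) ≤ r ^ n := by
  classical
  obtain ⟨u, hu, hlt⟩ := exists_exp_moment_lt_one hw1 hg
  refine ⟨∑ i, w i * Real.exp (u * g i), ?_, hlt, fun n s hs => ?_⟩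
  · obtain ⟨i, -, hi⟩ := Finset.exists_ne_zero_of_sum_ne_zero (hw1.trans_ne one_ne_zero)
    exact Finset.sum_pos' (fun j _ => mul_nonneg (hw j) (Real.exp_nonneg _))
      ⟨i, Finset.mem_univ _, mul_pos ((hw i).lt_of_ne' hi) (Real.exp_pos _)⟩
  · calc ∑ x ∈ s, ∏ t, w (x t) ≤ ∑ x ∈ s, ∏ t, (w (x t) * Real.exp (u * g (x t))) := by
          refine Finset.sum_le_sum fun x hx => ?_
          rw [Finset.prod_mul_distrib, ← Real.exp_sum, ← Finset.mul_sum]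
          -- Sequences through a letter of weight zero contribute nothing. This exempts them from
          -- the sign condition, which matters because `Real.log 0 = 0` would spoil it in the
          -- applications.
          by_cases h0 : ∀ t, w (x t) ≠ 0
          · exact le_mul_of_one_le_right (Finset.prod_nonneg fun t _ => hw _)
              (Real.one_le_exp (mul_nonneg hu.le (hs x hx h0)))
          · push Not at h0
            obtain ⟨t, ht⟩ := h0
            rw [Finset.prod_eq_zero (Finset.mem_univ t) ht, zero_mul]
      _ ≤ ∑ x : Fin n → ι, ∏ t, (w (x t) * Real.exp (u * g (x t))) :=
          Finset.sum_le_univ_sum_of_nonneg fun x =>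
            Finset.prod_nonneg fun t _ => mul_nonneg (hw _) (Real.exp_nonneg _)
      _ = _ := by
          have := Finset.prod_univ_sum (fun _ : Fin n => (Finset.univ : Finset ι))
            (fun _ i => w i * Real.exp (u * g i))
          rw [Fintype.piFinset_univ] at this
          rw [← this, Finset.prod_const, Finset.card_univ, Fintype.card_fin]

/-- Sequences whose probability is larger than `2^{-n(S-δ)}` are exponentially unlikely. -/
lemma exists_upper_tail_rate {w : ι → ℝ} (hw : ∀ i, 0 ≤ w i) (hw1 : ∑ i, w i = 1)
    {S δ : ℝ} (hS : S = ∑ i, Real.negMulLog (w i) / Real.log 2) (hδ : 0 < δ) :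
    ∃ r : ℝ, 0 < r ∧ r < 1 ∧ ∀ (n : ℕ) (s : Finset (Fin n → ι)),
      (∀ x ∈ s, (2 : ℝ) ^ (-(n : ℝ) * (S - δ)) < ∏ t, w (x t)) →
        ∑ x ∈ s, ∏ t, w (x t) ≤ r ^ n := by
  have hl : 0 < Real.log 2 := Real.log_pos (by norm_num)
  have hSl : S * Real.log 2 = -∑ i, w i * Real.log (w i) := by
    rw [hS, ← Finset.sum_div, div_mul_cancel₀ _ hl.ne', ← Finset.sum_neg_distrib]
    exact Finset.sum_congr rfl fun i _ => by rw [Real.negMulLog]; ring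
  -- The mean of `log w + (S - δ) log 2` is `-δ log 2`.
  obtain ⟨r, hr0, hr1, hr⟩ := exists_chernoff_rate (w := w)
    (g := fun i => Real.log (w i) + (S - δ) * Real.log 2) hw hw1 (by
      simp only [mul_add, Finset.sum_add_distrib, ← Finset.sum_mul, hw1]
      nlinarith)
  refine ⟨r, hr0, hr1, fun n s hs => hr n s fun x hx hne => ?_⟩
  have h := Real.log_lt_log (by positivity) (hs x hx)
  rw [Real.log_rpow (by norm_num), Real.log_prod (fun t _ => hne t)] at h
  rw [Finset.sum_add_distrib]
  simp only [Finset.sum_const, Finset.card_univ, Fintype.card_fin, nsmul_eq_mul]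
  nlinarith

/-- Sequences whose probability is smaller than `2^{-n(S+δ)}` are exponentially unlikely. -/
lemma exists_lower_tail_rate {w : ι → ℝ} (hw : ∀ i, 0 ≤ w i) (hw1 : ∑ i, w i = 1)
    {S δ : ℝ} (hS : S = ∑ i, Real.negMulLog (w i) / Real.log 2) (hδ : 0 < δ) :
    ∃ r : ℝ, 0 < r ∧ r < 1 ∧ ∀ (n : ℕ) (s : Finset (Fin n → ι)),
      (∀ x ∈ s, ∏ t, w (x t) < (2 : ℝ) ^ (-(n : ℝ) * (S + δ))) →
        ∑ x ∈ s, ∏ t, w (x t) ≤ r ^ n := by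
  have hl : 0 < Real.log 2 := Real.log_pos (by norm_num)
  have hSl : S * Real.log 2 = -∑ i, w i * Real.log (w i) := by
    rw [hS, ← Finset.sum_div, div_mul_cancel₀ _ hl.ne', ← Finset.sum_neg_distrib]
    exact Finset.sum_congr rfl fun i _ => by rw [Real.negMulLog]; ring
  obtain ⟨r, hr0, hr1, hr⟩ := exists_chernoff_rate (w := w)
    (g := fun i => -Real.log (w i) - (S + δ) * Real.log 2) hw hw1 (by
      simp only [mul_sub, mul_neg, Finset.sum_sub_distrib, Finset.sum_neg_distrib,
        ← Finset.sum_mul, hw1]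
      nlinarith)
  refine ⟨r, hr0, hr1, fun n s hs => hr n s fun x hx hne => ?_⟩
  have hpos : 0 < ∏ t, w (x t) := Finset.prod_pos fun t _ => (hw _).lt_of_ne' (hne t)
  have h := Real.log_lt_log hpos (hs x hx)
  rw [Real.log_rpow (by norm_num), Real.log_prod (fun t _ => hne t)] at h
  rw [Finset.sum_sub_distrib, Finset.sum_neg_distrib]
  simp only [Finset.sum_const, Finset.card_univ, Fintype.card_fin, nsmul_eq_mul]
  nlinarith

end Chernoff

/-! ### Random coefficients with independent phases -/

section Moments

variable {Ω ι : Type*} [MeasurableSpace Ω]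

/-- Bounded random coefficients whose joint law does not change when one of them is multiplied
by the imaginary unit. -/
structure PhaseInvariant (μ : Measure Ω) (c : ι → Ω → ℂ) : Prop where
  prob : IsProbabilityMeasure μ
  meas : ∀ i, Measurable (c i)
  bounded : ∃ B : ℝ, ∀ i ω, ‖c i ω‖ ≤ B
  phase : ∀ i₀, ∃ g : Ω → Ω, MeasurePreserving g μ μ ∧
    (∀ ω, c i₀ (g ω) = Complex.I * c i₀ ω) ∧ ∀ i, i ≠ i₀ → ∀ ω, c i (g ω) = c i ω

/-- Phase-invariant coefficients with the moments used for random codes. -/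
structure HasCodeMoments (μ : Measure Ω) (c : ι → Ω → ℂ) : Prop extends PhaseInvariant μ c where
  second : ∀ i, ∫ ω, ‖c i ω‖ ^ 2 ∂μ = 1
  mixed : ∀ i j, i ≠ j → ∫ ω, ‖c i ω‖ ^ 2 * ‖c j ω‖ ^ 2 ∂μ ≤ 1
  fourth : ∀ i, ∫ ω, ‖c i ω‖ ^ 2 * ‖c i ω‖ ^ 2 ∂μ ≤ 2

/-- Invariance of the measure gives `∫ F = z ∫ F` with `z ≠ 1`. -/
lemma integral_eq_zero_of_phase {μ : Measure Ω} {F : Ω → ℂ} (hF : Measurable F) {g : Ω → Ω}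
    (hg : MeasurePreserving g μ μ) {z : ℂ} (hz : z ≠ 1) (h : ∀ ω, F (g ω) = z * F ω) :
    ∫ ω, F ω ∂μ = 0 := by
  have h1 : ∫ ω, F ω ∂μ = ∫ ω, F (g ω) ∂μ := by
    conv_lhs => rw [← hg.map_eq]
    exact integral_map hg.measurable.aemeasurable hF.aestronglyMeasurable
  simp only [h, integral_const_mul] at h1
  have h2 : (z - 1) * ∫ ω, F ω ∂μ = 0 := by linear_combination -h1
  exact (mul_eq_zero.1 h2).resolve_left (sub_ne_zero.2 hz)

lemma I_ne_one : Complex.I ≠ 1 := fun h => by simpa using congrArg Complex.re h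

lemma integrable_of_bounded {μ : Measure Ω} [IsFiniteMeasure μ] {E : Type*}
    [NormedAddCommGroup E] [MeasurableSpace E] [BorelSpace E] [SecondCountableTopology E]
    {F : Ω → E} (hF : Measurable F) {B : ℝ} (hB : ∀ ω, ‖F ω‖ ≤ B) : Integrable F μ :=
  Integrable.of_bound hF.aestronglyMeasurable B (Filter.Eventually.of_forall hB)

namespace PhaseInvariant

variable {μ : Measure Ω} {c : ι → Ω → ℂ}

lemma measurable_conj (h : PhaseInvariant μ c) (i : ι) : Measurable fun ω => conj (c i ω) :=
  Complex.continuous_conj.measurable.comp (h.meas i)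

lemma integrable_second (h : PhaseInvariant μ c) (i j : ι) :
    Integrable (fun ω => c i ω * conj (c j ω)) μ := by
  have := h.prob
  obtain ⟨B, hB⟩ := h.bounded
  refine integrable_of_bounded ((h.meas i).mul (h.measurable_conj j)) (B := B * B) fun ω => ?_
  rw [norm_mul, RCLike.norm_conj]
  exact mul_le_mul (hB _ _) (hB _ _) (norm_nonneg _) ((norm_nonneg _).trans (hB i ω))

lemma measurable_fourth (h : PhaseInvariant μ c) (i j k l : ι) :
    Measurable (fun ω => c i ω * conj (c j ω) * (c k ω * conj (c l ω))) :=
  ((h.meas i).mul (h.measurable_conj j)).mul ((h.meas k).mul (h.measurable_conj l))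

lemma integrable_fourth (h : PhaseInvariant μ c) (i j k l : ι) :
    Integrable (fun ω => c i ω * conj (c j ω) * (c k ω * conj (c l ω))) μ := by
  have := h.prob
  obtain ⟨B, hB⟩ := h.bounded
  refine integrable_of_bounded (h.measurable_fourth i j k l) (B := (B * B) * (B * B)) fun ω => ?_
  rw [norm_mul, norm_mul, norm_mul, RCLike.norm_conj, RCLike.norm_conj]
  have hB0 : 0 ≤ B := (norm_nonneg _).trans (hB i ω)
  have := hB i ω; have := hB j ω; have := hB k ω; have := hB l ω
  gcongr

lemma second_eq_zero (h : PhaseInvariant μ c) {i j : ι} (hij : i ≠ j) :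
    ∫ ω, c i ω * conj (c j ω) ∂μ = 0 := by
  obtain ⟨g, hg, h1, h2⟩ := h.phase i
  refine integral_eq_zero_of_phase ((h.meas i).mul (h.measurable_conj j)) hg
    I_ne_one fun ω => ?_
  rw [h1, h2 j hij.symm]
  ring

/-- Unless the unconjugated indices match the conjugated ones as multisets, a quarter turn of one
coefficient multiplies the product by `I` or `-1`. A single phase `I` thus suffices in place of the
whole circle. -/
lemma fourth_eq_zero (h : PhaseInvariant μ c) {i j k l : ι} (h1 : ¬(i = j ∧ k = l))
    (h2 : ¬(i = l ∧ k = j)) :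
    ∫ ω, c i ω * conj (c j ω) * (c k ω * conj (c l ω)) ∂μ = 0 := by
  classical
  have hI2 : Complex.I * Complex.I ≠ 1 := by
    rw [Complex.I_mul_I]; norm_num
  have hsolo : ∀ i j k l : ι, i ≠ j → i ≠ l →
      ∫ ω, c i ω * conj (c j ω) * (c k ω * conj (c l ω)) ∂μ = 0 := by
    intro i j k l hij hil
    obtain ⟨g, hg, e1, e2⟩ := h.phase i
    by_cases hik : k = i
    · subst hik
      refine integral_eq_zero_of_phase (h.measurable_fourth _ _ _ _) hg hI2 fun ω => ?_
      rw [e1, e2 j hij.symm, e2 l hil.symm]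
      ring
    · refine integral_eq_zero_of_phase (h.measurable_fourth _ _ _ _) hg I_ne_one
        fun ω => ?_
      rw [e1, e2 j hij.symm, e2 l hil.symm, e2 k hik]
      ring
  have hpair : ∀ i k l : ι, k ≠ l →
      ∫ ω, c i ω * conj (c i ω) * (c k ω * conj (c l ω)) ∂μ = 0 := by
    intro i k l hkl
    by_cases hik : k = i
    · subst hik
      obtain ⟨g, hg, e1, e2⟩ := h.phase k
      refine integral_eq_zero_of_phase (h.measurable_fourth _ _ _ _) hg I_ne_one
        fun ω => ?_
      rw [e1, e2 l hkl.symm, map_mul, Complex.conj_I]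
      linear_combination (-Complex.I * (c k ω * conj (c k ω) * (c k ω * conj (c l ω)))) *
        Complex.I_sq
    · have := hsolo k i i l hik hkl
      rw [← this]
      congr 1
      ext ω
      ring
  have hswap : ∀ i j k l : ι, ∫ ω, c i ω * conj (c j ω) * (c k ω * conj (c l ω)) ∂μ =
      ∫ ω, c i ω * conj (c l ω) * (c k ω * conj (c j ω)) ∂μ := fun i j k l => by
    congr 1
    ext ω
    ring
  by_cases hij : i = j
  · subst hij
    exact hpair i k l fun e => h1 ⟨rfl, e⟩
  by_cases hil : i = l
  · subst hil
    rw [hswap]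
    exact hpair i k j fun e => h2 ⟨rfl, e⟩
  exact hsolo i j k l hij hil

lemma integrable_norm_sq (h : PhaseInvariant μ c) (i : ι) :
    Integrable (fun ω => ‖c i ω‖ ^ 2) μ := by
  have := (h.integrable_second i i).re
  refine this.congr (Filter.Eventually.of_forall fun ω => ?_)
  simp [Complex.mul_conj', ← Complex.ofReal_pow]

lemma integrable_norm_sq_mul (h : PhaseInvariant μ c) (i j : ι) :
    Integrable (fun ω => ‖c i ω‖ ^ 2 * ‖c j ω‖ ^ 2) μ := by
  have := (h.integrable_fourth i i j j).re
  refine this.congr (Filter.Eventually.of_forall fun ω => ?_)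
  simp [Complex.mul_conj', ← Complex.ofReal_pow]

end PhaseInvariant

lemma HasCodeMoments.second_apply [DecidableEq ι] {μ : Measure Ω} {c : ι → Ω → ℂ}
    (h : HasCodeMoments μ c) (i j : ι) :
    ∫ ω, c i ω * conj (c j ω) ∂μ = if i = j then 1 else 0 := by
  split_ifs with hij
  · subst hij
    have : ∀ ω, c i ω * conj (c i ω) = ((‖c i ω‖ ^ 2 : ℝ) : ℂ) := fun ω => by
      rw [Complex.mul_conj', Complex.ofReal_pow]
    simp only [this]
    rw [integral_complex_ofReal, h.second i, Complex.ofReal_one]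
  · exact h.second_eq_zero hij

end Moments

/-! ### Moments of the phases of Lloyd codes -/

section Lloyd

instance isProbabilityMeasure_unitAddCircle :
    IsProbabilityMeasure (volume : Measure UnitAddCircle) :=
  ⟨UnitAddCircle.measure_univ⟩

lemma toCircle_quarter :
    (AddCircle.toCircle (((1 / 4 : ℝ) : ℝ) : UnitAddCircle) : ℂ) = Complex.I := by
  rw [AddCircle.toCircle_apply_mk, Circle.coe_exp]
  have : ((2 * Real.pi / 1 * (1 / 4) : ℝ) : ℂ) = Real.pi / 2 := by
    push_cast
    ring
  rw [this, Complex.exp_pi_div_two_mul_I]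

/-- Phases have modulus one, so all moments equal 1, and translating one angle by `1/4` multiplies
its phase by `I`. The map `f` will be the inclusion of the typical indices: the law carries a phase
for every index. -/
lemma hasCodeMoments_toCircle {ι : Type*} [Fintype ι] {τ : Type*} (f : τ → ι)
    (hf : Function.Injective f) :
    HasCodeMoments (Measure.pi fun _ : ι => (volume : Measure UnitAddCircle))
      (fun (i : τ) θ => (AddCircle.toCircle (θ (f i)) : ℂ)) := by
  classical
  have hn : ∀ x : UnitAddCircle, ‖(AddCircle.toCircle x : ℂ)‖ = 1 := fun x => Circle.norm_coe _
  have hadd : ∀ x y : UnitAddCircle, (AddCircle.toCircle (x + y) : ℂ) =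
      (AddCircle.toCircle x : ℂ) * (AddCircle.toCircle y : ℂ) := fun x y => by
    rw [AddCircle.toCircle_add]
    exact Circle.coe_mul _ _
  have hc : Continuous fun x : UnitAddCircle => (AddCircle.toCircle x : ℂ) :=
    (fourier (T := 1) 1).continuous.congr fun x => fourier_one
  refine ⟨⟨inferInstance, fun i => hc.measurable.comp (measurable_pi_apply _),
    ⟨1, fun i θ => (hn _).le⟩, fun i₀ => ?_⟩, fun i => ?_, fun i j _ => ?_, fun i => ?_⟩
  · let v : ι → UnitAddCircle := Pi.single (f i₀) (((1 / 4 : ℝ) : ℝ) : UnitAddCircle)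
    refine ⟨fun θ => v + θ, measurePreserving_add_left _ _, fun θ => ?_, fun i hi θ => ?_⟩
    · have e : (v + θ) (f i₀) = (((1 / 4 : ℝ) : ℝ) : UnitAddCircle) + θ (f i₀) := by
        rw [Pi.add_apply, show v = Pi.single _ _ from rfl, Pi.single_eq_same]
      exact (congrArg (fun x : UnitAddCircle => (AddCircle.toCircle x : ℂ)) e).trans
        ((hadd _ _).trans (by rw [toCircle_quarter]))
    · have e : (v + θ) (f i) = θ (f i) := by
        rw [Pi.add_apply, show v = Pi.single _ _ from rfl, Pi.single_eq_of_ne (hf.ne hi), zero_add]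
      exact congrArg (fun x : UnitAddCircle => (AddCircle.toCircle x : ℂ)) e
  all_goals
    simp only [hn]
    norm_num

end Lloyd

/-! ### Moments of a uniform point of the sphere -/

section Sphere

open scoped Pointwise

lemma PhaseInvariant.integral_norm_sq_lin {Ω τ : Type*} [MeasurableSpace Ω] {μ : Measure Ω}
    {c : τ → Ω → ℂ} (h : PhaseInvariant μ c) (p q : ℝ) {i j : τ} (hij : i ≠ j) :
    ∫ ω, ‖(p : ℂ) * c i ω + (q : ℂ) * c j ω‖ ^ 2 ∂μ =
      p ^ 2 * ∫ ω, ‖c i ω‖ ^ 2 ∂μ + q ^ 2 * ∫ ω, ‖c j ω‖ ^ 2 ∂μ := by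
  have e : ∀ x y : ℂ, ‖(p : ℂ) * x + (q : ℂ) * y‖ ^ 2 =
      p ^ 2 * ‖x‖ ^ 2 + q ^ 2 * ‖y‖ ^ 2 + 2 * p * q * (x * conj y).re := fun x y => by
    simp only [← Complex.normSq_eq_norm_sq, Complex.normSq_apply]
    simp
    ring
  have h1 := (h.integrable_second i j).re
  have h2 := integral_re (h.integrable_second i j)
  rw [h.second_eq_zero hij] at h2
  have a1 := (h.integrable_norm_sq i).const_mul (p ^ 2)
  have a2 := (h.integrable_norm_sq j).const_mul (q ^ 2)
  have a3 := h1.const_mul (2 * p * q)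
  simp only [RCLike.re_to_complex, Complex.zero_re] at h2 a3
  simp only [e]
  rw [integral_add (a1.fun_add a2) a3, integral_add a1 a2]
  simp only [integral_const_mul]
  rw [h2]
  ring

lemma PhaseInvariant.integral_re_fourth_eq_zero {Ω τ : Type*} [MeasurableSpace Ω]
    {μ : Measure Ω} {c : τ → Ω → ℂ} (h : PhaseInvariant μ c) {i j k l : τ}
    (h1 : ¬(i = j ∧ k = l)) (h2 : ¬(i = l ∧ k = j)) :
    ∫ ω, (c i ω * conj (c j ω) * (c k ω * conj (c l ω))).re ∂μ = 0 := by
  have h3 := integral_re (h.integrable_fourth i j k l)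
  rw [h.fourth_eq_zero h1 h2] at h3
  simpa using h3

/-- All terms with unbalanced phases in the expansion integrate to zero. Comparing the result before
and after a rotation of two coordinates determines the moments on the sphere. -/
lemma PhaseInvariant.integral_norm_fourth_lin {Ω τ : Type*} [MeasurableSpace Ω] {μ : Measure Ω}
    {c : τ → Ω → ℂ} (h : PhaseInvariant μ c) (p q : ℝ) {i j : τ} (hij : i ≠ j) :
    ∫ ω, ‖(p : ℂ) * c i ω + (q : ℂ) * c j ω‖ ^ 2 * ‖(p : ℂ) * c i ω + (q : ℂ) * c j ω‖ ^ 2 ∂μ =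
      p ^ 4 * ∫ ω, ‖c i ω‖ ^ 2 * ‖c i ω‖ ^ 2 ∂μ + q ^ 4 * ∫ ω, ‖c j ω‖ ^ 2 * ‖c j ω‖ ^ 2 ∂μ +
      4 * p ^ 2 * q ^ 2 * ∫ ω, ‖c i ω‖ ^ 2 * ‖c j ω‖ ^ 2 ∂μ := by
  have e : ∀ x y : ℂ, ‖(p : ℂ) * x + (q : ℂ) * y‖ ^ 2 *
      ‖(p : ℂ) * x + (q : ℂ) * y‖ ^ 2 =
      p ^ 4 * (‖x‖ ^ 2 * ‖x‖ ^ 2) + q ^ 4 * (‖y‖ ^ 2 * ‖y‖ ^ 2) +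
      4 * p ^ 2 * q ^ 2 * (‖x‖ ^ 2 * ‖y‖ ^ 2) +
      2 * p ^ 2 * q ^ 2 * (x * conj y * (x * conj y)).re +
      4 * p ^ 3 * q * (x * conj x * (x * conj y)).re +
      4 * p * q ^ 3 * (y * conj y * (x * conj y)).re := fun x y => by
    simp only [← Complex.normSq_eq_norm_sq, Complex.normSq_apply]
    simp
    ring
  have a1 := (h.integrable_norm_sq_mul i i).const_mul (p ^ 4)
  have a2 := (h.integrable_norm_sq_mul j j).const_mul (q ^ 4)
  have a3 := (h.integrable_norm_sq_mul i j).const_mul (4 * p ^ 2 * q ^ 2)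
  have a4 := (h.integrable_fourth i j i j).re.const_mul (2 * p ^ 2 * q ^ 2)
  have a5 := (h.integrable_fourth i i i j).re.const_mul (4 * p ^ 3 * q)
  have a6 := (h.integrable_fourth j j i j).re.const_mul (4 * p * q ^ 3)
  simp only [RCLike.re_to_complex] at a4 a5 a6
  simp only [e]
  rw [integral_add ((((a1.fun_add a2).fun_add a3).fun_add a4).fun_add a5) a6,
    integral_add (((a1.fun_add a2).fun_add a3).fun_add a4) a5,
    integral_add ((a1.fun_add a2).fun_add a3) a4,
    integral_add (a1.fun_add a2) a3, integral_add a1 a2]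
  simp only [integral_const_mul]
  rw [h.integral_re_fourth_eq_zero (i := i) (j := j) (by tauto) (by tauto),
    h.integral_re_fourth_eq_zero (i := i) (j := i) (by tauto) (by tauto),
    h.integral_re_fourth_eq_zero (i := j) (j := j) (by tauto) (by tauto)]
  ring

variable {ι : Type*} [Fintype ι]

/-- The map of the unit sphere induced by a linear isometry. -/
def sphereMap {E : Type*} [NormedAddCommGroup E] [NormedSpace ℝ E] (f : E ≃ₗᵢ[ℝ] E)
    (x : Metric.sphere (0 : E) 1) : Metric.sphere (0 : E) 1 :=
  ⟨f x.1, by rw [mem_sphere_zero_iff_norm, f.norm_map]; exact mem_sphere_zero_iff_norm.1 x.2⟩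

/-- The spherical measure of `s` is proportional to the volume of the cone over `s`, and a linear
isometry maps cones to cones and preserves volume. -/
lemma measurePreserving_sphereMap {E : Type*} [NormedAddCommGroup E] [InnerProductSpace ℝ E]
    [FiniteDimensional ℝ E] [MeasurableSpace E] [BorelSpace E] (f : E ≃ₗᵢ[ℝ] E) :
    MeasurePreserving (sphereMap f) (volume : Measure E).toSphere (volume : Measure E).toSphere := by
  have hm : Measurable (sphereMap f) :=
    (f.continuous.measurable.comp measurable_subtype_coe).subtype_mk
  refine ⟨hm, Measure.ext fun s hs => ?_⟩
  rw [Measure.map_apply hm hs, Measure.toSphere_apply' _ hs, Measure.toSphere_apply' _ (hm hs)]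
  congr 1
  have e : Set.Ioo (0 : ℝ) 1 • ((↑) '' (sphereMap f ⁻¹' s) : Set E) =
      f ⁻¹' (Set.Ioo (0 : ℝ) 1 • ((↑) '' s : Set E)) := by
    ext x
    simp only [Set.mem_smul, Set.mem_image, Set.mem_preimage]
    constructor
    · rintro ⟨t, ht, _, ⟨y, hy, rfl⟩, rfl⟩
      exact ⟨t, ht, _, ⟨_, hy, rfl⟩, (f.map_smul t _).symm⟩
    · rintro ⟨t, ht, _, ⟨y, hy, rfl⟩, hx⟩
      refine ⟨t, ht, f.symm y.1, ⟨sphereMap f.symm y, ?_, rfl⟩, ?_⟩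
      · have : sphereMap f (sphereMap f.symm y) = y := Subtype.ext (f.apply_symm_apply _)
        rwa [this]
      · rw [← f.symm.map_smul, hx, f.symm_apply_apply]
  rw [e]
  exact f.measurePreserving.measure_preimage_equiv (f := f.toHomeomorph.toMeasurableEquiv) _

lemma measurePreserving_sphereMap_uniform
    (f : EuclideanSpace ℂ ι ≃ₗᵢ[ℝ] EuclideanSpace ℂ ι) :
    MeasurePreserving (sphereMap f) (uniformSphere ι) (uniformSphere ι) :=
  (measurePreserving_sphereMap f).smul_measure _

lemma isProbabilityMeasure_uniformSphere [Nonempty ι] :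
    IsProbabilityMeasure (uniformSphere ι) := by
  refine ⟨?_⟩
  rw [uniformSphere, Measure.smul_apply, smul_eq_mul]
  refine ENNReal.inv_mul_cancel ?_ (measure_ne_top _ _)
  rw [Measure.measure_univ_ne_zero]
  exact Measure.toSphere_ne_zero _

/-- A matrix with orthonormal columns as an isometry. -/
noncomputable def matrixIsometry [DecidableEq ι] (U : Matrix ι ι ℂ) (hU : Uᴴ * U = 1) :
    EuclideanSpace ℂ ι ≃ₗᵢ[ℝ] EuclideanSpace ℂ ι :=
  LinearIsometry.toLinearIsometryEquiv
    (⟨(Matrix.toEuclideanLin U).restrictScalars ℝ, fun x => by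
      have h := sum_norm_sq_mulVec_of_isometry hU x.ofLp
      rw [EuclideanSpace.norm_eq, EuclideanSpace.norm_eq]
      exact congrArg Real.sqrt h⟩ : EuclideanSpace ℂ ι →ₗᵢ[ℝ] EuclideanSpace ℂ ι) rfl

lemma matrixIsometry_apply [DecidableEq ι] (U : Matrix ι ι ℂ) (hU : Uᴴ * U = 1)
    (x : EuclideanSpace ℂ ι) (i : ι) : matrixIsometry U hU x i = (U *ᵥ x.ofLp) i := rfl

lemma phaseInvariant_sphere [Nonempty ι] (s : ℂ) :
    PhaseInvariant (uniformSphere ι) (fun (i : ι) φ => s * φ.1 i) := by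
  classical
  refine ⟨isProbabilityMeasure_uniformSphere, fun i => ?_, ⟨‖s‖ * 1, fun i φ => ?_⟩, fun i₀ => ?_⟩
  · have h : Continuous fun φ : Metric.sphere (0 : EuclideanSpace ℂ ι) 1 => s * φ.1 i := by
      fun_prop
    exact h.measurable
  · rw [norm_mul]
    have h1 := PiLp.norm_apply_le φ.1 i
    rw [mem_sphere_zero_iff_norm.1 φ.2] at h1
    gcongr
  · set d : ι → ℂ := fun i => if i = i₀ then Complex.I else 1 with hd
    have hU : (diagonal d)ᴴ * diagonal d = 1 := by
      rw [diagonal_conjTranspose, diagonal_mul_diagonal, ← diagonal_one]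
      congr 1
      ext i
      simp only [hd, Pi.star_apply]
      split_ifs <;> simp
    refine ⟨sphereMap (matrixIsometry _ hU), measurePreserving_sphereMap_uniform _,
      fun φ => ?_, fun i hi φ => ?_⟩
    · have : (sphereMap (matrixIsometry _ hU) φ).1 i₀ = d i₀ * φ.1 i₀ :=
        mulVec_diagonal _ _ _
      rw [this]
      simp only [hd, if_true]
      ring
    · have : (sphereMap (matrixIsometry _ hU) φ).1 i = d i * φ.1 i :=
        mulVec_diagonal _ _ _
      rw [this]
      simp only [hd, if_neg hi, one_mul]

lemma integral_comp_sphereMap [DecidableEq ι] {U : Matrix ι ι ℂ} (hU : Uᴴ * U = 1)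
    {F : EuclideanSpace ℂ ι → ℝ} (hF : Continuous F) :
    ∫ φ, F (matrixIsometry U hU φ.1) ∂(uniformSphere ι) = ∫ φ, F φ.1 ∂(uniformSphere ι) := by
  have hg := measurePreserving_sphereMap_uniform (matrixIsometry U hU)
  conv_rhs => rw [← hg.map_eq]
  rw [integral_map hg.measurable.aemeasurable]
  · rfl
  · exact (hF.comp continuous_subtype_val).measurable.aestronglyMeasurable

/-- A reflection that maps the coordinates `i`, `j` to `-(3/5) x i - (4/5) x j` and
`-(4/5) x i + (3/5) x j`. -/
lemma exists_reflection [DecidableEq ι] {i j : ι} (hij : i ≠ j) :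
    ∃ U : Matrix ι ι ℂ, Uᴴ * U = 1 ∧
      (∀ x : ι → ℂ, (U *ᵥ x) i = -(3 / 5) * x i - (4 / 5) * x j) ∧
      ∀ x : ι → ℂ, (U *ᵥ x) j = -(4 / 5) * x i + (3 / 5) * x j := by
  -- The Householder reflection along `(2, 1)` has the rational entries of the triple `(3, 4, 5)`.
  -- Its two coefficients have different moduli, so its two rows give independent relations between
  -- the moments.
  set v : ι → ℂ := Pi.single i 2 + Pi.single j 1 with hv
  have hvi : v i = 2 := by simp [hv, hij]
  have hvj : v j = 1 := by simp [hv, hij.symm]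
  have hdot : ∀ x : ι → ℂ, v ⬝ᵥ x = 2 * x i + x j := fun x => by
    simp [hv, add_dotProduct, single_dotProduct]
  have hvv : v ⬝ᵥ v = 5 := by rw [hdot, hvi, hvj]; norm_num
  have hstar : star v = v := by
    ext k
    simp only [hv, Pi.star_apply, Pi.add_apply, Pi.single_apply]
    split_ifs <;> simp
  have hmul : ∀ x : ι → ℂ, (1 - (2 / 5 : ℂ) • vecMulVec v v) *ᵥ x =
      x - ((2 / 5 : ℂ) * (2 * x i + x j)) • v := fun x => by
    rw [sub_mulVec, one_mulVec, smul_mulVec, vecMulVec_mulVec, hdot]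
    ext k
    simp
    ring
  refine ⟨1 - (2 / 5 : ℂ) • vecMulVec v v, ?_, fun x => ?_, fun x => ?_⟩
  · have hH : (1 - (2 / 5 : ℂ) • vecMulVec v v)ᴴ = 1 - (2 / 5 : ℂ) • vecMulVec v v := by
      rw [conjTranspose_sub, conjTranspose_one, conjTranspose_smul, conjTranspose_vecMulVec, hstar]
      simp
    rw [hH, Matrix.sub_mul, Matrix.mul_sub, Matrix.mul_sub, Matrix.one_mul, Matrix.one_mul,
      Matrix.mul_one, smul_mul_smul_comm, vecMulVec_mul_vecMulVec, hvv]
    ext k l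
    simp [vecMulVec_apply]
    ring
  · rw [hmul]
    simp [hvi]
    ring
  · rw [hmul]
    simp [hvj]
    ring

/-- Invariance under the reflections makes all second moments equal, all fourth moments equal, and
each fourth moment twice a mixed one. The constraints `∑ |φᵢ|² = 1` and its square fix the remaining
constants. -/
lemma sphere_moments [Nonempty ι] :
    (∀ i, ∫ φ, ‖φ.1 i‖ ^ 2 ∂(uniformSphere ι) = (Fintype.card ι : ℝ)⁻¹) ∧
    (∀ i j, i ≠ j → ∫ φ, ‖φ.1 i‖ ^ 2 * ‖φ.1 j‖ ^ 2 ∂(uniformSphere ι) =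
      ((Fintype.card ι : ℝ) * (Fintype.card ι + 1))⁻¹) ∧
    ∀ i, ∫ φ, ‖φ.1 i‖ ^ 2 * ‖φ.1 i‖ ^ 2 ∂(uniformSphere ι) =
      2 * ((Fintype.card ι : ℝ) * (Fintype.card ι + 1))⁻¹ := by
  classical
  have := isProbabilityMeasure_uniformSphere (ι := ι)
  have hP := phaseInvariant_sphere (ι := ι) 1
  simp only [one_mul] at hP
  set s : ι → ℝ := fun i => ∫ φ, ‖φ.1 i‖ ^ 2 ∂(uniformSphere ι) with hs
  set b : ι → ι → ℝ := fun i j => ∫ φ, ‖φ.1 i‖ ^ 2 * ‖φ.1 j‖ ^ 2 ∂(uniformSphere ι) with hb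
  have i2 := hP.integrable_norm_sq
  have i4 := hP.integrable_norm_sq_mul
  have lin2 : ∀ (p q : ℝ) i j, i ≠ j →
      ∫ φ, ‖(p : ℂ) * φ.1 i + (q : ℂ) * φ.1 j‖ ^ 2 ∂(uniformSphere ι) =
        p ^ 2 * s i + q ^ 2 * s j := fun p q i j hij => hP.integral_norm_sq_lin p q hij
  have lin4 : ∀ (p q : ℝ) i j, i ≠ j →
      ∫ φ, ‖(p : ℂ) * φ.1 i + (q : ℂ) * φ.1 j‖ ^ 2 * ‖(p : ℂ) * φ.1 i + (q : ℂ) * φ.1 j‖ ^ 2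
        ∂(uniformSphere ι) =
        p ^ 4 * b i i + q ^ 4 * b j j + 4 * p ^ 2 * q ^ 2 * b i j :=
    fun p q i j hij => hP.integral_norm_fourth_lin p q hij
  have hrel : ∀ i j, i ≠ j → s i = s j ∧ b i i = b j j ∧ b i i = 2 * b i j := by
    intro i j hij
    obtain ⟨U, hU, hUi, hUj⟩ := exists_reflection hij
    have ei : ∀ x : EuclideanSpace ℂ ι, matrixIsometry U hU x i =
        ((-(3 / 5) : ℝ) : ℂ) * x i + ((-(4 / 5) : ℝ) : ℂ) * x j := fun x => by
      rw [matrixIsometry_apply, hUi]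
      push_cast
      ring
    have ej : ∀ x : EuclideanSpace ℂ ι, matrixIsometry U hU x j =
        ((-(4 / 5) : ℝ) : ℂ) * x i + ((3 / 5 : ℝ) : ℂ) * x j := fun x => by
      rw [matrixIsometry_apply, hUj]
      push_cast
      ring
    have q1 := integral_comp_sphereMap hU (F := fun x => ‖x i‖ ^ 2) (by fun_prop)
    have q2 := integral_comp_sphereMap hU (F := fun x => ‖x i‖ ^ 2 * ‖x i‖ ^ 2) (by fun_prop)
    have q3 := integral_comp_sphereMap hU (F := fun x => ‖x j‖ ^ 2 * ‖x j‖ ^ 2) (by fun_prop)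
    simp only [ei, ej] at q1 q2 q3
    rw [lin2 _ _ i j hij] at q1
    rw [lin4 _ _ i j hij] at q2 q3
    change _ = s i at q1
    change _ = b i i at q2
    change _ = b j j at q3
    -- With `81 = 3⁴`, `256 = 4⁴`, `576 = 4·3²·4²`, the relations read `625 b i i = 81 b i i + 256 b
    -- j j + 576 b i j` and the same with `b i i`, `b j j` exchanged on the right for `625 b j j`.
    refine ⟨by linarith, ?_, ?_⟩ <;> linarith
  have hnorm : ∀ φ : Metric.sphere (0 : EuclideanSpace ℂ ι) 1, ∑ i, ‖φ.1 i‖ ^ 2 = 1 := fun φ => by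
    rw [← EuclideanSpace.norm_sq_eq, mem_sphere_zero_iff_norm.1 φ.2, one_pow]
  have hsum2 : ∑ i, s i = 1 := by
    simp only [hs]
    rw [← integral_finsetSum _ fun i _ => i2 i]
    simp [hnorm]
  have hsum4 : ∑ i, ∑ j, b i j = 1 := by
    simp only [hb]
    have : ∀ i, ∑ j, ∫ φ, ‖φ.1 i‖ ^ 2 * ‖φ.1 j‖ ^ 2 ∂(uniformSphere ι) =
        ∫ φ, ∑ j, ‖φ.1 i‖ ^ 2 * ‖φ.1 j‖ ^ 2 ∂(uniformSphere ι) := fun i =>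
      (integral_finsetSum _ fun j _ => i4 i j).symm
    simp only [this]
    rw [← integral_finsetSum _ fun i _ => integrable_finsetSum _ fun j _ => i4 i j]
    simp only [← Finset.mul_sum, hnorm, mul_one]
    simp
  have hcard : (0 : ℝ) < Fintype.card ι := by exact_mod_cast Fintype.card_pos
  have hs1 : ∀ i, s i = (Fintype.card ι : ℝ)⁻¹ := fun i => by
    have : ∀ j ∈ Finset.univ, s j = s i := fun j _ => by
      by_cases h : i = j
      · rw [h]
      · exact ((hrel i j h).1).symm
    rw [Finset.sum_congr rfl this, Finset.sum_const, nsmul_eq_mul, Finset.card_univ] at hsum2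
    field_simp
    linarith
  have hb1 : ∀ i, b i i = 2 * ((Fintype.card ι : ℝ) * (Fintype.card ι + 1))⁻¹ := fun i => by
    have : ∀ k ∈ Finset.univ, ∑ j, b k j = b i i * (((Fintype.card ι : ℝ) + 1) / 2) := by
      intro k _
      have hk : b k k = b i i := by
        by_cases h : i = k
        · rw [h]
        · exact ((hrel i k h).2.1).symm
      have : ∀ j ∈ Finset.univ, b k j = b i i / 2 + if k = j then b i i / 2 else 0 := by
        intro j _
        by_cases h : k = j
        · subst h
          rw [if_pos rfl, hk]
          ring
        · rw [if_neg h, ← hk, (hrel k j h).2.2]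
          ring
      rw [Finset.sum_congr rfl this, Finset.sum_add_distrib, Finset.sum_ite_eq]
      simp only [Finset.sum_const, Finset.mem_univ, if_true, nsmul_eq_mul, Finset.card_univ]
      ring
    rw [Finset.sum_congr rfl this, Finset.sum_const, nsmul_eq_mul, Finset.card_univ] at hsum4
    field_simp
    linarith
  refine ⟨hs1, fun i j hij => ?_, hb1⟩
  have h1 := (hrel i j hij).2.2
  rw [hb1] at h1
  change b i j = _
  linarith

/-- With `d` the dimension, scaling by `√d` makes the second moment 1, the mixed moment `d/(d+1)`
and the fourth moment `2d/(d+1)`. The last is why `HasCodeMoments.fourth` allows 2. -/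
lemma hasCodeMoments_sphere [Nonempty ι] :
    HasCodeMoments (uniformSphere ι)
      (fun (i : ι) φ => ((√(Fintype.card ι : ℝ) : ℝ) : ℂ) * φ.1 i) := by
  obtain ⟨h2, h4, h4'⟩ := sphere_moments (ι := ι)
  have hcard : (0 : ℝ) < Fintype.card ι := by exact_mod_cast Fintype.card_pos
  have hn : ∀ (φ : Metric.sphere (0 : EuclideanSpace ℂ ι) 1) (i : ι),
      ‖((√(Fintype.card ι : ℝ) : ℝ) : ℂ) * φ.1 i‖ ^ 2 = (Fintype.card ι : ℝ) * ‖φ.1 i‖ ^ 2 :=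
    fun φ i => by
      rw [norm_mul, Complex.norm_real, mul_pow, Real.norm_eq_abs, sq_abs, Real.sq_sqrt hcard.le]
  have hn4 : ∀ (φ : Metric.sphere (0 : EuclideanSpace ℂ ι) 1) (i j : ι),
      (Fintype.card ι : ℝ) * ‖φ.1 i‖ ^ 2 * ((Fintype.card ι : ℝ) * ‖φ.1 j‖ ^ 2) =
      (Fintype.card ι : ℝ) ^ 2 * (‖φ.1 i‖ ^ 2 * ‖φ.1 j‖ ^ 2) := fun φ i j => by ring
  have hle : (Fintype.card ι : ℝ) ^ 2 * ((Fintype.card ι : ℝ) * (Fintype.card ι + 1))⁻¹ ≤ 1 := by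
    rw [mul_inv_le_iff₀ (by positivity)]
    nlinarith
  refine ⟨phaseInvariant_sphere _, fun i => ?_, fun i j hij => ?_, fun i => ?_⟩
  · simp only [hn]
    rw [integral_const_mul, h2, mul_inv_cancel₀ hcard.ne']
  · simp only [hn, hn4]
    rw [integral_const_mul, h4 i j hij]
    exact hle
  · simp only [hn, hn4]
    rw [integral_const_mul, h4' i]
    linarith

end Sphere

/-! ### Second moments of random outputs -/

section RandomOutput

variable {Ω τ E B : Type*} [MeasurableSpace Ω] {μ : Measure Ω} {c : τ → Ω → ℂ}

/-- The mixed fourth moment `E |c i|² |c j|²`. -/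
noncomputable def mixedMoment (μ : Measure Ω) (c : τ → Ω → ℂ) (i j : τ) : ℝ :=
  ∫ ω, ‖c i ω‖ ^ 2 * ‖c j ω‖ ^ 2 ∂μ

/-- A Wick-type formula: only the two pairings of conjugated with unconjugated indices survive. They
coincide when all indices agree, so the second pairing omits `i = j`. -/
lemma PhaseInvariant.fourth_apply [DecidableEq τ] (h : PhaseInvariant μ c) (i j l k : τ) :
    ∫ ω, c i ω * conj (c j ω) * (c k ω * conj (c l ω)) ∂μ =
      (if i = j then if l = k then (mixedMoment μ c i l : ℂ) else 0 else 0) +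
      if i = l then if j = k then if i = j then 0 else (mixedMoment μ c i j : ℂ) else 0 else 0 := by
  have hm : ∀ i j, ∫ ω, c i ω * conj (c i ω) * (c j ω * conj (c j ω)) ∂μ =
      (mixedMoment μ c i j : ℂ) := fun i j => by
    rw [mixedMoment, ← integral_complex_ofReal]
    congr 1
    ext ω
    rw [Complex.mul_conj', Complex.mul_conj']
    push_cast
    rfl
  by_cases h1 : i = j ∧ l = k
  · obtain ⟨rfl, rfl⟩ := h1
    rw [hm]
    simp
  · by_cases h2 : i = l ∧ j = k
    · obtain ⟨rfl, rfl⟩ := h2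
      have hij : i ≠ j := by tauto
      have : ∀ ω, c i ω * conj (c j ω) * (c j ω * conj (c i ω)) =
          c i ω * conj (c i ω) * (c j ω * conj (c j ω)) := fun ω => by ring
      simp only [this, hm]
      simp [hij]
    · rw [h.fourth_eq_zero (by tauto) (by tauto)]
      have a1 : (if i = j then if l = k then (mixedMoment μ c i l : ℂ) else 0 else 0) = 0 := by
        split_ifs <;> first | rfl | tauto
      have a2 : (if i = l then if j = k then if i = j then 0 else
          (mixedMoment μ c i j : ℂ) else 0 else 0) = 0 := by
        split_ifs <;> first | rfl | tauto
      rw [a1, a2, add_zero]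

variable [Fintype τ] [DecidableEq τ] [Fintype E] [Fintype B]

lemma HasCodeMoments.integral_norm_sq_sum (h : HasCodeMoments μ c) (x : τ → ℂ) :
    Integrable (fun ω => ‖∑ i, c i ω * x i‖ ^ 2) μ ∧
      ∫ ω, ‖∑ i, c i ω * x i‖ ^ 2 ∂μ = ∑ i, ‖x i‖ ^ 2 := by
  have e : ∀ ω, ((‖∑ i, c i ω * x i‖ ^ 2 : ℝ) : ℂ) =
      ∑ i, ∑ j, c i ω * conj (c j ω) * (x i * conj (x j)) := fun ω => by
    rw [Complex.ofReal_pow, ← Complex.mul_conj', map_sum, Finset.sum_mul_sum]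
    refine Finset.sum_congr rfl fun i _ => Finset.sum_congr rfl fun j _ => ?_
    rw [map_mul]
    ring
  have hi : ∀ i j, Integrable (fun ω => c i ω * conj (c j ω) * (x i * conj (x j))) μ :=
    fun i j => (h.integrable_second i j).mul_const _
  have hint : Integrable (fun ω => ((‖∑ i, c i ω * x i‖ ^ 2 : ℝ) : ℂ)) μ := by
    simp only [e]
    exact integrable_finsetSum _ fun i _ => integrable_finsetSum _ fun j _ => hi i j
  have hre := hint.re
  simp only [RCLike.re_to_complex, Complex.ofReal_re] at hre
  refine ⟨hre, ?_⟩
  have h1 : ∫ ω, ((‖∑ i, c i ω * x i‖ ^ 2 : ℝ) : ℂ) ∂μ = ((∑ i, ‖x i‖ ^ 2 : ℝ) : ℂ) := by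
    simp only [e]
    rw [integral_finsetSum _ fun i _ => integrable_finsetSum _ fun j _ => hi i j]
    push_cast
    refine Finset.sum_congr rfl fun i _ => ?_
    rw [integral_finsetSum _ fun j _ => hi i j]
    simp only [integral_mul_const, h.second_apply, ite_mul, one_mul, zero_mul,
      Finset.sum_ite_eq, Finset.mem_univ, if_true]
    exact Complex.mul_conj' _
  rw [integral_complex_ofReal] at h1
  exact_mod_cast h1

lemma HasCodeMoments.integral_hsSq_sum (h : HasCodeMoments μ c) (X : τ → Matrix E B ℂ) :
    Integrable (fun ω => hsSq (∑ i, c i ω • X i)) μ ∧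
      ∫ ω, hsSq (∑ i, c i ω • X i) ∂μ = ∑ i, hsSq (X i) := by
  have e : ∀ ω, hsSq (∑ i, c i ω • X i) = ∑ k, ∑ y, ‖∑ i, c i ω * X i k y‖ ^ 2 := fun ω => by
    simp [hsSq, Matrix.sum_apply]
  have hi := fun k y => h.integral_norm_sq_sum fun i => X i k y
  simp only [e]
  refine ⟨integrable_finsetSum _ fun k _ => integrable_finsetSum _ fun y _ => (hi k y).1, ?_⟩
  rw [integral_finsetSum _ fun k _ => integrable_finsetSum _ fun y _ => (hi k y).1]
  simp only [hsSq]
  rw [Finset.sum_comm]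
  refine Finset.sum_congr rfl fun k _ => ?_
  rw [integral_finsetSum _ fun y _ => (hi k y).1, Finset.sum_comm]
  exact Finset.sum_congr rfl fun y _ => (hi k y).2

/-- The variance of a quadratic form in the random coefficients. -/
lemma HasCodeMoments.integral_norm_sq_quadratic (h : HasCodeMoments μ c) (x : τ → τ → ℂ) :
    Integrable (fun ω => ‖(∑ i, ∑ j, c i ω * conj (c j ω) * x i j) - ∑ i, x i i‖ ^ 2) μ ∧
      ∫ ω, ‖(∑ i, ∑ j, c i ω * conj (c j ω) * x i j) - ∑ i, x i i‖ ^ 2 ∂μ =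
        (∑ i, ∑ j, (mixedMoment μ c i j * (x i i * conj (x j j)).re +
          if i = j then 0 else mixedMoment μ c i j * ‖x i j‖ ^ 2)) - ‖∑ i, x i i‖ ^ 2 := by
  have := h.prob
  set z : Ω → ℂ := fun ω => ∑ i, ∑ j, c i ω * conj (c j ω) * x i j with hz
  set t := ∑ i, x i i with ht
  have hi2 : ∀ i j, Integrable (fun ω => c i ω * conj (c j ω) * x i j) μ :=
    fun i j => (h.integrable_second i j).mul_const _
  have hzi : Integrable z μ :=
    integrable_finsetSum _ fun i _ => integrable_finsetSum _ fun j _ => hi2 i j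
  have hzt : ∫ ω, z ω ∂μ = t := by
    simp only [hz]
    rw [integral_finsetSum _ fun i _ => integrable_finsetSum _ fun j _ => hi2 i j]
    refine Finset.sum_congr rfl fun i _ => ?_
    rw [integral_finsetSum _ fun j _ => hi2 i j]
    simp [integral_mul_const, h.second_apply]
  have hzz : ∀ ω, z ω * conj (z ω) = ∑ i, ∑ j, ∑ l, ∑ k,
      c i ω * conj (c j ω) * (c k ω * conj (c l ω)) * (x i j * conj (x l k)) := fun ω => by
    simp only [hz, map_sum]
    rw [Finset.sum_mul]
    refine Finset.sum_congr rfl fun i _ => ?_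
    rw [Finset.sum_mul]
    refine Finset.sum_congr rfl fun j _ => ?_
    rw [Finset.mul_sum]
    refine Finset.sum_congr rfl fun l _ => ?_
    rw [Finset.mul_sum]
    refine Finset.sum_congr rfl fun k _ => ?_
    simp only [map_mul, Complex.conj_conj]
    ring
  have hi4 : ∀ i j l k, Integrable (fun ω =>
      c i ω * conj (c j ω) * (c k ω * conj (c l ω)) * (x i j * conj (x l k))) μ :=
    fun i j l k => (h.integrable_fourth i j k l).mul_const _
  have hzzi : Integrable (fun ω => z ω * conj (z ω)) μ := by
    simp only [hzz]
    exact integrable_finsetSum _ fun i _ => integrable_finsetSum _ fun j _ =>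
      integrable_finsetSum _ fun l _ => integrable_finsetSum _ fun k _ => hi4 i j l k
  have hzze : ∫ ω, z ω * conj (z ω) ∂μ = ∑ i, ∑ j, (mixedMoment μ c i j * (x i i * conj (x j j)) +
      if i = j then 0 else (mixedMoment μ c i j : ℂ) * (x i j * conj (x i j))) := by
    simp only [hzz]
    have step : ∫ ω, (∑ i, ∑ j, ∑ l, ∑ k,
        c i ω * conj (c j ω) * (c k ω * conj (c l ω)) * (x i j * conj (x l k))) ∂μ =
        ∑ i, ∑ j, ∑ l, ∑ k, (∫ ω, c i ω * conj (c j ω) * (c k ω * conj (c l ω)) ∂μ) *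
          (x i j * conj (x l k)) := by
      rw [integral_finsetSum _ fun i _ => integrable_finsetSum _ fun j _ =>
        integrable_finsetSum _ fun l _ => integrable_finsetSum _ fun k _ => hi4 i j l k]
      refine Finset.sum_congr rfl fun i _ => ?_
      rw [integral_finsetSum _ fun j _ =>
        integrable_finsetSum _ fun l _ => integrable_finsetSum _ fun k _ => hi4 i j l k]
      refine Finset.sum_congr rfl fun j _ => ?_
      rw [integral_finsetSum _ fun l _ => integrable_finsetSum _ fun k _ => hi4 i j l k]
      refine Finset.sum_congr rfl fun l _ => ?_
      rw [integral_finsetSum _ fun k _ => hi4 i j l k]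
      exact Finset.sum_congr rfl fun k _ => integral_mul_const _ _
    rw [step]
    simp only [h.fourth_apply, add_mul, Finset.sum_add_distrib, ite_mul, zero_mul]
    congr 1
    · refine Finset.sum_congr rfl fun i _ => ?_
      have : ∀ j, (∑ l, ∑ k, if i = j then if l = k then
          (mixedMoment μ c i l : ℂ) * (x i j * conj (x l k)) else 0 else 0) =
          if i = j then ∑ l, (mixedMoment μ c i l : ℂ) * (x i j * conj (x l l)) else 0 := by
        intro j
        split_ifs with hij
        · simp
        · simp
      simp only [this]
      simp
    · refine Finset.sum_congr rfl fun i _ => Finset.sum_congr rfl fun j _ => ?_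
      have : ∀ l, (∑ k, if i = l then if j = k then if i = j then 0 else
          (mixedMoment μ c i j : ℂ) * (x i j * conj (x l k)) else 0 else 0) =
          if i = l then (if i = j then 0 else
            (mixedMoment μ c i j : ℂ) * (x i j * conj (x l j))) else 0 := by
        intro l
        split_ifs <;> simp_all
      simp only [this]
      simp
  have e : ∀ ω, ((‖z ω - t‖ ^ 2 : ℝ) : ℂ) =
      z ω * conj (z ω) - z ω * conj t - (t * conj (z ω) - t * conj t) := fun ω => by
    rw [Complex.ofReal_pow, ← Complex.mul_conj', map_sub]
    ring
  have hconj : Integrable (fun ω => conj (z ω)) μ := by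
    simpa using Complex.conjLIE.toContinuousLinearEquiv.integrable_comp_iff.2 hzi
  have i1 := hzzi.sub (hzi.mul_const (conj t))
  have i2 := (hconj.const_mul t).sub (integrable_const (μ := μ) (t * conj t))
  have hint : Integrable (fun ω => ((‖z ω - t‖ ^ 2 : ℝ) : ℂ)) μ := by
    simp only [e]
    exact i1.sub i2
  have hre := hint.re
  simp only [RCLike.re_to_complex, Complex.ofReal_re] at hre
  refine ⟨hre, ?_⟩
  have h1 : ∫ ω, ((‖z ω - t‖ ^ 2 : ℝ) : ℂ) ∂μ = (∫ ω, z ω * conj (z ω) ∂μ) - t * conj t := by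
    simp only [e]
    rw [integral_sub (by exact i1) (by exact i2), integral_sub hzzi (hzi.mul_const _),
      integral_sub (hconj.const_mul _) (integrable_const _), integral_mul_const,
      integral_const_mul, integral_conj, hzt]
    simp
  rw [integral_complex_ofReal, hzze, Complex.mul_conj'] at h1
  have h2 := congrArg Complex.re h1
  rw [Complex.ofReal_re, Complex.sub_re, Complex.re_sum, ← Complex.ofReal_pow,
    Complex.ofReal_re] at h2
  rw [h2]
  congr 1
  refine Finset.sum_congr rfl fun i _ => ?_
  rw [Complex.re_sum]
  refine Finset.sum_congr rfl fun j _ => ?_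
  rw [Complex.add_re, Complex.re_ofReal_mul]
  congr 1
  split_ifs
  · rfl
  · rw [Complex.mul_conj', ← Complex.ofReal_pow, ← Complex.ofReal_mul, Complex.ofReal_re]

lemma hsSq_eq_re_trace (X : Matrix E B ℂ) : hsSq X = (X * Xᴴ).trace.re := by
  rw [trace_mul_conjTranspose_self, Complex.ofReal_re]

/-- The random operator `ΨΨᴴ`, for `Ψ = ∑ c i • G i`, has small variance. -/
lemma HasCodeMoments.integral_hsSq_output (h : HasCodeMoments μ c) (G : τ → Matrix E B ℂ) :
    Integrable (fun ω => hsSq ((∑ i, c i ω • G i) * (∑ i, c i ω • G i)ᴴ - ∑ i, G i * (G i)ᴴ)) μ ∧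
      ∫ ω, hsSq ((∑ i, c i ω • G i) * (∑ i, c i ω • G i)ᴴ - ∑ i, G i * (G i)ᴴ) ∂μ ≤
        ∑ i, ∑ j, hsSq (G i * (G j)ᴴ) := by
  set Q : τ → τ → Matrix E E ℂ := fun i j => G i * (G j)ᴴ with hQ
  have e : ∀ ω, hsSq ((∑ i, c i ω • G i) * (∑ i, c i ω • G i)ᴴ - ∑ i, G i * (G i)ᴴ) =
      ∑ k, ∑ l, ‖(∑ i, ∑ j, c i ω * conj (c j ω) * Q i j k l) - ∑ i, Q i i k l‖ ^ 2 := fun ω => by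
    have : (∑ i, c i ω • G i) * (∑ i, c i ω • G i)ᴴ =
        ∑ i, ∑ j, (c i ω * conj (c j ω)) • Q i j := by
      rw [conjTranspose_sum, Matrix.sum_mul]
      refine Finset.sum_congr rfl fun i _ => ?_
      rw [Matrix.mul_sum]
      refine Finset.sum_congr rfl fun j _ => ?_
      rw [conjTranspose_smul, Matrix.smul_mul, Matrix.mul_smul, smul_smul]
      rfl
    rw [this]
    simp only [hsSq, Matrix.sub_apply, Matrix.sum_apply, Matrix.smul_apply, smul_eq_mul, hQ]
  have hi := fun k l => h.integral_norm_sq_quadratic fun i j => Q i j k l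
  simp only [e]
  refine ⟨integrable_finsetSum _ fun k _ => integrable_finsetSum _ fun y _ => (hi k y).1, ?_⟩
  -- The first pairing contributes `Tr(Gᵢ Gᵢᴴ Gⱼ Gⱼᴴ)`, whose nonnegativity permits replacing the
  -- mixed moments by their upper bounds. With unit moments these terms sum to the squared norm of
  -- the mean, which is subtracted.
  have hT : ∀ i j, ∑ k, ∑ l, (Q i i k l * conj (Q j j k l)).re = hsSq ((G j)ᴴ * G i) := by
    intro i j
    rw [hsSq_eq_re_trace]
    have e1 : ((G j)ᴴ * G i * ((G j)ᴴ * G i)ᴴ).trace = (Q i i * (Q j j)ᴴ).trace := by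
      simp only [hQ, conjTranspose_mul, conjTranspose_conjTranspose]
      rw [Matrix.mul_assoc, trace_mul_comm]
      simp only [Matrix.mul_assoc]
    rw [e1]
    simp only [Matrix.trace, Matrix.diag, Matrix.mul_apply, conjTranspose_apply, Complex.re_sum]
    rfl
  have hTii : ∀ i, hsSq ((G i)ᴴ * G i) = hsSq (Q i i) := fun i => by
    rw [← hT]
    simp only [hsSq]
    refine Finset.sum_congr rfl fun k _ => Finset.sum_congr rfl fun l _ => ?_
    rw [Complex.mul_conj', ← Complex.ofReal_pow, Complex.ofReal_re]
  have hθ : ∑ k, ∑ l, ‖∑ i, Q i i k l‖ ^ 2 = ∑ i, ∑ j, hsSq ((G j)ᴴ * G i) := by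
    have : ∀ k l, ‖∑ i, Q i i k l‖ ^ 2 = ∑ i, ∑ j, (Q i i k l * conj (Q j j k l)).re := by
      intro k l
      have h1 : ((‖∑ i, Q i i k l‖ ^ 2 : ℝ) : ℂ) = ∑ i, ∑ j, Q i i k l * conj (Q j j k l) := by
        rw [Complex.ofReal_pow, ← Complex.mul_conj', map_sum, Finset.sum_mul_sum]
      have h2 := congrArg Complex.re h1
      simpa only [Complex.ofReal_re, Complex.re_sum] using h2
    simp only [this, ← hT]
    calc ∑ k, ∑ l, ∑ i, ∑ j, (Q i i k l * conj (Q j j k l)).re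
        = ∑ k, ∑ i, ∑ l, ∑ j, (Q i i k l * conj (Q j j k l)).re :=
          Finset.sum_congr rfl fun k _ => Finset.sum_comm
      _ = ∑ i, ∑ k, ∑ l, ∑ j, (Q i i k l * conj (Q j j k l)).re := Finset.sum_comm
      _ = ∑ i, ∑ k, ∑ j, ∑ l, (Q i i k l * conj (Q j j k l)).re :=
          Finset.sum_congr rfl fun i _ => Finset.sum_congr rfl fun k _ => Finset.sum_comm
      _ = _ := Finset.sum_congr rfl fun i _ => Finset.sum_comm
  have hmain : ∑ k, ∑ l, ∑ i, ∑ j, (mixedMoment μ c i j * (Q i i k l * conj (Q j j k l)).re +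
          if i = j then 0 else mixedMoment μ c i j * ‖Q i j k l‖ ^ 2) =
      ∑ i, ∑ j, (mixedMoment μ c i j * hsSq ((G j)ᴴ * G i) +
        if i = j then 0 else mixedMoment μ c i j * hsSq (Q i j)) := by
    calc _ = ∑ k, ∑ i, ∑ l, ∑ j, (mixedMoment μ c i j * (Q i i k l * conj (Q j j k l)).re +
          if i = j then 0 else mixedMoment μ c i j * ‖Q i j k l‖ ^ 2) :=
          Finset.sum_congr rfl fun k _ => Finset.sum_comm
      _ = ∑ i, ∑ k, ∑ l, ∑ j, (mixedMoment μ c i j * (Q i i k l * conj (Q j j k l)).re +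
          if i = j then 0 else mixedMoment μ c i j * ‖Q i j k l‖ ^ 2) := Finset.sum_comm
      _ = ∑ i, ∑ k, ∑ j, ∑ l, (mixedMoment μ c i j * (Q i i k l * conj (Q j j k l)).re +
          if i = j then 0 else mixedMoment μ c i j * ‖Q i j k l‖ ^ 2) :=
          Finset.sum_congr rfl fun i _ => Finset.sum_congr rfl fun k _ => Finset.sum_comm
      _ = ∑ i, ∑ j, ∑ k, ∑ l, (mixedMoment μ c i j * (Q i i k l * conj (Q j j k l)).re +
          if i = j then 0 else mixedMoment μ c i j * ‖Q i j k l‖ ^ 2) :=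
          Finset.sum_congr rfl fun i _ => Finset.sum_comm
      _ = _ := by
          refine Finset.sum_congr rfl fun i _ => Finset.sum_congr rfl fun j _ => ?_
          simp only [Finset.sum_add_distrib, ← Finset.mul_sum, hT]
          congr 1
          split_ifs
          · simp
          · simp only [← Finset.mul_sum, hsSq]
  calc ∫ ω, ∑ k, ∑ l, ‖(∑ i, ∑ j, c i ω * conj (c j ω) * Q i j k l) - ∑ i, Q i i k l‖ ^ 2 ∂μ
      = ∑ k, ∑ l, ((∑ i, ∑ j, (mixedMoment μ c i j * (Q i i k l * conj (Q j j k l)).re +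
          if i = j then 0 else mixedMoment μ c i j * ‖Q i j k l‖ ^ 2)) -
            ‖∑ i, Q i i k l‖ ^ 2) := by
        rw [integral_finsetSum _ fun k _ => integrable_finsetSum _ fun y _ => (hi k y).1]
        refine Finset.sum_congr rfl fun k _ => ?_
        rw [integral_finsetSum _ fun y _ => (hi k y).1]
        exact Finset.sum_congr rfl fun y _ => (hi k y).2
    _ = (∑ i, ∑ j, (mixedMoment μ c i j * hsSq ((G j)ᴴ * G i) +
          if i = j then 0 else mixedMoment μ c i j * hsSq (Q i j))) -
        ∑ i, ∑ j, hsSq ((G j)ᴴ * G i) := by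
        simp only [Finset.sum_sub_distrib]
        rw [hmain, hθ]
    _ ≤ ∑ i, ∑ j, hsSq (Q i j) := by
        rw [sub_le_iff_le_add, ← Finset.sum_add_distrib]
        refine Finset.sum_le_sum fun i _ => ?_
        rw [← Finset.sum_add_distrib]
        refine Finset.sum_le_sum fun j _ => ?_
        have n1 := hsSq_nonneg ((G j)ᴴ * G i)
        have n2 := hsSq_nonneg (Q i j)
        -- On the diagonal the moment is at most 2: one copy is cancelled by the mean, the other is
        -- the term that the second pairing omitted. Off the diagonal the first pairing is cancelled
        -- by the mean.
        split_ifs with hij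
        · subst hij
          have := h.fourth i
          change mixedMoment μ c i i ≤ 2 at this
          rw [hTii] at n1 ⊢
          nlinarith
        · have := h.mixed i j hij
          change mixedMoment μ c i j ≤ 1 at this
          nlinarith

end RandomOutput

/-! ### Decoupling: truncation to typical output sequences -/

section Decoupling

variable {Ω τ E B : Type*} [MeasurableSpace Ω]

/-- Hölder gives `2 ‖X - Y‖ ‖X‖` in Hilbert–Schmidt norms. The AM–GM form with weight `s` is linear
in the squared norms, so for random `X` its mean is known exactly. -/
lemma traceNorm_mul_conjTranspose_sub_le [Fintype E] [DecidableEq E] [Fintype B] (X Y : Matrix E B ℂ)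
    (hYX : hsSq Y ≤ hsSq X) {s : ℝ} (hs : 0 < s) :
    traceNorm (X * Xᴴ - Y * Yᴴ) ≤ hsSq (X - Y) / s + s * hsSq X := by
  have e : X * Xᴴ - Y * Yᴴ = X * (X - Y)ᴴ + (X - Y) * Yᴴ := by
    rw [conjTranspose_sub, Matrix.mul_sub, Matrix.sub_mul]
    abel
  have h1 := traceNorm_mul_conjTranspose_le X (X - Y)
  have h2 := traceNorm_mul_conjTranspose_le (X - Y) Y
  have h3 := Real.sqrt_le_sqrt hYX
  have h4 : √(hsSq (X - Y)) * √(hsSq Y) ≤ √(hsSq (X - Y)) * √(hsSq X) := by gcongr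
  have ha := Real.sq_sqrt (hsSq_nonneg (X - Y))
  have hb := Real.sq_sqrt (hsSq_nonneg X)
  set a := √(hsSq (X - Y))
  set b := √(hsSq X)
  have h5 : 2 * (a * b) ≤ a ^ 2 / s + s * b ^ 2 := by
    have : 0 ≤ (a - s * b) ^ 2 / s := by positivity
    have e2 : (a - s * b) ^ 2 / s = a ^ 2 / s + s * b ^ 2 - 2 * (a * b) := by
      field_simp
      ring
    linarith
  rw [ha, hb] at h5
  rw [e]
  have h6 := traceNorm_add_le (X * (X - Y)ᴴ) ((X - Y) * Yᴴ)
  nlinarith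

/-- The restriction of a matrix to the rows in `sE` and the columns in `sB`. -/
def truncate [DecidableEq E] [DecidableEq B] (sE : Finset E) (sB : Finset B) (X : Matrix E B ℂ) : Matrix E B ℂ :=
  Matrix.of fun k y => if k ∈ sE ∧ y ∈ sB then X k y else 0

lemma hsSq_truncate_le [Fintype E] [DecidableEq E] [Fintype B] [DecidableEq B]
    (sE : Finset E) (sB : Finset B) (X : Matrix E B ℂ) :
    hsSq (truncate sE sB X) ≤ hsSq X := by
  refine Finset.sum_le_sum fun k _ => Finset.sum_le_sum fun y _ => ?_
  simp only [truncate, Matrix.of_apply]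
  split_ifs
  · exact le_rfl
  · rw [norm_zero, zero_pow two_ne_zero]
    positivity

lemma truncate_sum_smul [Fintype τ] [DecidableEq E] [DecidableEq B] (sE : Finset E) (sB : Finset B) (z : τ → ℂ)
    (X : τ → Matrix E B ℂ) :
    truncate sE sB (∑ i, z i • X i) = ∑ i, z i • truncate sE sB (X i) := by
  ext k y
  simp only [truncate, Matrix.of_apply, Matrix.sum_apply, Matrix.smul_apply]
  split_ifs <;> simp

/-- The matrices `X i` side by side. -/
def blockRow (X : τ → Matrix E B ℂ) : Matrix E (τ × B) ℂ := Matrix.of fun k p => X p.1 k p.2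

lemma blockRow_mul_conjTranspose [Fintype τ] [Fintype B] (X : τ → Matrix E B ℂ) :
    blockRow X * (blockRow X)ᴴ = ∑ i, X i * (X i)ᴴ := by
  ext k l
  simp [Matrix.mul_apply, Matrix.sum_apply, blockRow, Fintype.sum_prod_type]

lemma hsSq_blockRow [Fintype τ] [Fintype E] [Fintype B] (X : τ → Matrix E B ℂ) :
    hsSq (blockRow X) = ∑ i, hsSq (X i) := by
  simp only [hsSq, blockRow, Matrix.of_apply, Fintype.sum_prod_type]
  rw [Finset.sum_comm]

/-- A random superposition `Ψ = ∑ c i • W i` gives an operator `ΨΨᴴ` close to `∑ W i (W i)ᴴ` in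
trace norm, if up to small corrections the `W i` have few nonzero rows and `∑ (W i)ᴴ W i` is
small. The deviation is dominated by an integrable function of small mean. -/
lemma HasCodeMoments.exists_dominating [Fintype τ] [DecidableEq τ] [Fintype E]
    [DecidableEq E] [Fintype B] [DecidableEq B] {μ : Measure Ω} {c : τ → Ω → ℂ}
    (h : HasCodeMoments μ c) (W : τ → Matrix E B ℂ) (sE : Finset E) (sB : Finset B)
    (hW1 : ∑ i, hsSq (W i) = 1) {ε m : ℝ} (hm0 : 0 ≤ m)
    (hε : ∑ i, hsSq (W i - truncate sE sB (W i)) ≤ ε)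
    (hm : ∀ v : B → ℂ, (∀ y, y ∉ sB → v y = 0) →
      ∑ i, ∑ k, ‖∑ y, W i k y * v y‖ ^ 2 ≤ m * ∑ y, ‖v y‖ ^ 2)
    {s u : ℝ} (hs : 0 < s) (hu : 0 < u) :
    ∃ g : Ω → ℝ, Integrable g μ ∧
      (∀ ω, traceNorm ((∑ i, c i ω • W i) * (∑ i, c i ω • W i)ᴴ - ∑ i, W i * (W i)ᴴ) ≤ g ω) ∧
      ∫ ω, g ω ∂μ ≤ 2 * (ε / s + s) + (sE.card * m / u + u) := by
  have := h.prob
  set G : τ → Matrix E B ℂ := fun i => truncate sE sB (W i) with hG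
  -- The hypothesis `hm` is applied to every conjugated row of every `G j`. These rows are supported
  -- in `sB`, and their squared lengths sum to at most 1.
  have hGsum : ∑ i, ∑ j, hsSq (G i * (G j)ᴴ) ≤ m := by
    rw [Finset.sum_comm]
    calc ∑ j, ∑ i, hsSq (G i * (G j)ᴴ)
        ≤ ∑ j, ∑ l, m * ∑ y, ‖conj (G j l y)‖ ^ 2 := by
          refine Finset.sum_le_sum fun j _ => ?_
          have e1 : ∑ i, hsSq (G i * (G j)ᴴ) =
              ∑ l, ∑ i, ∑ k, ‖∑ y, G i k y * conj (G j l y)‖ ^ 2 := by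
            rw [Finset.sum_comm]
            refine Finset.sum_congr rfl fun i _ => ?_
            rw [hsSq, Finset.sum_comm]
            rfl
          rw [e1]
          refine Finset.sum_le_sum fun l _ => ?_
          have hsupp : ∀ y, y ∉ sB → conj (G j l y) = 0 := fun y hy => by
            simp [hG, truncate, hy]
          refine le_trans ?_ (hm (fun y => conj (G j l y)) hsupp)
          refine Finset.sum_le_sum fun i _ => Finset.sum_le_sum fun k _ => ?_
          by_cases hk : k ∈ sE
          · have : ∀ y, G i k y * conj (G j l y) = W i k y * conj (G j l y) := fun y => by
              by_cases hy : y ∈ sB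
              · simp [hG, truncate, hy, hk]
              · rw [hsupp y hy, mul_zero, mul_zero]
            simp only [this, le_refl]
          · have : ∀ y, G i k y = 0 := fun y => by simp [hG, truncate, hk]
            simp only [this, zero_mul, Finset.sum_const_zero, norm_zero, ne_eq,
              OfNat.ofNat_ne_zero, not_false_eq_true, zero_pow]
            positivity
      _ = m * ∑ j, hsSq (G j) := by
          rw [Finset.mul_sum]
          refine Finset.sum_congr rfl fun j _ => ?_
          rw [← Finset.mul_sum]
          simp only [RCLike.norm_conj, hsSq]
      _ ≤ m * 1 := by
          rw [← hW1]
          gcongr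
          exact hsSq_truncate_le _ _ _
      _ = m := mul_one m
  have q1 := h.integral_hsSq_sum W
  have q2 := h.integral_hsSq_sum fun i => W i - G i
  have q3 := h.integral_hsSq_output G
  have i1 := q2.1.div_const s
  have i2 := q1.1.const_mul s
  have i3 := (q3.1.const_mul (sE.card : ℝ)).div_const u
  have i4 : Integrable (fun _ : Ω => u + (ε / s + s)) μ := integrable_const _
  -- A dominating function built from quadratic and quartic expressions, so the trace norm itself
  -- need not be integrated. Its pieces bound the truncation of `Ψ`, the fluctuation of the
  -- truncated operator, and the truncation of the mean.
  refine ⟨fun ω => hsSq (∑ i, c i ω • (W i - G i)) / s + s * hsSq (∑ i, c i ω • W i) +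
    sE.card * hsSq ((∑ i, c i ω • G i) * (∑ i, c i ω • G i)ᴴ - ∑ i, G i * (G i)ᴴ) / u +
    (u + (ε / s + s)), ((i1.add i2).add i3).add i4, fun ω => ?_, ?_⟩
  · set Ψ := ∑ i, c i ω • W i with hΨ
    set Ψ' := ∑ i, c i ω • G i with hΨ'
    have e1 : Ψ' = truncate sE sB Ψ := (truncate_sum_smul _ _ _ _).symm
    have e2 : Ψ - Ψ' = ∑ i, c i ω • (W i - G i) := by
      rw [hΨ, hΨ', ← Finset.sum_sub_distrib]
      simp only [smul_sub]
    have b1 : traceNorm (Ψ * Ψᴴ - Ψ' * Ψ'ᴴ) ≤ hsSq (Ψ - Ψ') / s + s * hsSq Ψ :=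
      traceNorm_mul_conjTranspose_sub_le _ _ (e1 ▸ hsSq_truncate_le _ _ _) hs
    have b2 : traceNorm (Ψ' * Ψ'ᴴ - ∑ i, G i * (G i)ᴴ) ≤
        sE.card * hsSq (Ψ' * Ψ'ᴴ - ∑ i, G i * (G i)ᴴ) / u + u := by
      have hsupp : ∀ k, k ∉ sE → ∀ l, (Ψ' * Ψ'ᴴ - ∑ i, G i * (G i)ᴴ) k l = 0 := by
        intro k hk l
        rw [Matrix.sub_apply, Matrix.sum_apply, e1]
        simp [Matrix.mul_apply, hG, truncate, hk]
      refine (traceNorm_le_of_support sE _ hsupp).trans ?_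
      have n1 := Real.sq_sqrt (hsSq_nonneg (Ψ' * Ψ'ᴴ - ∑ i, G i * (G i)ᴴ))
      have n2 := Real.sq_sqrt (Nat.cast_nonneg (α := ℝ) sE.card)
      set a := √(sE.card : ℝ)
      set b := √(hsSq (Ψ' * Ψ'ᴴ - ∑ i, G i * (G i)ᴴ))
      rw [← n1, ← n2]
      have p1 : 0 ≤ (a * b - u) ^ 2 / u := by positivity
      have p2 : (a * b - u) ^ 2 / u = a ^ 2 * b ^ 2 / u + u - 2 * (a * b) := by
        field_simp
        ring
      have p3 : 0 ≤ a * b := by positivity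
      linarith
    have b3 : traceNorm (∑ i, G i * (G i)ᴴ - ∑ i, W i * (W i)ᴴ) ≤ ε / s + s := by
      -- Placing the matrices side by side writes each mean as a single product `X Xᴴ`, so the
      -- truncation estimate used for `Ψ` applies again.
      rw [traceNorm_sub_comm, ← blockRow_mul_conjTranspose, ← blockRow_mul_conjTranspose]
      refine (traceNorm_mul_conjTranspose_sub_le _ _ ?_ hs).trans ?_
      · rw [hsSq_blockRow, hsSq_blockRow]
        exact Finset.sum_le_sum fun i _ => hsSq_truncate_le _ _ _
      · have e3 : blockRow W - blockRow G = blockRow fun i => W i - G i := rfl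
        rw [e3, hsSq_blockRow, hsSq_blockRow, hW1, mul_one]
        gcongr
    have t1 := traceNorm_sub_le (Ψ * Ψᴴ) (Ψ' * Ψ'ᴴ) (∑ i, W i * (W i)ᴴ)
    have t2 := traceNorm_sub_le (Ψ' * Ψ'ᴴ) (∑ i, G i * (G i)ᴴ) (∑ i, W i * (W i)ᴴ)
    rw [e2] at b1
    linarith
  · rw [integral_add ((i1.fun_add i2).fun_add i3) i4, integral_add (i1.fun_add i2) i3,
      integral_add i1 i2, integral_div, integral_div, integral_const_mul, integral_const_mul,
      q1.2, q2.2, hW1, integral_const]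
    have r1 : (∑ i, hsSq (W i - G i)) / s ≤ ε / s := by gcongr
    have r2 : sE.card * (∫ ω, hsSq ((∑ i, c i ω • G i) * (∑ i, c i ω • G i)ᴴ -
        ∑ i, G i * (G i)ᴴ) ∂μ) / u ≤ sE.card * m / u := by
      have := q3.2.trans hGsum
      gcongr
    simp only [probReal_univ, smul_eq_mul, one_mul]
    linarith

end Decoupling

/-! ### Privacy from closeness to a fixed state -/

section Privacy

variable {a b κ : Type*} [Fintype a] [Fintype b]

/-- The matrix with rows `A k v`, so that `Ψ Ψᴴ` is Eve's output on `|v⟩⟨v|`. -/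
def outputAmplitude (A : κ → Matrix b a ℂ) (v : EuclideanSpace ℂ a) : Matrix κ b ℂ :=
  Matrix.of fun k y => (A k *ᵥ v.ofLp) y

lemma eveOutput_ketbra (A : κ → Matrix b a ℂ) (v : EuclideanSpace ℂ a) :
    eveOutput A (ketbra v) = outputAmplitude A v * (outputAmplitude A v)ᴴ := by
  ext k l
  have e : ketbra v = vecMulVec v.ofLp (star v.ofLp) := rfl
  have e2 : A k * ketbra v * (A l)ᴴ = vecMulVec (A k *ᵥ v.ofLp) (star (A l *ᵥ v.ofLp)) := by
    rw [e, mul_vecMulVec, vecMulVec_mul, star_mulVec]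
  simp only [eveOutput, Matrix.of_apply]
  rw [e2, trace_vecMulVec, Matrix.mul_apply]
  rfl

lemma posSemidef_eveOutput_ketbra [Fintype κ] (A : κ → Matrix b a ℂ) (v : EuclideanSpace ℂ a) :
    (eveOutput A (ketbra v)).PosSemidef := by
  rw [eveOutput_ketbra]
  exact posSemidef_self_mul_conjTranspose _

lemma hsSq_outputAmplitude [Fintype κ] [DecidableEq a] {A : κ → Matrix b a ℂ} (hA : IsKraus A)
    (v : EuclideanSpace ℂ a) : hsSq (outputAmplitude A v) = ‖v‖ ^ 2 := by
  have h1 : ∀ k, ((∑ y, ‖outputAmplitude A v k y‖ ^ 2 : ℝ) : ℂ) =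
      star v.ofLp ⬝ᵥ (((A k)ᴴ * A k) *ᵥ v.ofLp) := fun k => by
    have := dotProduct_star_self_eq (A k *ᵥ v.ofLp)
    rw [← mulVec_mulVec, dotProduct_mulVec, ← star_mulVec, this]
    rfl
  have h2 : (hsSq (outputAmplitude A v) : ℂ) = ((‖v‖ ^ 2 : ℝ) : ℂ) := by
    rw [hsSq, Complex.ofReal_sum, Finset.sum_congr rfl fun k _ => h1 k, ← dotProduct_sum,
      ← Matrix.sum_mulVec, hA, one_mulVec, dotProduct_star_self_eq, EuclideanSpace.norm_sq_eq]
  exact_mod_cast h2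

variable {N : ℕ}

lemma sigmaE_eq (A : κ → Matrix b a ℂ) (C : Fin N → EuclideanSpace ℂ a) :
    sigmaE A C = (∑ β, ‖C β‖ ^ 2)⁻¹ • ∑ α, eveOutput A (ketbra (C α)) := by
  ext k l
  have hr : ((√(∑ β, ‖C β‖ ^ 2))⁻¹ : ℝ) * ((√(∑ β, ‖C β‖ ^ 2))⁻¹ : ℝ) =
      (∑ β, ‖C β‖ ^ 2)⁻¹ := by
    rw [← mul_inv, Real.mul_self_sqrt (by positivity)]
  simp only [sigmaE, psiABE, Matrix.of_apply, Matrix.smul_apply, Matrix.sum_apply,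
    eveOutput_ketbra, Matrix.mul_apply, outputAmplitude, conjTranspose_apply, Finset.smul_sum]
  refine Finset.sum_congr rfl fun α _ => Finset.sum_congr rfl fun y _ => ?_
  rw [← hr, map_mul, Complex.conj_ofReal, Complex.real_smul, Complex.ofReal_mul]
  simp only [RCLike.star_def]
  ring

lemma sigmaEα_eq [Fintype κ] [DecidableEq a] {A : κ → Matrix b a ℂ} (hA : IsKraus A)
    (C : Fin N → EuclideanSpace ℂ a) (α : Fin N) :
    sigmaEα A C α = (‖C α‖ ^ 2)⁻¹ • eveOutput A (ketbra (C α)) := by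
  set r : ℝ := (√(∑ β, ‖C β‖ ^ 2))⁻¹ with hr
  have e1 : ∑ y, ∑ k, ‖psiABE A C α y k‖ ^ 2 = r ^ 2 * ‖C α‖ ^ 2 := by
    rw [← hsSq_outputAmplitude hA, hsSq, Finset.mul_sum, Finset.sum_comm]
    refine Finset.sum_congr rfl fun k _ => ?_
    rw [Finset.mul_sum]
    refine Finset.sum_congr rfl fun y _ => ?_
    rw [psiABE, norm_mul, mul_pow, Complex.norm_real, Real.norm_eq_abs, sq_abs]
    rfl
  have e2 : (Matrix.of fun k l => ∑ y, psiABE A C α y k * conj (psiABE A C α y l)) =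
      (r ^ 2) • eveOutput A (ketbra (C α)) := by
    ext k l
    simp only [psiABE, Matrix.of_apply, Matrix.smul_apply, eveOutput_ketbra, Matrix.mul_apply,
      outputAmplitude, conjTranspose_apply, Finset.smul_sum]
    refine Finset.sum_congr rfl fun y _ => ?_
    rw [map_mul, Complex.conj_ofReal, Complex.real_smul]
    simp only [RCLike.star_def, ← hr]
    push_cast
    ring
  rw [sigmaEα, e1, e2, smul_smul]
  -- The normalization of `ψ_ABE` is zero only when all codewords vanish; both sides are then zero,
  -- since `0⁻¹ = 0`.
  by_cases h0 : r = 0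
  · have hS : ∑ β, ‖C β‖ ^ 2 = 0 := by
      rw [hr, inv_eq_zero, Real.sqrt_eq_zero (by positivity)] at h0
      exact h0
    have hα : ‖C α‖ ^ 2 = 0 :=
      (Finset.sum_eq_zero_iff_of_nonneg fun β _ => by positivity).1 hS α (Finset.mem_univ _)
    simp [hα]
  · congr 1
    have : r ^ 2 ≠ 0 := pow_ne_zero 2 h0
    rw [mul_inv, mul_comm, ← mul_assoc, mul_inv_cancel₀ this, one_mul]

variable [Fintype κ] [DecidableEq κ]

lemma traceNorm_average_sub_le (hN : 0 < N) (σ : Fin N → Matrix κ κ ℂ) (θ : Matrix κ κ ℂ) :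
    traceNorm (average σ - θ) ≤ avgDist σ θ := by
  have hN' : (0 : ℝ) < N := by exact_mod_cast hN
  have e : average σ - θ = (N : ℝ)⁻¹ • ∑ α, (σ α - θ) := by
    rw [Finset.sum_sub_distrib, smul_sub, average, Finset.sum_const, Finset.card_univ,
      Fintype.card_fin, ← Nat.cast_smul_eq_nsmul ℝ, smul_smul, inv_mul_cancel₀ hN'.ne', one_smul]
  rw [e]
  refine (traceNorm_smul_le _ _).trans ?_
  rw [abs_of_pos (inv_pos.2 hN'), avgDist]
  gcongr
  exact traceNorm_sum_le _ _

lemma avgDist_triangle (hN : 0 < N) (σ : Fin N → Matrix κ κ ℂ) (θ η : Matrix κ κ ℂ) :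
    avgDist σ η ≤ avgDist σ θ + traceNorm (θ - η) := by
  have hN' : (0 : ℝ) < N := by exact_mod_cast hN
  have h : ∑ α, traceNorm (σ α - η) ≤ ∑ α, traceNorm (σ α - θ) + N * traceNorm (θ - η) := by
    calc _ ≤ ∑ α, (traceNorm (σ α - θ) + traceNorm (θ - η)) :=
          Finset.sum_le_sum fun α _ => traceNorm_sub_le _ _ _
      _ = _ := by rw [Finset.sum_add_distrib]; simp
  rw [avgDist, avgDist]
  calc _ ≤ (N : ℝ)⁻¹ * (∑ α, traceNorm (σ α - θ) + N * traceNorm (θ - η)) := by gcongr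
    _ = _ := by field_simp

lemma avgDist_average_le (hN : 0 < N) (σ : Fin N → Matrix κ κ ℂ) (θ : Matrix κ κ ℂ) :
    avgDist σ (average σ) ≤ 2 * avgDist σ θ := by
  have h1 := avgDist_triangle hN σ θ (average σ)
  have h2 := traceNorm_average_sub_le hN σ θ
  rw [traceNorm_sub_comm] at h2
  linarith

/-- The Holevo quantity is the mean of `S(average) - S(σ α)`, so a one-sided continuity bound is
enough. Traces below one are admitted because a zero codeword yields the zero matrix. -/
lemma holevo_le (hN : 0 < N) (σ : Fin N → Matrix κ κ ℂ) (hσ : ∀ α, (σ α).PosSemidef)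
    (hσ1 : ∀ α, (σ α).trace.re ≤ 1) {L : ℝ} (hL : 0 ≤ L) :
    holevo σ ≤ (avgDist σ (average σ) * (L + 1) + Fintype.card κ * Real.exp (-L)) /
      Real.log 2 := by
  have hN' : (0 : ℝ) < N := by exact_mod_cast hN
  have havg : (average σ).PosSemidef := by
    rw [average]
    exact (posSemidef_sum _ fun α _ => hσ α).smul (inv_nonneg.2 hN'.le)
  have h : ∑ α, (entropy (average σ) - entropy (σ α)) ≤
      ∑ α, (traceNorm (σ α - average σ) * (L + 1) + Fintype.card κ * Real.exp (-L)) /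
        Real.log 2 := by
    refine Finset.sum_le_sum fun α _ => ?_
    rw [traceNorm_sub_comm]
    exact entropy_sub_le havg (hσ α) (hσ1 α) hL
  rw [Finset.sum_sub_distrib, Finset.sum_const, Finset.card_univ, Fintype.card_fin, nsmul_eq_mul,
    ← Finset.sum_div, Finset.sum_add_distrib, ← Finset.sum_mul, Finset.sum_const,
    Finset.card_univ, Fintype.card_fin, nsmul_eq_mul] at h
  have h2 := mul_le_mul_of_nonneg_left h (inv_nonneg.2 hN'.le)
  have e1 : (N : ℝ)⁻¹ * (N * entropy (average σ) - ∑ α, entropy (σ α)) = holevo σ := by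
    rw [holevo, mul_sub, ← mul_assoc, inv_mul_cancel₀ hN'.ne', one_mul]
  have e2 : (N : ℝ)⁻¹ * (((∑ α, traceNorm (σ α - average σ)) * (L + 1) +
      N * (Fintype.card κ * Real.exp (-L))) / Real.log 2) =
      (avgDist σ (average σ) * (L + 1) + Fintype.card κ * Real.exp (-L)) / Real.log 2 := by
    rw [avgDist]
    field_simp
  rwa [e1, e2] at h2

/-- If Eve's outputs are on average close to a fixed operator of trace one, the code is
private. -/
lemma isPrivate_of_avgDist_le [DecidableEq a] {A : κ → Matrix b a ℂ} (hA : IsKraus A)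
    (hN : 0 < N) (C : Fin N → EuclideanSpace ℂ a) {θ : Matrix κ κ ℂ} (hθ : θ.trace = 1)
    {s L ε : ℝ} (hs : avgDist (fun α => eveOutput A (ketbra (C α))) θ ≤ s) (hL : 0 ≤ L)
    (h1 : 4 * s ≤ ε)
    (h2 : (4 * s * (L + 1) + Fintype.card κ * Real.exp (-L)) / Real.log 2 ≤ ε) :
    IsPrivate A C ε := by
  have hN' : (0 : ℝ) < N := by exact_mod_cast hN
  set w : Fin N → Matrix κ κ ℂ := fun α => eveOutput A (ketbra (C α)) with hw
  have htr : ∀ α, (w α).trace = ((‖C α‖ ^ 2 : ℝ) : ℂ) := fun α => by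
    simp only [hw]
    rw [eveOutput_ketbra, trace_mul_conjTranspose_self, hsSq_outputAmplitude hA]
  have htn : ∀ α, traceNorm (w α) = ‖C α‖ ^ 2 := fun α => by
    simp only [hw]
    rw [eveOutput_ketbra, traceNorm_mul_conjTranspose_self, hsSq_outputAmplitude hA]
  have hw0 : ∀ α, ‖C α‖ = 0 → w α = 0 := fun α h => by
    have h3 : C α = 0 := norm_eq_zero.1 h
    simp only [hw]
    rw [eveOutput_ketbra, h3]
    have : outputAmplitude A (0 : EuclideanSpace ℂ a) = 0 := by
      ext k y
      simp [outputAmplitude]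
    rw [this, Matrix.zero_mul]
  have hone : ∀ X : Matrix κ κ ℂ, ∀ x : ℝ, X.trace = (x : ℂ) → |x - 1| ≤ traceNorm (X - θ) := by
    intro X x hX
    have := norm_trace_le_traceNorm (X - θ)
    rw [trace_sub, hθ, hX, ← Complex.ofReal_one, ← Complex.ofReal_sub, Complex.norm_real] at this
    exact this
  -- Normalizing `X` moves it by at most `|x - 1|`, and `|x - 1| = |Tr(X - θ)| ≤ ‖X - θ‖`; hence the
  -- factor 2. For `x = 0` the normalized operator is 0.
  have hdev : ∀ (X : Matrix κ κ ℂ) (x : ℝ), 0 ≤ x → X.trace = (x : ℂ) → traceNorm X ≤ x →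
      (x = 0 → X = 0) → traceNorm (x⁻¹ • X - θ) ≤ 2 * traceNorm (X - θ) := by
    intro X x hx0 hX hXn hX0
    rcases hx0.eq_or_lt with h | h
    · rw [hX0 h.symm, smul_zero]
      linarith [traceNorm_nonneg (0 - θ)]
    · have e : x⁻¹ • X - X = (x⁻¹ - 1) • X := by rw [sub_smul, one_smul]
      have h3 : traceNorm (x⁻¹ • X - X) ≤ |x - 1| := by
        rw [e]
        refine (traceNorm_smul_le _ _).trans ?_
        calc |x⁻¹ - 1| * traceNorm X ≤ |x⁻¹ - 1| * x := by gcongr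
          _ = |x⁻¹ - 1| * |x| := by rw [abs_of_pos h]
          _ = |x - 1| := by rw [← abs_mul, sub_mul, inv_mul_cancel₀ h.ne', one_mul, abs_sub_comm]
      have h4 := traceNorm_sub_le (x⁻¹ • X) X θ
      have h5 := hone X x hX
      linarith
  have hσ : ∀ α, sigmaEα A C α = (‖C α‖ ^ 2)⁻¹ • w α := fun α => sigmaEα_eq hA C α
  have hσd : avgDist (sigmaEα A C) θ ≤ 2 * s := by
    calc avgDist (sigmaEα A C) θ ≤ (N : ℝ)⁻¹ * ∑ α, 2 * traceNorm (w α - θ) := by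
          rw [avgDist]
          gcongr with α
          rw [hσ]
          exact hdev _ _ (by positivity) (htr α) (htn α).le fun h => hw0 α (by simpa using h)
      _ = 2 * avgDist w θ := by
          rw [avgDist, ← Finset.mul_sum]
          ring
      _ ≤ _ := by linarith
  have hE : traceNorm (sigmaE A C - θ) ≤ 2 * s := by
    set x : ℝ := (N : ℝ)⁻¹ * ∑ α, ‖C α‖ ^ 2 with hx
    have e : sigmaE A C = x⁻¹ • average w := by
      rw [sigmaE_eq, average, smul_smul, hx, mul_inv, inv_inv, mul_comm (N : ℝ), mul_assoc,
        mul_inv_cancel₀ hN'.ne', mul_one]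
    have hav := traceNorm_average_sub_le hN w θ
    rw [e]
    refine (hdev (average w) x (by positivity) ?_ ?_ ?_).trans (by linarith)
    · rw [average, trace_smul, trace_sum, Finset.sum_congr rfl fun α _ => htr α, Complex.real_smul,
        hx, ← Complex.ofReal_sum, ← Complex.ofReal_mul]
    · rw [average, hx]
      refine (traceNorm_smul_le _ _).trans ?_
      rw [abs_of_pos (inv_pos.2 hN')]
      gcongr
      refine (traceNorm_sum_le _ _).trans (le_of_eq ?_)
      exact Finset.sum_congr rfl fun α _ => htn α
    · intro h0
      have hS : ∑ α, ‖C α‖ ^ 2 = 0 := by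
        rw [hx] at h0
        exact (mul_eq_zero.1 h0).resolve_left (inv_pos.2 hN').ne'
      have : ∀ α, w α = 0 := fun α => hw0 α (by
        simpa using (Finset.sum_eq_zero_iff_of_nonneg fun β _ => by positivity).1 hS α
          (Finset.mem_univ _))
      simp [average, this]
  have hd2 : avgDist (sigmaEα A C) (average (sigmaEα A C)) ≤ 4 * s := by
    have := avgDist_average_le hN (sigmaEα A C) θ
    linarith
  have hs0 : 0 ≤ s := by
    refine le_trans ?_ hs
    rw [avgDist]
    exact mul_nonneg (inv_nonneg.2 hN'.le) (Finset.sum_nonneg fun α _ => traceNorm_nonneg _)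
  refine ⟨?_, hd2.trans h1, ?_, ?_⟩
  · have := avgDist_average_le hN w θ
    linarith
  · have := avgDist_triangle hN (sigmaEα A C) θ (sigmaE A C)
    rw [traceNorm_sub_comm θ] at this
    linarith
  · refine (holevo_le hN (sigmaEα A C) (fun α => ?_) (fun α => ?_) hL).trans (le_trans ?_ h2)
    · rw [hσ]
      exact (posSemidef_eveOutput_ketbra A (C α)).smul (by positivity)
    · rw [hσ, trace_smul, htr, Complex.real_smul, ← Complex.ofReal_mul, Complex.ofReal_re]
      exact inv_mul_le_one
    · gcongr

end Privacy

/-! ### Tensor powers -/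

section Tensor

variable {a b d κ : Type*} {n : ℕ}

lemma sum_prod_eq_prod_sum {R ι : Type*} [CommSemiring R] [Fintype ι] (f : Fin n → ι → R) :
    ∑ x : Fin n → ι, ∏ t, f t (x t) = ∏ t, ∑ i, f t i := by
  have := Finset.prod_univ_sum (fun _ : Fin n => (Finset.univ : Finset ι)) f
  rw [Fintype.piFinset_univ] at this
  exact this.symm

lemma tensorProd_mul [Fintype b] (M : Fin n → Matrix d b ℂ) (M' : Fin n → Matrix b a ℂ) :
    tensorProd M * tensorProd M' = tensorProd fun t => M t * M' t := by
  ext y x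
  simp only [tensorProd, Matrix.mul_apply, Matrix.of_apply, ← Finset.prod_mul_distrib]
  exact sum_prod_eq_prod_sum fun t z => M t (y t) z * M' t z (x t)

lemma tensorProd_conjTranspose (M : Fin n → Matrix b a ℂ) :
    (tensorProd M)ᴴ = tensorProd fun t => (M t)ᴴ := by
  ext y x
  simp [tensorProd, Matrix.conjTranspose_apply]

lemma tensorProd_diagonal [DecidableEq a] (f : a → ℂ) :
    (tensorProd fun _ : Fin n => diagonal f) = diagonal fun x => ∏ t, f (x t) := by
  ext y x
  simp only [tensorProd, Matrix.of_apply]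
  by_cases h : y = x
  · subst h
    simp
  · rw [diagonal_apply_ne _ h]
    obtain ⟨t, ht⟩ := Function.ne_iff.1 h
    exact Finset.prod_eq_zero (Finset.mem_univ t) (diagonal_apply_ne _ ht)

lemma tensorProd_one [DecidableEq a] : (tensorProd fun _ : Fin n => (1 : Matrix a a ℂ)) = 1 := by
  rw [← diagonal_one, tensorProd_diagonal]
  simp

lemma tensorProd_isometry [Fintype b] [DecidableEq a] {U : Matrix b a ℂ} (hU : Uᴴ * U = 1) :
    (tensorProd fun _ : Fin n => U)ᴴ * (tensorProd fun _ : Fin n => U) = 1 := by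
  rw [tensorProd_conjTranspose, tensorProd_mul, hU, tensorProd_one]

lemma isKraus_krausPow [DecidableEq a] [Fintype b] [Fintype κ] {A : κ → Matrix b a ℂ} (hA : IsKraus A)
    (n : ℕ) : IsKraus (krausPow A n) := by
  rw [IsKraus, ← tensorProd_one]
  have h : ∀ k : Fin n → κ, (krausPow A n k)ᴴ * krausPow A n k =
      tensorProd fun t => (A (k t))ᴴ * A (k t) := fun k => by
    rw [krausPow, tensorProd_conjTranspose, tensorProd_mul]
  simp only [h]
  ext y x
  simp only [Matrix.sum_apply, tensorProd, Matrix.of_apply]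
  rw [sum_prod_eq_prod_sum fun t k => ((A k)ᴴ * A k) (y t) (x t)]
  refine Finset.prod_congr rfl fun t _ => ?_
  rw [← hA, Matrix.sum_apply]

lemma krausPow_mul_mul [Fintype a] (A : κ → Matrix b a ℂ) (ρ : Matrix a a ℂ) (k : Fin n → κ) :
    krausPow A n k * (tensorProd fun _ : Fin n => ρ) * (krausPow A n k)ᴴ =
      tensorProd fun t => A (k t) * ρ * (A (k t))ᴴ := by
  rw [krausPow, tensorProd_conjTranspose, tensorProd_mul, tensorProd_mul]

lemma bobOutput_krausPow [Fintype a] [Fintype κ] (A : κ → Matrix b a ℂ) (ρ : Matrix a a ℂ) :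
    bobOutput (krausPow A n) (tensorProd fun _ : Fin n => ρ) =
      tensorProd fun _ : Fin n => bobOutput A ρ := by
  ext y x
  simp only [bobOutput, krausPow_mul_mul, Matrix.sum_apply]
  simp only [tensorProd, Matrix.of_apply, Matrix.sum_apply]
  exact sum_prod_eq_prod_sum fun t k => (A k * ρ * (A k)ᴴ) (y t) (x t)

end Tensor

/-! ### Change of the output bases -/

section Rotation

variable {a b κ : Type*}

/-- Kraus operators in other orthonormal bases (the columns of `UB` and `UE`) of the output
systems. -/
def rotateKraus [Fintype b] [Fintype κ] (UB : Matrix b b ℂ) (UE : Matrix κ κ ℂ) (A : κ → Matrix b a ℂ) (k : κ) :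
    Matrix b a ℂ :=
  ∑ l, conj (UE l k) • (UBᴴ * A l)

lemma krausPow_rotateKraus [Fintype b] [Fintype κ] (UB : Matrix b b ℂ) (UE : Matrix κ κ ℂ)
    (A : κ → Matrix b a ℂ) (n : ℕ) : krausPow (rotateKraus UB UE A) n =
      rotateKraus (tensorProd fun _ => UB) (tensorProd fun _ => UE) (krausPow A n) := by
  funext k
  rw [rotateKraus]
  simp only [krausPow, tensorProd_conjTranspose, tensorProd_mul]
  ext y x
  simp only [rotateKraus, tensorProd, Matrix.of_apply, Matrix.sum_apply, Matrix.smul_apply,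
    smul_eq_mul, map_prod, ← Finset.prod_mul_distrib]
  exact (sum_prod_eq_prod_sum fun t l => conj (UE l (k t)) * (UBᴴ * A l) (y t) (x t)).symm

lemma eveOutput_rotateKraus [Fintype a] [Fintype b] [DecidableEq b] [Fintype κ]
    {UB : Matrix b b ℂ} (hUB : UB * UBᴴ = 1)
    (UE : Matrix κ κ ℂ) (A : κ → Matrix b a ℂ) (X : Matrix a a ℂ) :
    eveOutput (rotateKraus UB UE A) X = UEᴴ * eveOutput A X * UE := by
  ext k l
  have h : ∀ k' l', (UBᴴ * A k' * X * (UBᴴ * A l')ᴴ).trace = (A k' * X * (A l')ᴴ).trace := by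
    intro k' l'
    rw [conjTranspose_mul, conjTranspose_conjTranspose]
    rw [← Matrix.mul_assoc, trace_mul_comm]
    simp only [← Matrix.mul_assoc]
    rw [hUB, Matrix.one_mul]
  simp only [eveOutput, rotateKraus, Matrix.of_apply, conjTranspose_sum, conjTranspose_smul,
    Matrix.sum_mul, Matrix.mul_sum, Matrix.smul_mul, Matrix.mul_smul, trace_sum, trace_smul, h,
    Matrix.mul_apply, conjTranspose_apply, smul_eq_mul, RCLike.star_def, Complex.conj_conj]
  refine Finset.sum_congr rfl fun l' _ => ?_
  rw [Finset.sum_mul, Finset.mul_sum]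
  refine Finset.sum_congr rfl fun k' _ => ?_
  ring

/-- The unitary freedom of Kraus representations: sesquilinear sums over Kraus operators do not
change when these are mixed by a unitary. It gives both Bob's output and trace preservation below.
-/
lemma sum_rotate [Fintype κ] [DecidableEq κ] {UE : Matrix κ κ ℂ} (hUE : UE * UEᴴ = 1) {R : Type*}
    [AddCommGroup R] [Module ℂ R] (f : κ → κ → R) :
    ∑ k, ∑ l, ∑ l', (conj (UE l k) * UE l' k : ℂ) • f l l' = ∑ l, f l l := by
  have h : ∀ l l', ∑ k, conj (UE l k) * UE l' k = if l' = l then 1 else 0 := fun l l' => by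
    have := congrFun (congrFun hUE l') l
    rw [Matrix.mul_apply, Matrix.one_apply] at this
    rw [← this]
    refine Finset.sum_congr rfl fun k _ => ?_
    rw [conjTranspose_apply, RCLike.star_def, mul_comm]
  rw [Finset.sum_comm]
  refine Finset.sum_congr rfl fun l _ => ?_
  rw [Finset.sum_comm]
  simp only [← Finset.sum_smul, h, ite_smul, one_smul, zero_smul]
  simp

lemma bobOutput_rotateKraus [Fintype a] [Fintype b] [Fintype κ] [DecidableEq κ]
    (UB : Matrix b b ℂ) {UE : Matrix κ κ ℂ}
    (hUE : UE * UEᴴ = 1) (A : κ → Matrix b a ℂ) (X : Matrix a a ℂ) :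
    bobOutput (rotateKraus UB UE A) X = UBᴴ * bobOutput A X * UB := by
  have h := sum_rotate hUE fun l l' => UBᴴ * A l * X * (UBᴴ * A l')ᴴ
  have e : UBᴴ * bobOutput A X * UB = ∑ l, UBᴴ * A l * X * (UBᴴ * A l)ᴴ := by
    simp only [bobOutput, Matrix.mul_sum, Matrix.sum_mul, conjTranspose_mul,
      conjTranspose_conjTranspose, Matrix.mul_assoc]
  rw [e, ← h, bobOutput]
  refine Finset.sum_congr rfl fun k _ => ?_
  simp only [rotateKraus, conjTranspose_sum, conjTranspose_smul, Matrix.sum_mul, Matrix.smul_mul,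
    RCLike.star_def, Complex.conj_conj]
  refine Finset.sum_congr rfl fun l _ => ?_
  rw [Matrix.mul_sum, Finset.smul_sum]
  refine Finset.sum_congr rfl fun l' _ => ?_
  rw [Matrix.mul_smul, smul_smul]

lemma isKraus_rotateKraus [DecidableEq a] [Fintype b] [DecidableEq b] [Fintype κ]
    [DecidableEq κ] {UB : Matrix b b ℂ}
    (hUB : UB * UBᴴ = 1) {UE : Matrix κ κ ℂ} (hUE : UE * UEᴴ = 1) {A : κ → Matrix b a ℂ}
    (hA : IsKraus A) : IsKraus (rotateKraus UB UE A) := by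
  have h := sum_rotate hUE fun l l' => (UBᴴ * A l')ᴴ * (UBᴴ * A l)
  have e : ∑ l, (UBᴴ * A l)ᴴ * (UBᴴ * A l) = 1 := by
    rw [← hA]
    refine Finset.sum_congr rfl fun l _ => ?_
    rw [conjTranspose_mul, conjTranspose_conjTranspose, Matrix.mul_assoc,
      ← Matrix.mul_assoc UB, hUB, Matrix.one_mul]
  rw [IsKraus, ← e, ← h]
  refine Finset.sum_congr rfl fun k _ => ?_
  simp only [rotateKraus, conjTranspose_sum, conjTranspose_smul, Matrix.mul_sum,
    RCLike.star_def, Complex.conj_conj]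
  refine Finset.sum_congr rfl fun l _ => ?_
  rw [Matrix.sum_mul]
  refine Finset.sum_congr rfl fun l' _ => ?_
  rw [Matrix.smul_mul, Matrix.mul_smul, smul_smul, mul_comm]

lemma isHermitian_eveOutput [Fintype a] [Fintype b] (A : κ → Matrix b a ℂ)
    {ρ : Matrix a a ℂ} (hρ : ρ.IsHermitian) :
    (eveOutput A ρ).IsHermitian := by
  ext k l
  simp only [conjTranspose_apply, eveOutput, Matrix.of_apply]
  rw [← trace_conjTranspose]
  simp only [conjTranspose_mul, conjTranspose_conjTranspose, hρ.eq, Matrix.mul_assoc]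

lemma isHermitian_bobOutput [Fintype a] [Fintype κ] (A : κ → Matrix b a ℂ)
    {ρ : Matrix a a ℂ} (hρ : ρ.IsHermitian) :
    (bobOutput A ρ).IsHermitian := by
  rw [IsHermitian, bobOutput, conjTranspose_sum]
  simp only [conjTranspose_mul, conjTranspose_conjTranspose, hρ.eq, Matrix.mul_assoc]

/-- In suitable output bases, both outputs of a channel are diagonal. -/
lemma exists_diagonalizing_rotation [Fintype a] [DecidableEq a] [Fintype b] [DecidableEq b]
    [Fintype κ] [DecidableEq κ]
    {A : κ → Matrix b a ℂ} (hA : IsKraus A) {ρ : Matrix a a ℂ} (hρ : ρ.IsHermitian) :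
    ∃ (A' : κ → Matrix b a ℂ) (UE : Matrix κ κ ℂ) (lB : b → ℝ) (lE : κ → ℝ),
      IsKraus A' ∧ UEᴴ * UE = 1 ∧
      bobOutput A' ρ = diagonal (fun y => (lB y : ℂ)) ∧
      eveOutput A' ρ = diagonal (fun k => (lE k : ℂ)) ∧
      entropy (bobOutput A ρ) = ∑ y, Real.negMulLog (lB y) / Real.log 2 ∧
      entropy (eveOutput A ρ) = ∑ k, Real.negMulLog (lE k) / Real.log 2 ∧
      ∀ (n : ℕ) (X : Matrix (Fin n → a) (Fin n → a) ℂ), eveOutput (krausPow A n) X =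
        (tensorProd fun _ => UE) * eveOutput (krausPow A' n) X * (tensorProd fun _ => UE)ᴴ := by
  have hB := isHermitian_bobOutput A hρ
  have hE := isHermitian_eveOutput A hρ
  obtain ⟨UB, hUB1, hUB2, hUB⟩ := exists_unitary_diagonal hB
  obtain ⟨UE, hUE1, hUE2, hUE⟩ := exists_unitary_diagonal hE
  refine ⟨rotateKraus UB UE A, UE, hB.eigenvalues, hE.eigenvalues,
    isKraus_rotateKraus hUB2 hUE2 hA, hUE1, ?_, ?_, ?_, ?_, fun n X => ?_⟩
  · rw [bobOutput_rotateKraus UB hUE2]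
    nth_rw 1 [hUB]
    simp only [← Matrix.mul_assoc]
    rw [hUB1, Matrix.one_mul, Matrix.mul_assoc, hUB1, Matrix.mul_one]
  · rw [eveOutput_rotateKraus hUB2]
    nth_rw 1 [hUE]
    simp only [← Matrix.mul_assoc]
    rw [hUE1, Matrix.one_mul, Matrix.mul_assoc, hUE1, Matrix.mul_one]
  · rw [entropy, dif_pos hB]
  · rw [entropy, dif_pos hE]
  · have h1 : (tensorProd fun _ : Fin n => UB) * (tensorProd fun _ : Fin n => UB)ᴴ = 1 :=
      mul_eq_one_comm.1 (tensorProd_isometry hUB1)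
    have h2 : (tensorProd fun _ : Fin n => UE) * (tensorProd fun _ : Fin n => UE)ᴴ = 1 :=
      mul_eq_one_comm.1 (tensorProd_isometry hUE1)
    rw [krausPow_rotateKraus, eveOutput_rotateKraus h1]
    simp only [← Matrix.mul_assoc]
    rw [h2, Matrix.one_mul, Matrix.mul_assoc, h2, Matrix.mul_one]

end Rotation

/-! ### Eigenbases of the source -/

section Eigenbasis

variable {ι : Type*} [Fintype ι]

/-- Spectral expansion of a matrix in an orthonormal eigenbasis. -/
lemma dotProduct_mulVec_eq_sum_eigenbasis {M : Matrix ι ι ℂ}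
    (e : OrthonormalBasis ι ℂ (EuclideanSpace ℂ ι)) {p : ι → ℝ}
    (he : ∀ i, M *ᵥ (e i).ofLp = (p i : ℂ) • (e i).ofLp) (u w : ι → ℂ) :
    u ⬝ᵥ (M *ᵥ w) = ∑ i, (p i : ℂ) * ((u ⬝ᵥ (e i).ofLp) * (star (e i).ofLp ⬝ᵥ w)) := by
  have h1 : w = ∑ i, (star (e i).ofLp ⬝ᵥ w) • (e i).ofLp := by
    have h2 := e.sum_repr' (WithLp.toLp 2 w)
    have h3 := congrArg WithLp.ofLp h2
    rw [WithLp.ofLp_sum] at h3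
    refine Eq.trans h3.symm (Finset.sum_congr rfl fun i _ => ?_)
    rw [WithLp.ofLp_smul]
    congr 1
    rw [EuclideanSpace.inner_eq_star_dotProduct, dotProduct_comm]
  conv_lhs => rw [h1]
  rw [Matrix.mulVec_sum, dotProduct_sum]
  refine Finset.sum_congr rfl fun i _ => ?_
  rw [mulVec_smul, he, dotProduct_smul, dotProduct_smul, smul_eq_mul, smul_eq_mul]
  ring

lemma sum_eigenbasis_norm_sq {M : Matrix ι ι ℂ}
    (e : OrthonormalBasis ι ℂ (EuclideanSpace ℂ ι)) {p : ι → ℝ}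
    (he : ∀ i, M *ᵥ (e i).ofLp = (p i : ℂ) • (e i).ofLp) (u : ι → ℂ) :
    ((∑ i, p i * ‖u ⬝ᵥ (e i).ofLp‖ ^ 2 : ℝ) : ℂ) = u ⬝ᵥ (M *ᵥ star u) := by
  rw [dotProduct_mulVec_eq_sum_eigenbasis e he]
  push_cast
  refine Finset.sum_congr rfl fun i _ => ?_
  rw [← Complex.mul_conj', ← RCLike.star_def, star_dotProduct_star]

/-- Two orthonormal eigenbases have the same eigenvalues with multiplicities. -/
lemma sum_eigenvalues_eq [DecidableEq ι] {M U : Matrix ι ι ℂ} (hU : Uᴴ * U = 1) {l : ι → ℝ}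
    (hM : M = U * diagonal (fun i => (l i : ℂ)) * Uᴴ)
    (e : OrthonormalBasis ι ℂ (EuclideanSpace ℂ ι)) {p : ι → ℝ}
    (he : ∀ i, M *ᵥ (e i).ofLp = (p i : ℂ) • (e i).ofLp) (f : ℝ → ℝ) :
    ∑ i, f (p i) = ∑ x, f (l x) := by
  have hU2 : U * Uᴴ = 1 := mul_eq_one_comm.1 hU
  set z : ι → ι → ℂ := fun i => Uᴴ *ᵥ (e i).ofLp with hz
  have h1 : ∀ i x, (p i : ℂ) * z i x = l x * z i x := fun i x => by
    have h2 := congrArg (Uᴴ *ᵥ ·) (he i)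
    simp only [hM, mulVec_smul, mulVec_mulVec] at h2
    simp only [← Matrix.mul_assoc] at h2
    rw [hU, Matrix.one_mul, ← mulVec_mulVec] at h2
    have h3 := congrFun h2 x
    rw [mulVec_diagonal, Pi.smul_apply, smul_eq_mul] at h3
    exact h3.symm
  -- Eigenvectors overlap only when their eigenvalues agree, and the squared overlaps are doubly
  -- stochastic, so summing both ways identifies the two sums.
  have h2 : ∀ i x, ‖z i x‖ ^ 2 * f (p i) = ‖z i x‖ ^ 2 * f (l x) := fun i x => by
    by_cases h0 : z i x = 0
    · simp [h0]
    · have : p i = l x := by exact_mod_cast mul_right_cancel₀ h0 (h1 i x)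
      rw [this]
  have hrow : ∀ i, ∑ x, ‖z i x‖ ^ 2 = 1 := fun i => by
    rw [hz, sum_norm_sq_mulVec_of_isometry (by rwa [conjTranspose_conjTranspose]),
      ← EuclideanSpace.norm_sq_eq, e.norm_eq_one, one_pow]
  have hcol : ∀ x, ∑ i, ‖z i x‖ ^ 2 = 1 := fun x => by
    have h3 := sum_eigenbasis_norm_sq (M := 1) e (p := fun _ => 1) (by simp) (Uᴴ x)
    rw [one_mulVec] at h3
    have h4 : (Uᴴ x) ⬝ᵥ star (Uᴴ x) = 1 := by
      have := congrFun (congrFun hU x) x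
      rw [Matrix.mul_apply, one_apply_eq] at this
      rw [← this]
      refine Finset.sum_congr rfl fun y _ => ?_
      simp [conjTranspose_apply]
    rw [h4] at h3
    simp only [one_mul] at h3
    exact_mod_cast h3
  calc ∑ i, f (p i) = ∑ i, ∑ x, ‖z i x‖ ^ 2 * f (p i) := by
        refine Finset.sum_congr rfl fun i _ => ?_
        rw [← Finset.sum_mul, hrow, one_mul]
    _ = ∑ x, ∑ i, ‖z i x‖ ^ 2 * f (l x) := by
        rw [Finset.sum_comm]
        exact Finset.sum_congr rfl fun x _ => Finset.sum_congr rfl fun i _ => h2 i x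
    _ = _ := by
        refine Finset.sum_congr rfl fun x _ => ?_
        rw [← Finset.sum_mul, hcol, one_mul]

end Eigenbasis

/-! ### The typical subspace of the source -/

section Typical

variable {a : Type*} [Fintype a] [DecidableEq a]

/-- Degeneracy allows eigenbases of `ρ^{⊗n}` that are not product bases. The eigenvalues with
multiplicity are still the products of those of `ρ`, so the mass outside the typical set is a sum of
two tails of an i.i.d. source. -/
lemma exists_typical_mass_rate {ρ : Matrix a a ℂ} (hρ : IsState ρ) {δ : ℝ} (hδ : 0 < δ) :
    ∃ r : ℝ, 0 < r ∧ r < 1 ∧ ∀ (n : ℕ)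
      (e : OrthonormalBasis (Fin n → a) ℂ (EuclideanSpace ℂ (Fin n → a))) (p : (Fin n → a) → ℝ),
      IsSourceEigenbasis ρ e p →
        (∀ i, 0 ≤ p i) ∧ 1 - 2 * r ^ n ≤ ∑ i ∈ typical (entropy ρ) δ p, p i := by
  classical
  have hH := hρ.1.isHermitian
  obtain ⟨U, hU1, hU2, hU⟩ := exists_unitary_diagonal hH
  have hl0 := hρ.1.eigenvalues_nonneg
  have hS : entropy ρ = ∑ i, Real.negMulLog (hH.eigenvalues i) / Real.log 2 := by
    rw [entropy, dif_pos hH]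
  have hl1 : ∑ i, hH.eigenvalues i = 1 := by
    have h1 := hH.trace_eq_sum_eigenvalues
    rw [hρ.2] at h1
    refine Complex.ofReal_injective ?_
    rw [Complex.ofReal_one, h1, Complex.ofReal_sum]
    rfl
  set l := hH.eigenvalues
  obtain ⟨r1, hr10, hr11, hr1⟩ := exists_upper_tail_rate hl0 hl1 hS hδ
  obtain ⟨r2, hr20, hr21, hr2⟩ := exists_lower_tail_rate hl0 hl1 hS hδ
  refine ⟨max r1 r2, lt_max_of_lt_left hr10, max_lt hr11 hr21, fun n e p he => ?_⟩
  have hM : (tensorProd fun _ : Fin n => ρ) = (tensorProd fun _ : Fin n => U) *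
      diagonal (fun x => ((∏ t, l (x t) : ℝ) : ℂ)) * (tensorProd fun _ : Fin n => U)ᴴ := by
    have h1 : (diagonal fun x : Fin n → a => ((∏ t, l (x t) : ℝ) : ℂ)) =
        tensorProd fun _ : Fin n => diagonal fun i => (l i : ℂ) := by
      rw [tensorProd_diagonal]
      simp
    rw [h1, tensorProd_conjTranspose, tensorProd_mul, tensorProd_mul, ← hU]
  have hsum := sum_eigenvalues_eq (tensorProd_isometry hU1) hM e he
  have hp0 : ∀ i, 0 ≤ p i := by
    -- Counting negative eigenvalues in both bases gives zero.
    have h0 := hsum fun t => if t < 0 then 1 else 0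
    have h2 : ∀ x : Fin n → a, ¬(∏ t, l (x t) < 0) := fun x =>
      not_lt.2 (Finset.prod_nonneg fun t _ => hl0 _)
    simp only [h2, if_false, Finset.sum_const_zero] at h0
    intro i
    have h3 := (Finset.sum_eq_zero_iff_of_nonneg fun i _ => by split_ifs <;> norm_num).1 h0 i
      (Finset.mem_univ _)
    by_contra hlt
    rw [if_pos (not_le.1 hlt)] at h3
    exact one_ne_zero h3
  refine ⟨hp0, ?_⟩
  set lo := (2 : ℝ) ^ (-(n : ℝ) * (entropy ρ + δ)) with hlo
  set hi := (2 : ℝ) ^ (-(n : ℝ) * (entropy ρ - δ)) with hhi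
  have hp1 : ∑ i, p i = 1 := by
    have := hsum id
    simp only [id] at this
    rw [this, sum_prod_eq_prod_sum fun _ i => l i]
    simp [hl1]
  have hlow : ∑ i, (if p i < lo then p i else 0) ≤ r2 ^ n := by
    rw [hsum fun t => if t < lo then t else 0, ← Finset.sum_filter]
    exact hr2 n _ fun x hx => (Finset.mem_filter.1 hx).2
  have hup : ∑ i, (if hi < p i then p i else 0) ≤ r1 ^ n := by
    rw [hsum fun t => if hi < t then t else 0, ← Finset.sum_filter]
    exact hr1 n _ fun x hx => (Finset.mem_filter.1 hx).2
  have hsplit : ∑ i, p i ≤ ∑ i ∈ typical (entropy ρ) δ p, p i +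
      ∑ i, (if p i < lo then p i else 0) + ∑ i, (if hi < p i then p i else 0) := by
    have h4 : ∑ i ∈ typical (entropy ρ) δ p, p i =
        ∑ i, if lo ≤ p i ∧ p i ≤ hi then p i else 0 := by
      rw [← Finset.sum_filter]
      refine Finset.sum_congr ?_ fun _ _ => rfl
      ext i
      simp [typical, hlo, hhi]
    rw [h4, ← Finset.sum_add_distrib, ← Finset.sum_add_distrib]
    refine Finset.sum_le_sum fun i _ => ?_
    have h5 := hp0 i
    by_cases c1 : lo ≤ p i
    · by_cases c2 : p i ≤ hi
      · rw [if_pos ⟨c1, c2⟩, if_neg (not_lt.2 c1), if_neg (not_lt.2 c2)]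
        linarith
      · rw [if_neg (by tauto), if_neg (not_lt.2 c1), if_pos (not_le.1 c2)]
        linarith
    · rw [if_neg (by tauto), if_pos (not_le.1 c1)]
      split_ifs <;> linarith
  have m1 : r1 ^ n ≤ max r1 r2 ^ n := by gcongr; exact le_max_left _ _
  have m2 : r2 ^ n ≤ max r1 r2 ^ n := by gcongr; exact le_max_right _ _
  linarith

end Typical

/-! ### Decoupling of Eve from a random codeword -/

section CodewordDecoupling

universe u

variable {a : Type u} {b κ : Type*} [Fintype a] [DecidableEq a] [Fintype b] [DecidableEq b]
  [Fintype κ] [DecidableEq κ]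

/-- A codeword with coefficients `c i` relative to `√ρ_typ`. -/
noncomputable def weightedCodeword {n : ℕ}
    (e : OrthonormalBasis (Fin n → a) ℂ (EuclideanSpace ℂ (Fin n → a)))
    (T : Finset (Fin n → a)) (p : (Fin n → a) → ℝ) (z : T → ℂ) : EuclideanSpace ℂ (Fin n → a) :=
  ∑ i : T, (((√(typWeight T p i) : ℝ) : ℂ) * z i) • e i

lemma outputAmplitude_sum_smul {a b κ τ : Type*} [Fintype a] [Fintype τ]
    (A : κ → Matrix b a ℂ) (z : τ → ℂ) (v : τ → EuclideanSpace ℂ a) :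
    outputAmplitude A (∑ i, z i • v i) = ∑ i, z i • outputAmplitude A (v i) := by
  ext k y
  simp only [outputAmplitude, Matrix.of_apply, Matrix.sum_apply, Matrix.smul_apply,
    WithLp.ofLp_sum, WithLp.ofLp_smul, Matrix.mulVec_sum, mulVec_smul, Finset.sum_apply,
    Pi.smul_apply]

lemma card_le_of_prod_ge {ι : Type*} [Fintype ι] {w : ι → ℝ} (hw : ∀ i, 0 ≤ w i)
    (hw1 : ∑ i, w i = 1) {n : ℕ} (s : Finset (Fin n → ι)) {x : ℝ}
    (hs : ∀ i ∈ s, (2 : ℝ) ^ (-x) ≤ ∏ t, w (i t)) : (s.card : ℝ) ≤ (2 : ℝ) ^ x := by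
  have h1 : (s.card : ℝ) * (2 : ℝ) ^ (-x) ≤ 1 := by
    calc (s.card : ℝ) * (2 : ℝ) ^ (-x) = ∑ _i ∈ s, (2 : ℝ) ^ (-x) := by
          rw [Finset.sum_const, nsmul_eq_mul]
      _ ≤ ∑ i ∈ s, ∏ t, w (i t) := Finset.sum_le_sum hs
      _ ≤ ∑ i : Fin n → ι, ∏ t, w (i t) :=
          Finset.sum_le_univ_sum_of_nonneg fun i => Finset.prod_nonneg fun t _ => hw _
      _ = 1 := by
          rw [sum_prod_eq_prod_sum fun _ i => w i]
          simp [hw1]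
  rw [Real.rpow_neg (by norm_num), mul_inv_le_iff₀ (by positivity), one_mul] at h1
  exact h1

/-- Eve's output on a random codeword is close to a fixed operator, up to an error of
exponentially small mean, when the outputs of the channel are diagonal. -/
lemma exists_decoupling_rate_of_diagonal {A : κ → Matrix b a ℂ} (hA : IsKraus A)
    {ρ : Matrix a a ℂ} (hρ : IsState ρ) {lB : b → ℝ} {lE : κ → ℝ}
    (hB : bobOutput A ρ = diagonal (fun y => (lB y : ℂ)))
    (hE : eveOutput A ρ = diagonal (fun k => (lE k : ℂ))) {SB SE η : ℝ}
    (hSB : SB = ∑ y, Real.negMulLog (lB y) / Real.log 2)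
    (hSE : SE = ∑ k, Real.negMulLog (lE k) / Real.log 2) (hη : 0 < η) :
    ∃ r : ℝ, 0 < r ∧ r < 1 ∧ ∀ (n : ℕ)
      (e : OrthonormalBasis (Fin n → a) ℂ (EuclideanSpace ℂ (Fin n → a))) (p : (Fin n → a) → ℝ),
      IsSourceEigenbasis ρ e p → (∀ i, 0 ≤ p i) → ∀ T : Finset (Fin n → a),
      1 / 2 ≤ ∑ i ∈ T, p i → ∃ θ : Matrix (Fin n → κ) (Fin n → κ) ℂ, θ.trace = 1 ∧
      ∀ (Ω : Type u) [MeasurableSpace Ω] (μ : Measure Ω) (c : T → Ω → ℂ), HasCodeMoments μ c →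
      ∀ s u : ℝ, 0 < s → 0 < u → ∃ g : Ω → ℝ, Integrable g μ ∧
        (∀ ω, traceNorm (eveOutput (krausPow A n)
          (ketbra (weightedCodeword e T p fun i => c i ω)) - θ) ≤ g ω) ∧
        ∫ ω, g ω ∂μ ≤ 2 * (4 * r ^ n / s + s) +
          ((2 : ℝ) ^ ((n : ℝ) * (SE + η)) * (2 * (2 : ℝ) ^ (-(n : ℝ) * (SB - η))) / u + u) := by
  classical
  -- The joint distribution of outcomes when Eve and Bob measure in their eigenbases; its marginals
  -- are the two output spectra `lE` and `lB`.
  set ν : κ → b → ℝ := fun k y => ((A k * ρ * (A k)ᴴ) y y).re with hν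
  have hpsd : ∀ k, (A k * ρ * (A k)ᴴ).PosSemidef := fun k => hρ.1.mul_mul_conjTranspose_same _
  have hν0 : ∀ k y, 0 ≤ ν k y := fun k y =>
    (Complex.nonneg_iff.1 ((hpsd k).diag_nonneg (i := y))).1
  have hνc : ∀ k y, (A k * ρ * (A k)ᴴ) y y = (ν k y : ℂ) := fun k y => by
    have h1 := (Complex.nonneg_iff.1 ((hpsd k).diag_nonneg (i := y))).2
    exact Complex.ext (by simp [hν]) (by simp [← h1])
  have hlE : ∀ k, ∑ y, ν k y = lE k := fun k => by
    have h1 := congrFun (congrFun hE k) k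
    rw [diagonal_apply_eq] at h1
    have h2 : eveOutput A ρ k k = ∑ y, (ν k y : ℂ) := by
      simp only [eveOutput, Matrix.of_apply, Matrix.trace, Matrix.diag, hνc]
    rw [h2] at h1
    exact_mod_cast h1
  have hlB : ∀ y, ∑ k, ν k y = lB y := fun y => by
    have h1 := congrFun (congrFun hB y) y
    rw [diagonal_apply_eq] at h1
    have h2 : bobOutput A ρ y y = ∑ k, (ν k y : ℂ) := by
      simp only [bobOutput, Matrix.sum_apply, hνc]
    rw [h2] at h1
    exact_mod_cast h1
  have hν1 : ∑ k, ∑ y, ν k y = 1 := by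
    have h1 : ∑ k, (A k * ρ * (A k)ᴴ).trace = 1 := by
      rw [← hρ.2, ← trace_sum]
      have : ∀ k, (A k * ρ * (A k)ᴴ).trace = ((A k)ᴴ * A k * ρ).trace := fun k => by
        rw [trace_mul_comm, Matrix.mul_assoc]
      rw [trace_sum]
      simp only [this]
      rw [← trace_sum, ← Matrix.sum_mul, hA, Matrix.one_mul]
    simp only [Matrix.trace, Matrix.diag, hνc] at h1
    exact_mod_cast h1
  have hlE0 : ∀ k, 0 ≤ lE k := fun k => hlE k ▸ Finset.sum_nonneg fun y _ => hν0 k y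
  have hlB0 : ∀ y, 0 ≤ lB y := fun y => hlB y ▸ Finset.sum_nonneg fun k _ => hν0 k y
  have hlE1 : ∑ k, lE k = 1 := by simp only [← hlE, hν1]
  have hlB1 : ∑ y, lB y = 1 := by simp only [← hlB]; rw [Finset.sum_comm, hν1]
  obtain ⟨r1, hr10, hr11, hr1⟩ := exists_upper_tail_rate hlB0 hlB1 hSB hη
  obtain ⟨r2, hr20, hr21, hr2⟩ := exists_lower_tail_rate hlE0 hlE1 hSE hη
  refine ⟨max r1 r2, lt_max_of_lt_left hr10, max_lt hr11 hr21, fun n e p he hp0 T hT => ?_⟩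
  have hT0 : 0 < ∑ i ∈ T, p i := by linarith
  have hq0 : ∀ i, 0 ≤ typWeight T p i := fun i => div_nonneg (hp0 i) hT0.le
  -- As `T` has mass at least 1/2, sums weighted by `q` over `T` are at most twice the sums over the
  -- full source, whose outputs factorize. All factors 2 below come from this.
  have hq2 : ∀ i, typWeight T p i ≤ 2 * p i := fun i => by
    rw [typWeight, div_le_iff₀ hT0]
    nlinarith [hp0 i]
  have hq1 : ∑ i : T, typWeight T p i = 1 := by
    rw [Finset.sum_coe_sort T (typWeight T p)]
    simp only [typWeight]
    rw [← Finset.sum_div, div_self hT0.ne']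
  -- One-sided typicality suffices: Bob's eigenvalues must not be too large, Eve's not too small.
  set sB : Finset (Fin n → b) :=
    Finset.univ.filter fun y => ∏ t, lB (y t) ≤ (2 : ℝ) ^ (-(n : ℝ) * (SB - η)) with hsB
  set sE : Finset (Fin n → κ) :=
    Finset.univ.filter fun k => (2 : ℝ) ^ (-(n : ℝ) * (SE + η)) ≤ ∏ t, lE (k t) with hsE
  set W : T → Matrix (Fin n → κ) (Fin n → b) ℂ := fun i =>
    ((√(typWeight T p i) : ℝ) : ℂ) • outputAmplitude (krausPow A n) (e i) with hW
  have hWn : ∀ i k y, ‖W i k y‖ ^ 2 =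
      typWeight T p i * ‖outputAmplitude (krausPow A n) (e i) k y‖ ^ 2 := fun i k y => by
    simp only [hW, Matrix.smul_apply, norm_smul, mul_pow, Complex.norm_real, Real.norm_eq_abs,
      sq_abs, Real.sq_sqrt (hq0 _)]
  have hAn := isKraus_krausPow hA n
  have hW1 : ∑ i, hsSq (W i) = 1 := by
    rw [← hq1]
    refine Finset.sum_congr rfl fun i _ => ?_
    have h1 := hsSq_outputAmplitude hAn (e i)
    rw [e.norm_eq_one, one_pow] at h1
    simp only [hsSq, hWn, ← Finset.mul_sum]
    rw [hsSq] at h1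
    rw [h1, mul_one]
  have hspec : ∀ (k : Fin n → κ) (v : (Fin n → b) → ℂ),
      ((∑ i, p i * ‖∑ y, outputAmplitude (krausPow A n) (e i) k y * v y‖ ^ 2 : ℝ) : ℂ) =
        v ⬝ᵥ ((krausPow A n k * (tensorProd fun _ : Fin n => ρ) * (krausPow A n k)ᴴ) *ᵥ
          star v) := by
    intro k v
    have h1 := sum_eigenbasis_norm_sq e he (v ᵥ* krausPow A n k)
    have h2 : ∀ i, (v ᵥ* krausPow A n k) ⬝ᵥ (e i).ofLp =
        ∑ y, outputAmplitude (krausPow A n) (e i) k y * v y := fun i => by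
      rw [← dotProduct_mulVec, dotProduct_comm]
      rfl
    simp only [h2] at h1
    rw [h1, star_vecMul, mulVec_mulVec, ← dotProduct_mulVec, mulVec_mulVec, ← Matrix.mul_assoc]
  have htyp : ∀ f : (Fin n → a) → ℝ, (∀ i, 0 ≤ f i) →
      ∑ i : T, typWeight T p i * f i ≤ 2 * ∑ i, p i * f i := fun f hf => by
    rw [Finset.sum_coe_sort T fun i => typWeight T p i * f i, Finset.mul_sum]
    calc ∑ i ∈ T, typWeight T p i * f i ≤ ∑ i ∈ T, 2 * (p i * f i) := by
          refine Finset.sum_le_sum fun i _ => ?_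
          rw [← mul_assoc]
          exact mul_le_mul_of_nonneg_right (hq2 i) (hf i)
      _ ≤ _ := Finset.sum_le_univ_sum_of_nonneg fun i =>
          mul_nonneg (by norm_num) (mul_nonneg (hp0 i) (hf i))
  have hentry : ∀ k y, ∑ i, p i * ‖outputAmplitude (krausPow A n) (e i) k y‖ ^ 2 =
      ∏ t, ν (k t) (y t) := fun k y => by
    have h1 := hspec k (Pi.single y 1)
    have h2 : star (Pi.single y (1 : ℂ)) = (Pi.single y 1 : (Fin n → b) → ℂ) := by
      rw [← Pi.single_star, star_one]
    rw [h2, single_one_dotProduct, mulVec_single_one, krausPow_mul_mul] at h1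
    have h3 : ∀ i, ∑ y', outputAmplitude (krausPow A n) (e i) k y' *
        (Pi.single y (1 : ℂ) : (Fin n → b) → ℂ) y' =
        outputAmplitude (krausPow A n) (e i) k y := fun i => by
      simp [Pi.single_apply]
    simp only [h3, col_apply, tensorProd, Matrix.of_apply, hνc] at h1
    exact_mod_cast h1
  have hentryW : ∀ k y, ∑ i, ‖W i k y‖ ^ 2 ≤ 2 * ∏ t, ν (k t) (y t) := fun k y => by
    simp only [hWn]
    rw [← hentry]
    exact htyp (fun i => ‖outputAmplitude (krausPow A n) (e i) k y‖ ^ 2) fun i => by positivity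
  -- A deleted entry lies in a deleted row or a deleted column: two tails, each doubled by the
  -- passage from `q` to `p`.
  have hε : ∑ i, hsSq (W i - truncate sE sB (W i)) ≤ 4 * max r1 r2 ^ n := by
    have h1 : ∀ i k y, ‖(W i - truncate sE sB (W i)) k y‖ ^ 2 =
        if k ∈ sE ∧ y ∈ sB then 0 else ‖W i k y‖ ^ 2 := fun i k y => by
      simp only [Matrix.sub_apply, truncate, Matrix.of_apply]
      split_ifs <;> simp
    calc ∑ i, hsSq (W i - truncate sE sB (W i))
        = ∑ k, ∑ y, ∑ i, if k ∈ sE ∧ y ∈ sB then 0 else ‖W i k y‖ ^ 2 := by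
          simp only [hsSq, h1]
          rw [Finset.sum_comm]
          exact Finset.sum_congr rfl fun k _ => Finset.sum_comm
      _ ≤ ∑ k, ∑ y, ((if k ∈ sE then 0 else 2 * ∏ t, ν (k t) (y t)) +
            if y ∈ sB then 0 else 2 * ∏ t, ν (k t) (y t)) := by
          refine Finset.sum_le_sum fun k _ => Finset.sum_le_sum fun y _ => ?_
          have h2 := hentryW k y
          have h3 : 0 ≤ ∏ t, ν (k t) (y t) := Finset.prod_nonneg fun t _ => hν0 _ _
          by_cases c1 : k ∈ sE
          · by_cases c2 : y ∈ sB
            · simp [c1, c2]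
            · simpa [c1, c2] using h2
          · simp only [c1, false_and, if_false]
            split_ifs <;> linarith
      _ = 2 * (∑ k, if k ∈ sE then 0 else ∏ t, lE (k t)) +
            2 * ∑ y, if y ∈ sB then 0 else ∏ t, lB (y t) := by
          simp only [Finset.sum_add_distrib]
          congr 1
          · rw [Finset.mul_sum]
            refine Finset.sum_congr rfl fun k _ => ?_
            split_ifs
            · simp
            · rw [← Finset.mul_sum, sum_prod_eq_prod_sum fun t y => ν (k t) y]
              simp only [hlE]
          · rw [Finset.sum_comm, Finset.mul_sum]
            refine Finset.sum_congr rfl fun y _ => ?_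
            split_ifs
            · simp
            · rw [← Finset.mul_sum, sum_prod_eq_prod_sum fun t k => ν k (y t)]
              simp only [hlB]
      _ ≤ 2 * r2 ^ n + 2 * r1 ^ n := by
          have t1 : (∑ k, if k ∈ sE then 0 else ∏ t, lE (k t)) ≤ r2 ^ n := by
            have : ∀ k : Fin n → κ, (if k ∈ sE then 0 else ∏ t, lE (k t)) =
                if k ∉ sE then ∏ t, lE (k t) else 0 := fun k => by split_ifs <;> tauto
            simp only [this]
            rw [← Finset.sum_filter]
            refine hr2 n _ fun k hk => ?_
            have h2 := (Finset.mem_filter.1 hk).2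
            rw [hsE, Finset.mem_filter, not_and] at h2
            exact not_le.1 (h2 (Finset.mem_univ _))
          have t2 : (∑ y, if y ∈ sB then 0 else ∏ t, lB (y t)) ≤ r1 ^ n := by
            have : ∀ y : Fin n → b, (if y ∈ sB then 0 else ∏ t, lB (y t)) =
                if y ∉ sB then ∏ t, lB (y t) else 0 := fun k => by split_ifs <;> tauto
            simp only [this]
            rw [← Finset.sum_filter]
            refine hr1 n _ fun k hk => ?_
            have h2 := (Finset.mem_filter.1 hk).2
            rw [hsB, Finset.mem_filter, not_and] at h2
            exact not_le.1 (h2 (Finset.mem_univ _))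
          linarith
      _ ≤ _ := by
          have m1 : r1 ^ n ≤ max r1 r2 ^ n := by gcongr; exact le_max_left _ _
          have m2 : r2 ^ n ≤ max r1 r2 ^ n := by gcongr; exact le_max_right _ _
          linarith
  set m : ℝ := 2 * (2 : ℝ) ^ (-(n : ℝ) * (SB - η)) with hm
  have hm0 : 0 ≤ m := by positivity
  -- Summing over Eve and the whole source leaves the quadratic form of Bob's output, which is
  -- diagonal with entries `∏ lB`. On vectors supported in `sB` it is therefore bounded by the
  -- threshold.
  have hbob : ∀ v : (Fin n → b) → ℂ,
      ∑ k, ∑ i, p i * ‖∑ y, outputAmplitude (krausPow A n) (e i) k y * v y‖ ^ 2 =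
        ∑ y, (∏ t, lB (y t)) * ‖v y‖ ^ 2 := fun v => by
    have h1 : ((∑ k, ∑ i, p i *
        ‖∑ y, outputAmplitude (krausPow A n) (e i) k y * v y‖ ^ 2 : ℝ) : ℂ) =
        ((∑ y, (∏ t, lB (y t)) * ‖v y‖ ^ 2 : ℝ) : ℂ) := by
      rw [Complex.ofReal_sum, Finset.sum_congr rfl fun k _ => hspec k v, ← dotProduct_sum,
        ← Matrix.sum_mulVec]
      have h2 : ∑ k, krausPow A n k * (tensorProd fun _ : Fin n => ρ) * (krausPow A n k)ᴴ =
          diagonal fun y => ∏ t, (lB (y t) : ℂ) := by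
        rw [← tensorProd_diagonal fun y => (lB y : ℂ), ← hB, ← bobOutput_krausPow]
        rfl
      rw [h2, dotProduct, Complex.ofReal_sum]
      refine Finset.sum_congr rfl fun y _ => ?_
      rw [mulVec_diagonal, Complex.ofReal_mul, Complex.ofReal_pow, ← Complex.mul_conj',
        Complex.ofReal_prod, Pi.star_apply, RCLike.star_def]
      ring
    exact_mod_cast h1
  have hmv : ∀ v : (Fin n → b) → ℂ, (∀ y, y ∉ sB → v y = 0) →
      ∑ i, ∑ k, ‖∑ y, W i k y * v y‖ ^ 2 ≤ m * ∑ y, ‖v y‖ ^ 2 := fun v hv => by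
    calc ∑ i, ∑ k, ‖∑ y, W i k y * v y‖ ^ 2
        = ∑ k, ∑ i : T, typWeight T p i *
            ‖∑ y, outputAmplitude (krausPow A n) (e i) k y * v y‖ ^ 2 := by
          rw [Finset.sum_comm]
          refine Finset.sum_congr rfl fun k _ => Finset.sum_congr rfl fun i _ => ?_
          simp only [hW, Matrix.smul_apply, smul_eq_mul, mul_assoc, ← Finset.mul_sum]
          rw [norm_mul, mul_pow, Complex.norm_real, Real.norm_eq_abs, sq_abs,
            Real.sq_sqrt (hq0 _)]
      _ ≤ ∑ k, 2 * ∑ i, p i * ‖∑ y, outputAmplitude (krausPow A n) (e i) k y * v y‖ ^ 2 :=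
          Finset.sum_le_sum fun k _ =>
            htyp (fun i => ‖∑ y, outputAmplitude (krausPow A n) (e i) k y * v y‖ ^ 2)
              fun i => by positivity
      _ = 2 * ∑ y, (∏ t, lB (y t)) * ‖v y‖ ^ 2 := by rw [← Finset.mul_sum, hbob]
      _ ≤ m * ∑ y, ‖v y‖ ^ 2 := by
          rw [hm, mul_assoc, Finset.mul_sum (a := (2 : ℝ) ^ (-(n : ℝ) * (SB - η)))]
          refine mul_le_mul_of_nonneg_left (Finset.sum_le_sum fun y _ => ?_) (by norm_num)
          by_cases hy : y ∈ sB
          · rw [hsB, Finset.mem_filter] at hy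
            exact mul_le_mul_of_nonneg_right hy.2 (by positivity)
          · simp [hv y hy]
  have hcard : (sE.card : ℝ) ≤ (2 : ℝ) ^ ((n : ℝ) * (SE + η)) := by
    refine card_le_of_prod_ge hlE0 hlE1 sE fun k hk => ?_
    rw [hsE, Finset.mem_filter] at hk
    rw [← neg_mul]
    exact hk.2
  refine ⟨∑ i, W i * (W i)ᴴ, ?_, fun Ω _ μ c hc s u hs hu => ?_⟩
  · rw [trace_sum, Finset.sum_congr rfl fun i _ => trace_mul_conjTranspose_self (W i),
      ← Complex.ofReal_sum, hW1, Complex.ofReal_one]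
  · obtain ⟨g, hg1, hg2, hg3⟩ := hc.exists_dominating W sE sB hW1 hm0 hε hmv hs hu
    refine ⟨g, hg1, fun ω => ?_, hg3.trans ?_⟩
    · have h1 : outputAmplitude (krausPow A n) (weightedCodeword e T p fun i => c i ω) =
          ∑ i, c i ω • W i := by
        rw [weightedCodeword, outputAmplitude_sum_smul]
        refine Finset.sum_congr rfl fun i _ => ?_
        simp only [hW]
        rw [smul_smul, mul_comm]
      rw [eveOutput_ketbra, h1]
      exact hg2 ω
    · gcongr

end CodewordDecoupling

/-! ### Random codes -/

section RandomCodes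

universe u

/-- Markov's inequality for an average over independent copies. -/
lemma ofReal_le_pi_of_average_lt {Ω : Type*} [MeasurableSpace Ω] (μ : Measure Ω)
    [IsProbabilityMeasure μ] {N : ℕ} (hN : 0 < N) {g : Ω → ℝ} (hg : Integrable g μ)
    (hg0 : ∀ ω, 0 ≤ g ω) {s B : ℝ} (hs : 0 < s) (hB : ∫ ω, g ω ∂μ ≤ B * s)
    {S : Set (Fin N → Ω)} (hS : ∀ x, (N : ℝ)⁻¹ * ∑ α, g (x α) < s → x ∈ S) :
    ENNReal.ofReal (1 - B) ≤ Measure.pi (fun _ : Fin N => μ) S := by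
  have hN' : (0 : ℝ) < N := by exact_mod_cast hN
  set P := Measure.pi fun _ : Fin N => μ with hP
  set G : (Fin N → Ω) → ℝ := fun x => (N : ℝ)⁻¹ * ∑ α, g (x α) with hG
  have hmp : ∀ α : Fin N, MeasurePreserving (Function.eval α) P μ :=
    fun α => measurePreserving_eval (fun _ : Fin N => μ) α
  have hgi : ∀ α : Fin N, Integrable (fun x : Fin N → Ω => g (x α)) P :=
    fun α => (hmp α).integrable_comp_of_integrable hg
  have hge : ∀ α : Fin N, ∫ x, g (x α) ∂P = ∫ ω, g ω ∂μ := fun α => by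
    rw [← (hmp α).map_eq, integral_map (hmp α).measurable.aemeasurable
      ((hmp α).map_eq.symm ▸ hg.aestronglyMeasurable)]
  have hGi : Integrable G P := (integrable_finsetSum _ fun α _ => hgi α).const_mul _
  have hGe : ∫ x, G x ∂P = ∫ ω, g ω ∂μ := by
    simp only [hG]
    rw [integral_const_mul, integral_finsetSum _ fun α _ => hgi α]
    simp only [hge, Finset.sum_const, Finset.card_univ, Fintype.card_fin, nsmul_eq_mul]
    rw [← mul_assoc, inv_mul_cancel₀ hN'.ne', one_mul]
  have hG0 : ∀ x, 0 ≤ G x := fun x =>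
    mul_nonneg (inv_nonneg.2 hN'.le) (Finset.sum_nonneg fun α _ => hg0 _)
  have hmk := mul_meas_ge_le_integral_of_nonneg (Filter.Eventually.of_forall hG0) hGi s
  have hreal : P.real {x | s ≤ G x} ≤ B := by
    rw [hGe] at hmk
    have := hmk.trans hB
    rw [mul_comm B] at this
    exact le_of_mul_le_mul_left this hs
  -- Only subadditivity is used, so `S` need not be measurable.
  have hcover : (Set.univ : Set (Fin N → Ω)) ⊆ S ∪ {x | s ≤ G x} := fun x _ => by
    by_cases h : s ≤ G x
    · exact Or.inr h
    · exact Or.inl (hS x (not_le.1 h))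
  have h1 : 1 ≤ P.real S + P.real {x | s ≤ G x} := by
    rw [← probReal_univ (μ := P)]
    exact (measureReal_mono hcover).trans (measureReal_union_le _ _)
  rw [← ofReal_measureReal (measure_ne_top P S)]
  exact ENNReal.ofReal_le_ofReal (by linarith)

variable {a : Type u} {b κ : Type*} [Fintype a] [DecidableEq a] [Fintype b] [DecidableEq b]
  [Fintype κ] [DecidableEq κ]

/-- At positive coherent information, Eve's output on a random codeword is close to a fixed
operator, up to an error of exponentially small mean. -/
lemma exists_decoupling_rate {A : κ → Matrix b a ℂ} (hA : IsKraus A) {ρ : Matrix a a ℂ}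
    (hρ : IsState ρ) (hI : 0 < coherentInfo A ρ) :
    ∃ r : ℝ, 0 < r ∧ r < 1 ∧ ∀ (n : ℕ)
      (e : OrthonormalBasis (Fin n → a) ℂ (EuclideanSpace ℂ (Fin n → a))) (p : (Fin n → a) → ℝ),
      IsSourceEigenbasis ρ e p → (∀ i, 0 ≤ p i) → ∀ T : Finset (Fin n → a),
      1 / 2 ≤ ∑ i ∈ T, p i → ∃ θ : Matrix (Fin n → κ) (Fin n → κ) ℂ, θ.trace = 1 ∧
      ∀ (Ω : Type u) [MeasurableSpace Ω] (μ : Measure Ω) (c : T → Ω → ℂ), HasCodeMoments μ c →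
      ∃ g : Ω → ℝ, Integrable g μ ∧
        (∀ ω, traceNorm (eveOutput (krausPow A n)
          (ketbra (weightedCodeword e T p fun i => c i ω)) - θ) ≤ g ω) ∧
        ∫ ω, g ω ∂μ ≤ 13 * r ^ n := by
  obtain ⟨A', UE, lB, lE, hA', hUE, hB, hE, hSB, hSE, hrot⟩ :=
    exists_diagonalizing_rotation hA hρ.1.isHermitian
  set SB := entropy (bobOutput A ρ)
  set SE := entropy (eveOutput A ρ)
  have hI' : 0 < SB - SE := hI
  -- Then `(SE + η) - (SB - η) = -2η`, so the fluctuation term is `2 w^{2n}` with `w = 2^{-η}`.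
  set η := (SB - SE) / 4 with hη
  have hη0 : 0 < η := by positivity
  obtain ⟨r, hr0, hr1, hr⟩ := exists_decoupling_rate_of_diagonal hA' hρ hB hE hSB hSE hη0
  set q := √r with hq
  have hq0 : 0 < q := Real.sqrt_pos.2 hr0
  have hq1 : q < 1 := by rw [hq, Real.sqrt_lt' one_pos]; simpa using hr1
  have hqr : q * q = r := Real.mul_self_sqrt hr0.le
  set w := (2 : ℝ) ^ (-η) with hw
  have hw0 : 0 < w := by positivity
  have hw1 : w < 1 := Real.rpow_lt_one_of_one_lt_of_neg (by norm_num) (by linarith)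
  refine ⟨max q w, lt_max_of_lt_left hq0, max_lt hq1 hw1, fun n e p he hp0 T hT => ?_⟩
  obtain ⟨θ, hθ, hg⟩ := hr n e p he hp0 T hT
  set W : Matrix (Fin n → κ) (Fin n → κ) ℂ := tensorProd fun _ => UE with hW
  have hWW : Wᴴ * W = 1 := tensorProd_isometry hUE
  refine ⟨W * θ * Wᴴ, ?_, fun Ω _ μ c hc => ?_⟩
  · rw [trace_mul_comm, ← Matrix.mul_assoc, hWW, Matrix.one_mul, hθ]
  -- Square roots of the error terms serve as the AM–GM weights. The total is `2(4 + 1) q^n + (2 +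
  -- 1) w^n`, whence the constant 13.
  · obtain ⟨g, hg1, hg2, hg3⟩ := hg Ω μ c hc (q ^ n) (w ^ n) (pow_pos hq0 n) (pow_pos hw0 n)
    refine ⟨g, hg1, fun ω => ?_, hg3.trans ?_⟩
    · rw [hrot, ← hW, ← Matrix.sub_mul, ← Matrix.mul_sub]
      exact (traceNorm_unitary_conj_le hWW _).trans (hg2 ω)
    · have e1 : 4 * r ^ n / q ^ n = 4 * q ^ n := by
        rw [← hqr, mul_pow]
        field_simp
      have e2 : (2 : ℝ) ^ ((n : ℝ) * (SE + η)) * (2 * (2 : ℝ) ^ (-(n : ℝ) * (SB - η))) =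
          2 * (w ^ n * w ^ n) := by
        have h1 : w ^ n = (2 : ℝ) ^ (-η * n) := by
          rw [hw, ← Real.rpow_natCast, ← Real.rpow_mul (by norm_num)]
        rw [h1, mul_left_comm, ← Real.rpow_add (by norm_num), ← Real.rpow_add (by norm_num)]
        congr 2
        rw [hη]
        ring
      have e3 : 2 * (w ^ n * w ^ n) / w ^ n = 2 * w ^ n := by field_simp
      rw [e1, e2, e3]
      have m1 : q ^ n ≤ max q w ^ n := by gcongr; exact le_max_left _ _
      have m2 : w ^ n ≤ max q w ^ n := by gcongr; exact le_max_right _ _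
      linarith

lemma lloydCodeword_eq {a : Type*} [Fintype a] {n : ℕ}
    (e : OrthonormalBasis (Fin n → a) ℂ (EuclideanSpace ℂ (Fin n → a)))
    (T : Finset (Fin n → a)) (p : (Fin n → a) → ℝ) (θ : (Fin n → a) → UnitAddCircle) :
    lloydCodeword e T p θ = weightedCodeword e T p fun i => (AddCircle.toCircle (θ i) : ℂ) :=
  (Finset.sum_coe_sort T fun i =>
    (((√(typWeight T p i) : ℝ) : ℂ) * (AddCircle.toCircle (θ i) : ℂ)) • e i).symm

lemma distortedCodeword_eq {a : Type*} [Fintype a] {n : ℕ}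
    (e : OrthonormalBasis (Fin n → a) ℂ (EuclideanSpace ℂ (Fin n → a)))
    (T : Finset (Fin n → a)) (p : (Fin n → a) → ℝ)
    (φ : Metric.sphere (0 : EuclideanSpace ℂ T) 1) :
    distortedCodeword e T p φ =
      weightedCodeword e T p fun i => ((√(Fintype.card T : ℝ) : ℝ) : ℂ) * φ.1 i := by
  rw [distortedCodeword, weightedCodeword]
  refine Finset.sum_congr rfl fun i _ => ?_
  rw [Fintype.card_coe]
  congr 1
  push_cast
  ring

/-- Polynomial factors are absorbed by a slightly larger exponential rate. -/
lemma exists_rate_absorbing {q : ℝ} (hq0 : 0 < q) (hq1 : q < 1) (l : ℝ) :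
    ∃ z : ℝ, 0 < z ∧ z < 1 ∧ ∀ᶠ n : ℕ in Filter.atTop, 13 * q ^ n ≤ z ^ n ∧
      (4 * q ^ n * (n * l + 1) + (1 / 2) ^ n) / Real.log 2 ≤ z ^ n := by
  -- Taking `z = √x` leaves a spare factor `z^n` to absorb the constant 13 and the factor linear in
  -- `n`.
  set x := max q (1 / 2) with hx
  have hx0 : 0 < x := lt_max_of_lt_left hq0
  have hx1 : x < 1 := max_lt hq1 (by norm_num)
  set z := √x with hz
  have hz0 : 0 < z := Real.sqrt_pos.2 hx0
  have hz1 : z < 1 := by rw [hz, Real.sqrt_lt' one_pos]; simpa using hx1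
  have hzx : z * z = x := Real.mul_self_sqrt hx0.le
  refine ⟨z, hz0, hz1, ?_⟩
  have hl2 : 0 < Real.log 2 := Real.log_pos (by norm_num)
  have t1 : Filter.Tendsto (fun n : ℕ => z ^ n) Filter.atTop (nhds 0) :=
    tendsto_pow_atTop_nhds_zero_of_lt_one hz0.le hz1
  have t2 : Filter.Tendsto (fun n : ℕ => (n : ℝ) * z ^ n) Filter.atTop (nhds 0) :=
    tendsto_self_mul_const_pow_of_lt_one hz0.le hz1
  have t3 : Filter.Tendsto (fun n : ℕ => 4 * |l| * ((n : ℝ) * z ^ n) + 5 * z ^ n)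
      Filter.atTop (nhds 0) := by
    simpa using (t2.const_mul (4 * |l|)).add (t1.const_mul 5)
  have t4 : Filter.Tendsto (fun n : ℕ => 13 * z ^ n) Filter.atTop (nhds 0) := by
    simpa using t1.const_mul 13
  filter_upwards [t4.eventually_lt_const one_pos, t3.eventually_lt_const hl2] with n h1 h2
  have hzn : 0 < z ^ n := pow_pos hz0 n
  have hqz : q ^ n ≤ z ^ n * z ^ n := by
    rw [← mul_pow, hzx]
    gcongr
    exact le_max_left _ _
  have h2z : (1 / 2 : ℝ) ^ n ≤ z ^ n * z ^ n := by
    rw [← mul_pow, hzx]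
    gcongr
    exact le_max_right _ _
  have hqn : 0 < q ^ n := pow_pos hq0 n
  refine ⟨by nlinarith, ?_⟩
  rw [div_le_iff₀ hl2]
  have h3 : q ^ n * (n * l + 1) ≤ z ^ n * z ^ n * (n * |l| + 1) := by
    calc q ^ n * (n * l + 1) ≤ q ^ n * (n * |l| + 1) := by
          gcongr
          exact le_abs_self l
      _ ≤ _ := by gcongr
  nlinarith

/-- A code drawn from independent random codewords with the right moments is private with high
probability. -/
lemma ofReal_le_pi_isPrivate {a b κ : Type*} [Fintype a] [DecidableEq a] [Fintype b]
    [Fintype κ] [DecidableEq κ] {A : κ → Matrix b a ℂ} (hA : IsKraus A) {n N : ℕ} (hN : 0 < N)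
    {Ω : Type*} [MeasurableSpace Ω] (μ : Measure Ω) [IsProbabilityMeasure μ]
    (C : Ω → EuclideanSpace ℂ (Fin n → a)) {θ : Matrix (Fin n → κ) (Fin n → κ) ℂ}
    (hθ : θ.trace = 1) {g : Ω → ℝ} (hg : Integrable g μ)
    (hgC : ∀ ω, traceNorm (eveOutput (krausPow A n) (ketbra (C ω)) - θ) ≤ g ω) {q ε : ℝ}
    (hq : 0 < q) (hgq : ∫ ω, g ω ∂μ ≤ 13 * (q ^ n * q ^ n)) (h1 : 13 * q ^ n ≤ ε)
    (h2 : (4 * q ^ n * (n * Real.log (2 * (Fintype.card κ + 1)) + 1) + (1 / 2) ^ n) /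
      Real.log 2 ≤ ε) :
    ENNReal.ofReal (1 - ε) ≤ Measure.pi (fun _ : Fin N => μ)
      {x | IsPrivate (krausPow A n) (fun α => C (x α)) ε} := by
  have hqn : 0 < q ^ n := pow_pos hq n
  refine (ENNReal.ofReal_le_ofReal (by linarith)).trans
    (ofReal_le_pi_of_average_lt μ hN hg (fun ω => (traceNorm_nonneg _).trans (hgC ω)) hqn
      (B := 13 * q ^ n) (by linarith) fun x hx => ?_)
  have hN' : (0 : ℝ) < N := by exact_mod_cast hN
  have hK : (0 : ℝ) < 2 * (Fintype.card κ + 1) := by positivity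
  set l := Real.log (2 * (Fintype.card κ + 1)) with hl
  have hl0 : 0 ≤ l := Real.log_nonneg (by
    have : (0 : ℝ) ≤ Fintype.card κ := by positivity
    linarith)
  -- With this slope the dimension term is `(|κ| / (2(|κ| + 1)))^n ≤ 2^{-n}`; adding 1 to `|κ|`
  -- keeps the logarithm nonnegative even for empty `κ`.
  refine isPrivate_of_avgDist_le (isKraus_krausPow hA n) hN _ hθ (s := q ^ n) (L := n * l) ?_
    (by positivity) (by linarith) (le_trans ?_ h2)
  · refine le_trans ?_ hx.le
    rw [avgDist]
    gcongr with α
    exact hgC _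
  · have h3 : (Fintype.card (Fin n → κ) : ℝ) * Real.exp (-(n * l)) ≤ (1 / 2) ^ n := by
      have h4 : Real.exp (-(n * l)) = ((2 * ((Fintype.card κ : ℝ) + 1)) ^ n)⁻¹ := by
        rw [Real.exp_neg, Real.exp_nat_mul, hl, Real.exp_log hK]
      rw [h4, Fintype.card_fun, Fintype.card_fin, Nat.cast_pow, ← inv_pow, ← mul_pow]
      have h5 : (Fintype.card κ : ℝ) * (2 * ((Fintype.card κ : ℝ) + 1))⁻¹ ≤ 1 / 2 := by
        rw [mul_inv_le_iff₀ hK]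
        linarith
      gcongr
    have hl2 : 0 < Real.log 2 := Real.log_pos (by norm_num)
    gcongr

end RandomCodes

end QPrivacy

/-! ### Choice of the exponent and conclusion for both ensembles. -/

theorem mainTheorem1 {a b κ : Type*} [Fintype a] [DecidableEq a] [Fintype b] [DecidableEq b]
    [Fintype κ] [DecidableEq κ]
    (A : κ → Matrix b a ℂ) (hA : QPrivacy.IsKraus A)
    (ρ : Matrix a a ℂ) (hρ : QPrivacy.IsState ρ)
    (R : ℝ) (hR0 : 0 ≤ R) (hR : R < QPrivacy.coherentInfo A ρ)
    (δ : ℝ) (hδ : 0 < δ) :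
    ∃ c : ℝ, 0 < c ∧ ∃ n₀ : ℕ, ∀ n : ℕ, n₀ ≤ n →
      ∀ (e : OrthonormalBasis (Fin n → a) ℂ (EuclideanSpace ℂ (Fin n → a)))
        (p : (Fin n → a) → ℝ), QPrivacy.IsSourceEigenbasis ρ e p →
      ∀ (T : Finset (Fin n → a)), T = QPrivacy.typical (QPrivacy.entropy ρ) δ p →
      ∀ N : ℕ, N = ⌊(2 : ℝ) ^ ((n : ℝ) * R)⌋₊ →
        ENNReal.ofReal (1 - (2 : ℝ) ^ (-c * (n : ℝ))) ≤
          QPrivacy.lloydLaw a n N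
            {θ | QPrivacy.IsPrivate (QPrivacy.krausPow A n)
              (fun α => QPrivacy.lloydCodeword e T p (θ α)) ((2 : ℝ) ^ (-c * (n : ℝ)))} ∧
        ENNReal.ofReal (1 - (2 : ℝ) ^ (-c * (n : ℝ))) ≤
          QPrivacy.distortedLaw T N
            {φ | QPrivacy.IsPrivate (QPrivacy.krausPow A n)
              (fun α => QPrivacy.distortedCodeword e T p (φ α)) ((2 : ℝ) ^ (-c * (n : ℝ)))} := by
  open QPrivacy in
  obtain ⟨r, hr0, hr1, hr⟩ := exists_decoupling_rate hA hρ (hR0.trans_lt hR)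
  obtain ⟨r', hr'0, hr'1, hr'⟩ := exists_typical_mass_rate hρ hδ
  have hq0 : 0 < √r := Real.sqrt_pos.2 hr0
  have hq1 : √r < 1 := by rw [Real.sqrt_lt' one_pos]; simpa using hr1
  -- Markov's inequality splits the mean deviation `13 r^n`: one factor `√r^n` is the deviation
  -- tolerated, the other bounds the failure probability.
  have hqr : ∀ n : ℕ, r ^ n = √r ^ n * √r ^ n := fun n => by
    rw [← mul_pow, Real.mul_self_sqrt hr0.le]
  obtain ⟨z, hz0, hz1, hz⟩ := exists_rate_absorbing hq0 hq1
    (Real.log (2 * (Fintype.card κ + 1)))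
  -- The typical mass is at least `1 - 2 r'^n`, so this makes it exceed 1/2.
  have hmass : ∀ᶠ n : ℕ in Filter.atTop, r' ^ n < 1 / 4 :=
    (tendsto_pow_atTop_nhds_zero_of_lt_one hr'0.le hr'1).eventually_lt_const (by norm_num)
  obtain ⟨n₀, hn₀⟩ := Filter.eventually_atTop.1 (hz.and hmass)
  refine ⟨-Real.logb 2 z, neg_pos.2 (Real.logb_neg (by norm_num) hz0 hz1), n₀,
    fun n hn e p he T hT N hN => ?_⟩
  have hε : (2 : ℝ) ^ (- -Real.logb 2 z * (n : ℝ)) = z ^ n := by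
    rw [neg_neg, Real.rpow_mul (by norm_num), Real.rpow_logb (by norm_num) (by norm_num) hz0,
      Real.rpow_natCast]
  rw [hε]
  obtain ⟨⟨h1, h2⟩, h3⟩ := hn₀ n hn
  obtain ⟨hp0, hpT⟩ := hr' n e p he
  rw [← hT] at hpT
  have hN0 : 0 < N := by
    rw [hN, Nat.floor_pos]
    exact Real.one_le_rpow (by norm_num) (by positivity)
  obtain ⟨θ, hθ, hg⟩ := hr n e p he hp0 T (by linarith)
  -- The unit sphere of the typical subspace carries a probability measure only if that subspace is
  -- nonzero.
  have hne : Nonempty T := by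
    rw [Finset.nonempty_coe_sort, Finset.nonempty_iff_ne_empty]
    rintro rfl
    rw [Finset.sum_empty] at hpT
    linarith
  constructor
  · obtain ⟨g, hg1, hg2, hg3⟩ := hg _ _ _
      (hasCodeMoments_toCircle (fun i : T => (i : Fin n → a)) Subtype.val_injective)
    simp only [← lloydCodeword_eq] at hg2
    rw [hqr] at hg3
    exact ofReal_le_pi_isPrivate hA hN0 _ (lloydCodeword e T p) hθ hg1 hg2 hq0 hg3 h1 h2
  · obtain ⟨g, hg1, hg2, hg3⟩ := hg _ _ _ (hasCodeMoments_sphere (ι := T))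
    simp only [← distortedCodeword_eq] at hg2
    rw [hqr] at hg3
    have := isProbabilityMeasure_uniformSphere (ι := T)
    exact ofReal_le_pi_isPrivate hA hN0 _ (distortedCodeword e T p) hθ hg1 hg2 hq0 hg3 h1 h2
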